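/- **Theorem (Breakdown condition).** Let $K\ge 2$ and let $p_{ij}=p_{ji}\in[0,1]$ ($i\ne j$) be fixed. Consider a sequence of random graphs on one probability space following the random interconnection model (RIM): the nodes are partitioned into $K$ clusters of (deterministic) sizes $n_1,\dots,n_K$, with $n=\sum_k n_k$; the subgraph inside each cluster is almost surely connected and otherwise arbitrary (deterministic, or random and independent of the edges between clusters); the edges between different clusters are mutually independent, an edge between a node of cluster $i$ and a node of cluster $j\neq i$ being present with probability $p_{ij}$. No relation between the graphs for different size vectors is assumed. Along the sequence no vector $(n_1,\dots,n_K)$ occurs twice, $n_k\to\infty$ for all $k$, and $n_{\min}/n_{\max}\to c>0$, where $n_{\min}=\min_k n_k$ and $n_{\max}=\max_k n_k$. Let $\mathbf L=\mathbf D-\mathbf A$ be the graph Laplacian of the whole graph, $\lambda_1(\mathbf L)\le\lambda_2(\mathbf L)\le\cdots$ its eigenvalues with multiplicity, and let $\mathbf Y\in\mathbb R^{n\times(K-1)}$ be any minimizer of $\operatorname{trace}(\mathbf X^T\mathbf L\mathbf X)$ over $\mathbf X\in\mathbb R^{n\times(K-1)}$ with $\mathbf X^T\mathbf X=\mathbf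 I_{K-1}$ and $\mathbf X^T\mathbf 1_n=\mathbf 0$ (in particular, any matrix of orthonormal eigenvectors, orthogonal to $\mathbf 1_n$, for $\lambda_2(\mathbf L),\dots,\lambda_K(\mathbf L)$). Let $\mathbf Y_k$ be the block of the rows of $\mathbf Y$ indexed by cluster $k$. Let $\widetilde{\mathbf A}$ be the $(K-1)\times(K-1)$ matrix with $$[\widetilde{\mathbf A}]_{ii}=(n_i+n_K)\,p_{iK}+\sum_{z=1,\,z\ne i}^{K-1}n_z\,p_{iz},\qquad [\widetilde{\mathbf A}]_{ij}=n_i\,(p_{iK}-p_{ij})\quad(i\ne j).$$ Then almost surely the following holds. If the differences $\frac{\lambda_i(\widetilde{\mathbf A})}{n}-\frac{\lambda_j(\mathbf L)}{n}$, $i=1,\dots,K-1$, $j=2,\dots,K$, are asymptotically nonzero, i.e. for some $\varepsilon>0$ all of them are at least $\varepsilon$ in absolute value for all sufficiently late graphs of the sequence, then for every choice of the minimizers $\mathbf Y$, $$\mathbf Y_k^T\mathbf 1_{n_k}\to\mathbf 0_{K-1}\qquad\text{for every } k=1,\dots,K,$$ and hence spectral clustering fails: for all sufficiently late graphs of the sequence,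 no optimal K-means partition of the rows of $\mathbf Y$ into $K$ groups coincides with the partition into the true clusters. -/

import Mathlib

open MeasureTheory ProbabilityTheory Filter Topology

/-- Nodes of a graph with `r + 1` clusters of sizes `n k`: a cluster label `k` together with a
position inside that cluster. -/
abbrev ClusterNode {r : ℕ} (n : Fin (r + 1) → ℕ) : Type := Σ k : Fin (r + 1), Fin (n k)

/-- The random interconnection model with `r + 1` clusters of sizes `n k` and interconnection
probabilities `p i j`, `i ≠ j`. The subgraph induced on each cluster is connected and otherwise
arbitrary; it may be deterministic, or random and independent of the edges between clusters.
The edges between different clusters are mutually independent, an edge between clusters `i` and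
`j` being present with probability `p i j`. -/
structure IsRIM {Ω : Type*} [MeasurableSpace Ω] (P : Measure Ω) {r : ℕ}
    (n : Fin (r + 1) → ℕ) (p : Fin (r + 1) → Fin (r + 1) → ℝ)
    (G : Ω → SimpleGraph (ClusterNode n)) : Prop where
  measurable_adj : ∀ u v : ClusterNode n, MeasurableSet {ω | (G ω).Adj u v}
  connected_cluster : ∀ᵐ ω ∂P, ∀ k : Fin (r + 1),
    ((G ω).comap (fun x : Fin (n k) => (⟨k, x⟩ : ClusterNode n))).Connected
  prob_inter : ∀ u v : ClusterNode n, u.1 ≠ v.1 →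
    P {ω | (G ω).Adj u v} = ENNReal.ofReal (p u.1 v.1)
  indep_inter : iIndepSet
    (fun e : {e : ClusterNode n × ClusterNode n // e.1.1 < e.2.1} =>
      {ω | (G ω).Adj e.1.1 e.1.2}) P
  indep_intra_inter : Indep
    (MeasurableSpace.generateFrom
      {s : Set Ω | ∃ u v : ClusterNode n, u.1 = v.1 ∧ s = {ω | (G ω).Adj u v}})
    (MeasurableSpace.generateFrom
      {s : Set Ω | ∃ u v : ClusterNode n, u.1 ≠ v.1 ∧ s = {ω | (G ω).Adj u v}}) P

open Classical in
/-- The graph Laplacian `L = D - A` as a real matrix. -/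
noncomputable def graphLaplacian {V : Type*} [Fintype V] (G : SimpleGraph V) : Matrix V V ℝ :=
  G.lapMatrix ℝ

theorem graphLaplacian_isHermitian {V : Type*} [Fintype V] (G : SimpleGraph V) :
    (graphLaplacian G).IsHermitian := by
  classical
  exact SimpleGraph.isHermitian_lapMatrix ℝ G

/-- Laplacian eigenvalues listed in increasing order with multiplicity, starting from index `0`:
the value at `j` is the `(j + 1)`-th smallest eigenvalue. -/
noncomputable def laplacianEigenvalue {V : Type*} [Fintype V] [DecidableEq V]
    (G : SimpleGraph V) (j : Fin (Fintype.card V)) : ℝ :=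
  (graphLaplacian_isHermitian G).eigenvalues₀ j.rev

/-- Feasible matrices of the spectral clustering problem: orthonormal columns, each of which is
orthogonal to the all-ones vector. -/
def IsSpectralFeasible {V : Type*} [Fintype V] {r : ℕ} (X : Matrix V (Fin r) ℝ) : Prop :=
  X.transpose * X = 1 ∧ X.transpose.mulVec (fun _ => 1) = 0

/-- `Y` solves the spectral clustering problem for the matrix `L`: it minimizes
`trace (Xᵀ L X)` over all feasible `X`. -/
def IsSpectralSolution {V : Type*} [Fintype V] {r : ℕ} (L : Matrix V V ℝ)
    (Y : Matrix V (Fin r) ℝ) : Prop :=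
  IsSpectralFeasible Y ∧ ∀ X : Matrix V (Fin r) ℝ, IsSpectralFeasible X →
    (Y.transpose * L * Y).trace ≤ (X.transpose * L * X).trace

/-- The block of rows of `Y` belonging to cluster `k`. -/
def clusterBlock {r : ℕ} {n : Fin (r + 1) → ℕ} (Y : Matrix (ClusterNode n) (Fin r) ℝ)
    (k : Fin (r + 1)) : Matrix (Fin (n k)) (Fin r) ℝ :=
  Y.submatrix (fun x => ⟨k, x⟩) id

/-- The matrix `Ã`; the last cluster plays the role of the index `K = r + 1`. -/
def breakdownMatrix {r : ℕ} (n : Fin (r + 1) → ℕ) (p : Fin (r + 1) → Fin (r + 1) → ℝ) :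
    Matrix (Fin r) (Fin r) ℝ :=
  Matrix.of fun i j =>
    if i = j then
      ((n i.castSucc : ℝ) + n (Fin.last r)) * p i.castSucc (Fin.last r)
        + ∑ z ∈ Finset.univ.erase i, (n z.castSucc : ℝ) * p i.castSucc z.castSucc
    else
      (n i.castSucc : ℝ) * (p i.castSucc (Fin.last r) - p i.castSucc j.castSucc)

/-- The number of nodes `n`. -/
def totalSize {r : ℕ} (n : Fin (r + 1) → ℕ) : ℕ := ∑ k, n k

/-- The size of the smallest cluster. -/
def minSize {r : ℕ} (n : Fin (r + 1) → ℕ) : ℕ := Finset.univ.inf' Finset.univ_nonempty n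

/-- The size of the largest cluster. -/
def maxSize {r : ℕ} (n : Fin (r + 1) → ℕ) : ℕ := Finset.univ.sup' Finset.univ_nonempty n

/-- The K-means cost of the rows of `Y` for the assignment `s` and the centers `c`. -/
def kMeansCost {V : Type*} [Fintype V] {r K : ℕ} (Y : Matrix V (Fin r) ℝ)
    (s : V → Fin K) (c : Fin K → Fin r → ℝ) : ℝ :=
  ∑ v, ∑ j, (Y v j - c (s v) j) ^ 2

/-- `s` is an optimal K-means assignment of the rows of `Y` to `K` groups. -/
def IsKMeansSolution {V : Type*} [Fintype V] {r K : ℕ} (Y : Matrix V (Fin r) ℝ)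
    (s : V → Fin K) : Prop :=
  ∃ c : Fin K → Fin r → ℝ, ∀ (s' : V → Fin K) (c' : Fin K → Fin r → ℝ),
    kMeansCost Y s c ≤ kMeansCost Y s' c'

/-- The assignment `s` recovers the true clusters, up to a relabelling. -/
def RecoversClusters {r : ℕ} {n : Fin (r + 1) → ℕ} (s : ClusterNode n → Fin (r + 1)) : Prop :=
  ∃ π : Equiv.Perm (Fin (r + 1)), ∀ v, s v = π v.1

/-! Let N be the number of nodes, K = r + 1, and let y be a unit eigenvector of L orthogonal to the
all-ones vector, with eigenvalue l among the second to the K-th. Summing L y = l y over a cluster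
kills the Laplacian inside it. Since the cluster sums add up to zero, the vector s of the first r of
them satisfies (l - Ã) s = e, where e is built from the inner products of blocks of y with the
degree deviations b_ij(x) = (number of neighbours of x in cluster j) - n_j p_ij. The spectral gap
gives |det((l - Ã)/N)| ≥ ε^r, and the entries of (l - Ã)/N are bounded, so s is at most a constant
times the largest |e_i|/N (`abs_clusterSum_le`). Everything reduces to e = o(N).

A net argument bounds the centred adjacency blocks by O(√N) in operator norm (`CrossBound`). Hence
b_ij has norm O(N), which yields only s = O(1). The obstacle is that y depends on the same edges as
b_ij. It is overcome by showing that the block y_i almost lies in a low-dimensional space determined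
by the graph inside cluster i, which is independent of b_ij. With the bound on s, the eigenvalue
equation on cluster i says that (L_i + θ) y_i has norm O(√N), where θ approximates the mean outer
degree minus l, once a small set of rows is discarded (`sum_shiftedRows_mulVec_sq_le`). So y_i is
close to the span of the right singular vectors with singular value at most c√N, the near-kernel. As
L_i + θ is a diagonal matrix minus an adjacency matrix of Hilbert–Schmidt norm at most N, that span
has dimension at most a small multiple of N if the diagonal exceeds 2c√N on almost all rows
(`card_nearKernelIndex_le`). For a fixed inner graph, Hoeffding's inequality and a union bound over
discarded sets, shifts and nets make all projections of b_ij onto such near-kernels at most ηN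
(`ae_eventually_projection_le`).

The diagonal is large for a variational reason. If many nodes had small inner degree,
anti-concentration of the outer degrees, independent of the inner graph, would give r + 1 of them
total degree well below l, and test vectors supported there would contradict minimality
(`IsSpectralSolution.exists_le_nodeDeg`). This uses p_ij strictly between 0 and 1; otherwise b_ij
vanishes almost surely.

The exceptional events have probability at most C exp(-cN), which is summable over distinct size
vectors. A minimizer is an orthogonal transform of a matrix of eigenvectors, so its cluster sums
tend to zero as well. Then splitting the nodes into their true clusters hardly lowers the K-means
cost below r, while isolating one row of squared norm at least r/N lowers it by at least r/N. -/

set_option linter.unusedSectionVars false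

/-! ### Concentration, conditioning and anti-concentration for independent indicators -/

section ProbabilityTools

variable {Ω : Type*} [mΩ : MeasurableSpace Ω] {P : Measure Ω} [IsProbabilityMeasure P]

theorem integral_indicator_one_const {A : Set Ω} (hA : MeasurableSet A) (a : ℝ) :
    ∫ ω, a * A.indicator (fun _ => (1 : ℝ)) ω ∂P = a * P.real A := by
  rw [integral_const_mul, integral_indicator_const _ hA]
  simp

/-- A centred weighted indicator is sub-Gaussian. -/
theorem hasSubgaussianMGF_mul_indicator {A : Set Ω} (hA : MeasurableSet A) (a : ℝ) :
    HasSubgaussianMGF (fun ω => a * (A.indicator (fun _ => (1 : ℝ)) ω - P.real A))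
      ((‖a‖₊ / 2) ^ 2) P := by
  have hm : AEMeasurable (fun ω => a * A.indicator (fun _ => (1 : ℝ)) ω) P :=
    ((measurable_const.indicator hA).const_mul a).aemeasurable
  have hb : ∀ᵐ ω ∂P, a * A.indicator (fun _ => (1 : ℝ)) ω ∈ Set.Icc (min 0 a) (max 0 a) := by
    refine ae_of_all _ fun ω => ?_
    by_cases h : ω ∈ A <;> simp [h]
  have h := hasSubgaussianMGF_of_mem_Icc hm hb
  have hn : ‖max 0 a - min 0 a‖₊ = ‖a‖₊ := by
    rw [max_sub_min_eq_abs]; simp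
  rw [hn, integral_indicator_one_const hA] at h
  simpa only [mul_sub] using h

theorem hasSubgaussianMGF_sum_mul_indicator {ι : Type*} [Fintype ι] {A : ι → Set Ω}
    (hA : ∀ i, MeasurableSet (A i)) (h : iIndepSet A P) (a : ι → ℝ) :
    HasSubgaussianMGF
      (fun ω => ∑ i, a i * ((A i).indicator (fun _ => (1 : ℝ)) ω - P.real (A i)))
      (∑ i, (‖a i‖₊ / 2) ^ 2) P := by
  have hi : iIndepFun (fun i ω => a i * ((A i).indicator (fun _ => (1 : ℝ)) ω - P.real (A i))) P :=
    (h.iIndepFun_indicator (β := ℝ)).comp (fun i x => a i * (x - P.real (A i)))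
      (fun i => by fun_prop)
  exact HasSubgaussianMGF.sum_of_iIndepFun hi
    (fun i _ => hasSubgaussianMGF_mul_indicator (hA i) (a i))

/-- Hoeffding's inequality for weighted sums of independent indicators. -/
theorem measureReal_sum_mul_indicator_ge_le {ι : Type*} [Fintype ι] {A : ι → Set Ω}
    (hA : ∀ i, MeasurableSet (A i)) (h : iIndepSet A P) (a : ι → ℝ) {t s : ℝ} (ht : 0 ≤ t)
    (hs : 0 < s) (has : ∑ i, a i ^ 2 ≤ s) :
    P.real {ω | t ≤ ∑ i, a i * ((A i).indicator (fun _ => (1 : ℝ)) ω - P.real (A i))}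
      ≤ Real.exp (-(2 * t ^ 2 / s)) := by
  have key := (hasSubgaussianMGF_sum_mul_indicator hA h a).measure_ge_le ht
  have hc : ((∑ i, (‖a i‖₊ / 2) ^ 2 : NNReal) : ℝ) = (∑ i, a i ^ 2) / 4 := by
    push_cast
    rw [Finset.sum_div]
    refine Finset.sum_congr rfl fun i _ => ?_
    rw [div_pow, Real.norm_eq_abs, sq_abs]; norm_num
  rw [hc] at key
  -- The sub-Gaussian exponent has the sum of squares in its denominator, so vanishing weights are
  -- treated apart.
  rcases (Finset.sum_nonneg fun i _ => sq_nonneg (a i)).eq_or_lt with h0 | h0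
  · have ha : ∀ i, a i = 0 := by
      intro i
      have := (Finset.sum_eq_zero_iff_of_nonneg (fun i _ => sq_nonneg (a i))).1 h0.symm i
        (Finset.mem_univ i)
      exact pow_eq_zero_iff (two_ne_zero) |>.1 this
    rcases ht.eq_or_lt with rfl | ht
    · simp
    · simp [ha, not_le.2 ht, (Real.exp_pos _).le]
  · refine key.trans (Real.exp_le_exp.2 ?_)
    rw [neg_div, neg_le_neg_iff]
    rw [div_le_div_iff₀ hs (by positivity)]
    nlinarith [sq_nonneg t]

/-- If `h` takes finitely many values, is measurable for `m₁`, and `m₁` is independent of `m₂`,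
then the union bound conditional on `h` holds. -/
theorem measureReal_mem_comp_le_of_indep {m₁ m₂ : MeasurableSpace Ω} (hm₁ : m₁ ≤ mΩ)
    (hi : Indep m₁ m₂ P) {α : Type*} [Finite α] (h : Ω → α)
    (hh : ∀ a, MeasurableSet[m₁] (h ⁻¹' {a})) (F : α → Set Ω)
    (hF : ∀ a, MeasurableSet[m₂] (F a)) {δ : ℝ} (hδ : ∀ a, P.real (F a) ≤ δ) :
    P.real {ω | ω ∈ F (h ω)} ≤ δ := by
  classical
  have := Fintype.ofFinite α
  have hsub : {ω | ω ∈ F (h ω)} ⊆ ⋃ a ∈ (Finset.univ : Finset α), (h ⁻¹' {a} ∩ F a) := by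
    intro ω hω
    simp only [Finset.mem_univ, Set.iUnion_true, Set.mem_iUnion]
    exact ⟨h ω, rfl, hω⟩
  have hsum : ∑ a, P.real (h ⁻¹' {a}) = 1 := by
    rw [← measureReal_biUnion_finset]
    · have : (⋃ a ∈ (Finset.univ : Finset α), h ⁻¹' {a}) = Set.univ := by
        ext ω; simp
      rw [this]; simp
    · intro a _ b _ hab
      exact Set.disjoint_left.2 fun ω h1 h2 => hab (by simp at h1 h2; rw [← h1, ← h2])
    · exact fun a _ => hm₁ _ (hh a)
  calc P.real {ω | ω ∈ F (h ω)}
      ≤ P.real (⋃ a ∈ (Finset.univ : Finset α), (h ⁻¹' {a} ∩ F a)) := measureReal_mono hsub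
    _ ≤ ∑ a, P.real (h ⁻¹' {a} ∩ F a) := measureReal_biUnion_finset_le _ _
    _ = ∑ a, P.real (h ⁻¹' {a}) * P.real (F a) := by
        refine Finset.sum_congr rfl fun a _ => ?_
        simp only [measureReal_def, (Indep_iff m₁ m₂ P).1 hi _ _ (hh a) (hF a), ENNReal.toReal_mul]
    _ ≤ ∑ a, P.real (h ⁻¹' {a}) * δ := by gcongr with a _; exact hδ a
    _ = δ := by rw [← Finset.sum_mul, hsum, one_mul]

/-- Sets that are measurable for disjoint blocks of an independent family are independent. -/
theorem iIndepSet_of_iIndep_prod {α β : Type*} {m : α × β → MeasurableSpace Ω}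
    (hm : ∀ e, m e ≤ mΩ) (h : iIndep m P) (F : α → Set Ω)
    (hF : ∀ a, MeasurableSet[⨆ e ∈ {e : α × β | e.1 = a}, m e] (F a)) : iIndepSet F P := by
  classical
  have hle : ∀ S : Set (α × β), (⨆ e ∈ S, m e) ≤ mΩ :=
    fun S => iSup₂_le fun e _ => hm e
  rw [iIndepSet_iff_meas_biInter (fun a => hle _ _ (hF a))]
  intro s
  induction s using Finset.induction_on with
  | empty => simp
  | insert a s ha ih =>
    rw [Finset.set_biInter_insert, Finset.prod_insert ha, ← ih]
    have hd : Disjoint {e : α × β | e.1 = a} {e : α × β | e.1 ∈ s} := by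
      refine Set.disjoint_left.2 fun e h1 h2 => ha ?_
      simp only [Set.mem_ofPred_eq] at h1 h2
      rwa [← h1]
    refine (Indep_iff _ _ P).1 (indep_iSup_of_disjoint hm h hd) _ _ (hF a) ?_
    refine Finset.measurableSet_biInter _ fun b hb => ?_
    have hle' : (⨆ e ∈ {e : α × β | e.1 = b}, m e) ≤ ⨆ e ∈ {e : α × β | e.1 ∈ s}, m e := by
      refine biSup_mono fun e he => ?_
      simp only [Set.mem_ofPred_eq] at he ⊢
      rwa [he]
    exact hle' _ (hF b)

theorem one_add_add_sq_div_four_le_exp {x : ℝ} (hx : |x| ≤ 1) :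
    1 + x + x ^ 2 / 4 ≤ Real.exp x := by
  have h := Real.exp_bound hx (n := 3) (by norm_num)
  have h' := (abs_le.1 h).1
  simp [Finset.sum_range_succ, Nat.factorial] at h'
  have h3 : |x| ^ 3 ≤ x ^ 2 := by
    rw [pow_succ, sq_abs]; nlinarith [sq_nonneg x]
  nlinarith

theorem exp_half_le_one_add {u : ℝ} (h0 : 0 ≤ u) (h1 : u ≤ 1) : Real.exp (u / 2) ≤ 1 + u := by
  have h := Real.exp_bound' (x := u / 2) (by linarith) (by linarith) (n := 2) (by norm_num)
  simp [Finset.sum_range_succ, Nat.factorial] at h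
  nlinarith

/-- Integrating 1 + x + x²/4 ≤ exp x at the centred variable removes the linear term and leaves a
quarter of the variance. As an indicator equals its square, the lower bound is affine in it. -/
theorem mgf_indicator_ge {A : Set Ω} (hA : MeasurableSet A) {s : ℝ} (hs : |s| ≤ 1) :
    1 + s ^ 2 * (P.real A * (1 - P.real A)) / 4
      ≤ mgf (fun ω => A.indicator (fun _ => (1 : ℝ)) ω - P.real A) P s := by
  have hp0 : 0 ≤ P.real A := measureReal_nonneg
  have hp1 : P.real A ≤ 1 := measureReal_le_one
  set p := P.real A with hp
  have hmeas : Measurable fun ω => A.indicator (fun _ => (1 : ℝ)) ω :=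
    measurable_const.indicator hA
  have hbd : ∀ ω, A.indicator (fun _ => (1 : ℝ)) ω = 1 ∨ A.indicator (fun _ => (1 : ℝ)) ω = 0 := by
    intro ω; by_cases h : ω ∈ A <;> simp [h]
  have hpt : ∀ ω, 1 + s ^ 2 * p ^ 2 / 4 - s * p +
      (s + s ^ 2 * (1 - 2 * p) / 4) * A.indicator (fun _ => (1 : ℝ)) ω ≤
        Real.exp (s * (A.indicator (fun _ => (1 : ℝ)) ω - p)) := by
    intro ω
    have hle : |s * (A.indicator (fun _ => (1 : ℝ)) ω - p)| ≤ 1 := by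
      rw [abs_mul]
      refine mul_le_one₀ hs (abs_nonneg _) ?_
      rcases hbd ω with h | h <;> rw [h] <;> rw [abs_le] <;> constructor <;> linarith
    refine le_trans (le_of_eq ?_) (one_add_add_sq_div_four_le_exp hle)
    rcases hbd ω with h | h <;> rw [h] <;> ring
  have hint : Integrable (fun ω => A.indicator (fun _ => (1 : ℝ)) ω) P :=
    (integrable_const (1 : ℝ)).indicator hA
  have hint2 : Integrable (fun ω => Real.exp (s * (A.indicator (fun _ => (1 : ℝ)) ω - p))) P := by
    refine integrable_exp_mul_of_mem_Icc (a := -1) (b := 1) (by fun_prop) (ae_of_all _ fun ω => ?_)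
    rcases hbd ω with h | h <;> simp only [h] <;> constructor <;> linarith
  have hmono := integral_mono (((integrable_const _).add (hint.const_mul _))) hint2 hpt
  refine le_trans (le_of_eq ?_) hmono
  rw [integral_add' (integrable_const _) (hint.const_mul _), integral_indicator_one_const hA,
    integral_const]
  simp only [probReal_univ, smul_eq_mul, one_mul, ← hp]
  ring

/-- Paley–Zygmund inequality. -/
theorem sq_integral_div_le_measureReal {Z : Ω → ℝ} (hZ : Measurable Z)
    (h1 : Integrable Z P) (h2 : Integrable (fun ω => Z ω ^ 2) P) (hpos : 0 < ∫ ω, Z ω ∂P)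
    {M : ℝ} (hM : 0 < M) (hZM : ∫ ω, Z ω ^ 2 ∂P ≤ M) :
    (∫ ω, Z ω ∂P) ^ 2 / (4 * M) ≤ P.real {ω | (∫ ω, Z ω ∂P) / 2 ≤ Z ω} := by
  set e := ∫ ω, Z ω ∂P with he
  set F := {ω | e / 2 ≤ Z ω} with hF
  have hFm : MeasurableSet F := measurableSet_le measurable_const hZ
  -- On F, Z is at most β Z²/2 + 1/(2β) by the arithmetic-geometric mean inequality; this β makes
  -- the second-moment term at most e/4.
  set β := e / (2 * M) with hβ
  have hβ0 : 0 < β := by positivity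
  have hpt : ∀ ω, Z ω ≤ e / 2 + (β / 2 * Z ω ^ 2 +
      1 / (2 * β) * F.indicator (fun _ => (1 : ℝ)) ω) := by
    intro ω
    by_cases h : ω ∈ F
    · have hq : 0 ≤ (β * Z ω - 1) ^ 2 / (2 * β) := by positivity
      have : (β * Z ω - 1) ^ 2 / (2 * β) = β / 2 * Z ω ^ 2 + 1 / (2 * β) * 1 - Z ω := by
        field_simp; ring
      simp only [h, Set.indicator_of_mem]
      linarith
    · have h' : Z ω < e / 2 := by simpa [hF] using h
      simp only [h, not_false_eq_true, Set.indicator_of_notMem]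
      have := sq_nonneg (Z ω)
      have : 0 ≤ β / 2 * Z ω ^ 2 := by positivity
      linarith
  have hint : Integrable (fun ω => F.indicator (fun _ => (1 : ℝ)) ω) P :=
    (integrable_const (1 : ℝ)).indicator hFm
  have hmono := integral_mono h1
    ((integrable_const (e / 2)).add ((h2.const_mul (β / 2)).add (hint.const_mul (1 / (2 * β)))))
    hpt
  rw [integral_add' (integrable_const _) ((h2.const_mul (β / 2)).add (hint.const_mul _)),
    integral_add' (h2.const_mul (β / 2)) (hint.const_mul _), integral_indicator_one_const hFm,
    integral_const, integral_const_mul] at hmono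
  simp only [probReal_univ, smul_eq_mul, one_mul, ← he] at hmono
  have h3 : β / 2 * ∫ ω, Z ω ^ 2 ∂P ≤ e / 4 := by
    calc β / 2 * ∫ ω, Z ω ^ 2 ∂P ≤ β / 2 * M := by gcongr
      _ = e / 4 := by rw [hβ]; field_simp; norm_num
  have h4 : e / 4 ≤ 1 / (2 * β) * P.real F := by linarith
  have h5 : 1 / (2 * β) = M / e := by rw [hβ]; field_simp
  rw [h5] at h4
  rw [div_le_iff₀ (by positivity)]
  rw [div_mul_eq_mul_div, le_div_iff₀ hpos] at h4
  nlinarith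

/-- A sum of independent centred indicators, a positive fraction of which is nondegenerate, is
below `-C √N` with probability bounded away from zero. -/
theorem exists_le_measureReal_sum_indicator_le (P : Measure Ω) [IsProbabilityMeasure P]
    {v κ C : ℝ} (hv : 0 < v) (hv1 : v ≤ 1) (hκ : 0 < κ) (hC : 0 ≤ C) :
    ∃ q : ℝ, 0 < q ∧ ∃ N₀ : ℝ, ∀ (ι : Type) [Fintype ι] (A : ι → Set Ω),
      (∀ i, MeasurableSet (A i)) → iIndepSet A P → ∀ N : ℝ, N₀ ≤ N → (Fintype.card ι : ℝ) ≤ N →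
      ∀ J : Finset ι, (∀ i ∈ J, v ≤ P.real (A i) * (1 - P.real (A i))) → κ * N ≤ J.card →
      q ≤ P.real {ω | ∑ i, ((A i).indicator (fun _ => (1 : ℝ)) ω - P.real (A i)) ≤
        -(C * √N)} := by
  classical
  -- Exponential tilt: apply Paley–Zygmund to Z = exp(-sX) with s = h/√N. Its mean is at least
  -- exp(κvh²/8) and its second moment at most exp(h²/2). On the resulting event -sX ≥ κvh²/8 - 1,
  -- and h is so large that this is at least (C + 1)h - 1 ≥ Ch. The threshold h² for N ensures s ≤
  -- 1.
  set h : ℝ := 8 * (C + 1) / (κ * v) + 1 with hh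
  have hh1 : 1 ≤ h := by
    have : 0 ≤ 8 * (C + 1) / (κ * v) := by positivity
    linarith
  have hhC : C + 1 ≤ κ * v * h / 8 := by
    have : κ * v * h = 8 * (C + 1) + κ * v := by rw [hh]; field_simp
    have : 0 < κ * v := by positivity
    linarith
  refine ⟨Real.exp (-(h ^ 2 / 2)) / 4, by positivity, h ^ 2, ?_⟩
  intro ι _ A hA hind N hN hcard J hJ hJN
  have hN1 : 0 < N := by nlinarith
  have hsN : 0 < √N := Real.sqrt_pos.2 hN1
  have hhs : h ≤ √N := Real.le_sqrt_of_sq_le hN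
  set s : ℝ := h / √N with hs
  have hs0 : 0 < s := by positivity
  have hs1 : s ≤ 1 := by rw [hs, div_le_one hsN]; exact hhs
  have hs2 : s ^ 2 * N = h ^ 2 := by
    rw [hs, div_pow, Real.sq_sqrt hN1.le]; field_simp
  set X : Ω → ℝ := fun ω => ∑ i, ((A i).indicator (fun _ => (1 : ℝ)) ω - P.real (A i)) with hX
  have hXm : Measurable X := by
    refine Finset.measurable_sum _ fun i _ => ?_
    exact (measurable_const.indicator (hA i)).sub_const _
  have hsub : HasSubgaussianMGF X (∑ i : ι, (‖(1 : ℝ)‖₊ / 2) ^ 2) P := by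
    simpa only [one_mul] using hasSubgaussianMGF_sum_mul_indicator hA hind (fun _ => (1 : ℝ))
  have hXind : iIndepFun (fun i ω => (A i).indicator (fun _ => (1 : ℝ)) ω - P.real (A i)) P :=
    (hind.iIndepFun_indicator (β := ℝ)).comp (fun i x => x - P.real (A i)) (fun i => by fun_prop)
  have hprod : mgf X P (-s) = ∏ i, mgf (fun ω => (A i).indicator (fun _ => (1 : ℝ)) ω
      - P.real (A i)) P (-s) := by
    have := hXind.mgf_sum (t := -s)
      (fun i => (measurable_const.indicator (hA i)).sub_const _) Finset.univ
    rw [← this, hX]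
    congr 1
    ext ω
    simp
  set Z : Ω → ℝ := fun ω => Real.exp (-s * X ω) with hZ
  have hlow : Real.exp (κ * v * h ^ 2 / 8) ≤ ∫ ω, Z ω ∂P := by
    change _ ≤ mgf X P (-s)
    rw [hprod]
    have hge : ∀ i, 1 + s ^ 2 * (P.real (A i) * (1 - P.real (A i))) / 4 ≤ mgf (fun ω =>
        (A i).indicator (fun _ => (1 : ℝ)) ω - P.real (A i)) P (-s) := fun i => by
      have := mgf_indicator_ge (P := P) (hA i) (s := -s) (by rw [abs_neg, abs_of_pos hs0]; exact hs1)
      rwa [neg_sq] at this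
    have hvar : ∀ i, 0 ≤ P.real (A i) * (1 - P.real (A i)) := fun i =>
      mul_nonneg measureReal_nonneg (sub_nonneg.2 measureReal_le_one)
    calc Real.exp (κ * v * h ^ 2 / 8) ≤ (Real.exp (s ^ 2 * v / 4 / 2)) ^ J.card := by
          rw [← Real.exp_nat_mul]
          refine Real.exp_le_exp.2 ?_
          have : κ * v * h ^ 2 / 8 = κ * N * (s ^ 2 * v / 4 / 2) := by rw [← hs2]; ring
          rw [this]
          gcongr
      _ = ∏ i, if i ∈ J then Real.exp (s ^ 2 * v / 4 / 2) else 1 := by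
          rw [Finset.prod_ite_mem, Finset.univ_inter, Finset.prod_const]
      _ ≤ ∏ i, mgf (fun ω => (A i).indicator (fun _ => (1 : ℝ)) ω - P.real (A i)) P (-s) := by
          refine Finset.prod_le_prod (fun i _ => by split_ifs <;> positivity) fun i _ => ?_
          refine le_trans ?_ (hge i)
          split_ifs with hi
          · refine le_trans (exp_half_le_one_add (by positivity) ?_) ?_
            · have : s ^ 2 ≤ 1 := pow_le_one₀ hs0.le hs1
              nlinarith
            · have := hJ i hi
              gcongr
          · have := hvar i
            have : 0 ≤ s ^ 2 * (P.real (A i) * (1 - P.real (A i))) / 4 := by positivity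
            linarith
  have hup : ∫ ω, Z ω ^ 2 ∂P ≤ Real.exp (h ^ 2 / 2) := by
    have h1 : (fun ω => Z ω ^ 2) = fun ω => Real.exp ((-2 * s) * X ω) := by
      ext ω; rw [hZ, ← Real.exp_nat_mul]; congr 1; push_cast; ring
    rw [h1]
    refine (hsub.mgf_le (-2 * s)).trans (Real.exp_le_exp.2 ?_)
    have hc : ((∑ i : ι, (‖(1 : ℝ)‖₊ / 2) ^ 2 : NNReal) : ℝ) = (Fintype.card ι : ℝ) / 4 := by
      push_cast
      simp; ring
    rw [hc, ← hs2]
    nlinarith [sq_nonneg s]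
  have hpos : 0 < ∫ ω, Z ω ∂P := (Real.exp_pos _).trans_le hlow
  have hone : 1 ≤ ∫ ω, Z ω ∂P := le_trans (Real.one_le_exp (by positivity)) hlow
  have hZ2 : Integrable (fun ω => Z ω ^ 2) P := by
    have h1 : (fun ω => Z ω ^ 2) = fun ω => Real.exp ((-2 * s) * X ω) := by
      ext ω; rw [hZ, ← Real.exp_nat_mul]; congr 1; push_cast; ring
    rw [h1]
    exact hsub.integrable_exp_mul _
  have hPZ := sq_integral_div_le_measureReal (P := P) (Z := Z) (by fun_prop)
    (hsub.integrable_exp_mul (-s)) hZ2 hpos (Real.exp_pos _) hup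
  calc Real.exp (-(h ^ 2 / 2)) / 4 = 1 ^ 2 / (4 * Real.exp (h ^ 2 / 2)) := by
        rw [Real.exp_neg]; field_simp
    _ ≤ (∫ ω, Z ω ∂P) ^ 2 / (4 * Real.exp (h ^ 2 / 2)) := by gcongr
    _ ≤ P.real {ω | (∫ ω, Z ω ∂P) / 2 ≤ Z ω} := hPZ
    _ ≤ _ := by
        refine measureReal_mono fun ω hω => ?_
        simp only [Set.mem_ofPred_eq] at hω ⊢
        change X ω ≤ _
        have h2 : Real.exp (κ * v * h ^ 2 / 8 - 1) ≤ Real.exp (-s * X ω) := by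
          refine le_trans ?_ (le_trans (div_le_div_of_nonneg_right hlow zero_le_two) hω)
          rw [Real.exp_sub]
          gcongr
          have := Real.add_one_le_exp 1
          linarith
        have h3 := Real.exp_le_exp.1 h2
        have h4 : s * √N = h := by rw [hs]; field_simp
        have h5 : s * X ω ≤ s * (-(C * √N)) := by
          have : s * (-(C * √N)) = -(C * h) := by rw [← h4]; ring
          rw [this]
          nlinarith
        exact le_of_mul_le_mul_left h5 hs0

/-! ### Nets of exponential size in the Euclidean ball -/

theorem exists_int_abs_le_abs_sub_le_one (x : ℝ) :
    ∃ z : ℤ, |(z : ℝ)| ≤ |x| ∧ |x - z| ≤ 1 := by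
  rcases le_total 0 x with h | h
  · refine ⟨⌊x⌋, ?_, ?_⟩
    · rw [abs_of_nonneg h, abs_of_nonneg (by exact_mod_cast Int.floor_nonneg.2 h)]
      exact Int.floor_le x
    · rw [abs_le]; constructor <;> linarith [Int.floor_le x, Int.lt_floor_add_one x]
  · refine ⟨⌈x⌉, ?_, ?_⟩
    · rw [abs_of_nonpos h, abs_of_nonpos (by exact_mod_cast Int.ceil_nonpos.2 h)]
      linarith [Int.le_ceil x]
    · rw [abs_le]; constructor <;> linarith [Int.le_ceil x, Int.ceil_lt_add_one x]

theorem sum_Icc_exp_neg_sq_le (R : ℕ) :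
    ∑ z ∈ Finset.Icc (-(R : ℤ)) R, Real.exp (-(z : ℝ) ^ 2) ≤ Real.exp 2 := by
  -- The subtracted geometric term lets the induction close, since exp(-(R+1)²) ≤ 2^(-(R+1)) occurs
  -- twice at each step.
  have key : ∑ z ∈ Finset.Icc (-(R : ℤ)) R, Real.exp (-(z : ℝ) ^ 2) ≤ 3 - 2 * (1 / 2) ^ R := by
    induction R with
    | zero => simp; norm_num
    | succ R ih =>
      have hset : Finset.Icc (-((R + 1 : ℕ) : ℤ)) (R + 1 : ℕ) =
          insert (-((R + 1 : ℕ) : ℤ)) (insert ((R + 1 : ℕ) : ℤ) (Finset.Icc (-(R : ℤ)) R)) := by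
        ext z
        simp only [Finset.mem_Icc, Finset.mem_insert]
        push_cast
        omega
      rw [hset, Finset.sum_insert (by simp; omega), Finset.sum_insert (by simp)]
      have hexp : Real.exp (-((R + 1 : ℕ) : ℝ) ^ 2) ≤ (1 / 2) ^ (R + 1) := by
        calc Real.exp (-((R + 1 : ℕ) : ℝ) ^ 2) ≤ Real.exp (((R + 1 : ℕ) : ℝ) * (-1)) := by
              refine Real.exp_le_exp.2 ?_
              push_cast
              nlinarith [(Nat.cast_nonneg R : (0 : ℝ) ≤ R)]
          _ = (Real.exp (-1)) ^ (R + 1) := by rw [Real.exp_nat_mul]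
          _ ≤ (1 / 2) ^ (R + 1) := by
              gcongr
              rw [Real.exp_neg, ← one_div]
              have := Real.add_one_le_exp 1
              gcongr
              linarith
      have h1 : Real.exp (-((-((R + 1 : ℕ) : ℤ) : ℤ) : ℝ) ^ 2) ≤ (1 / 2) ^ (R + 1) := by
        refine le_trans (le_of_eq ?_) hexp
        push_cast; ring_nf
      have h2 : Real.exp (-((((R + 1 : ℕ) : ℤ)) : ℝ) ^ 2) ≤ (1 / 2) ^ (R + 1) := by
        exact_mod_cast hexp
      have h3 : ((1 : ℝ) / 2) ^ (R + 1) = (1 / 2) ^ R / 2 := by rw [pow_succ]; ring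
      rw [h3] at h1 h2 ⊢
      linarith
  have h2 := Real.add_one_le_exp 2
  have : (0 : ℝ) ≤ (1 / 2) ^ R := by positivity
  linarith

/-- A finite `1/2`-net of the Euclidean unit ball of `ι → ℝ` of exponential cardinality. -/
theorem exists_unitBall_net (ι : Type*) [Fintype ι] :
    ∃ S : Finset (ι → ℝ), (S.card : ℝ) ≤ Real.exp (6 * Fintype.card ι) ∧
      (∀ x ∈ S, ∑ i, x i ^ 2 ≤ 1) ∧
      ∀ (a : ι → ℝ) (t : ℝ), (∀ x ∈ S, ∑ i, x i * a i ≤ t) → √(∑ i, a i ^ 2) ≤ 2 * t := by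
  classical
  set k := Fintype.card ι with hk
  -- The net consists of the points z/(2√k) with z integral and |z|² ≤ 4k. Weighting each z by
  -- exp(4k - |z|²) ≥ 1 factorises the count over coordinates, giving exp(4k) · exp(2)^k.
  set T : Finset (ι → ℤ) := (Fintype.piFinset fun _ => Finset.Icc (-((4 * k : ℕ) : ℤ)) (4 * k : ℕ)).filter
    (fun z => ∑ i, (z i : ℝ) ^ 2 ≤ 4 * k) with hT
  refine ⟨T.image fun z i => (z i : ℝ) / (2 * √k), ?_, ?_, ?_⟩
  · calc ((T.image fun z i => (z i : ℝ) / (2 * √k)).card : ℝ) ≤ T.card := by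
          exact_mod_cast Finset.card_image_le
      _ = ∑ z ∈ T, (1 : ℝ) := by simp
      _ ≤ ∑ z ∈ T, Real.exp (4 * k) * ∏ i, Real.exp (-(z i : ℝ) ^ 2) := by
          refine Finset.sum_le_sum fun z hz => ?_
          rw [← Real.exp_sum, ← Real.exp_add]
          refine Real.one_le_exp ?_
          have := (Finset.mem_filter.1 hz).2
          rw [Finset.sum_neg_distrib]
          linarith
      _ ≤ ∑ z ∈ Fintype.piFinset fun _ => Finset.Icc (-((4 * k : ℕ) : ℤ)) (4 * k : ℕ),
            Real.exp (4 * k) * ∏ i, Real.exp (-(z i : ℝ) ^ 2) := by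
          refine Finset.sum_le_sum_of_subset_of_nonneg (Finset.filter_subset _ _) fun z _ _ => ?_
          positivity
      _ = Real.exp (4 * k) * ∏ i : ι, ∑ z ∈ Finset.Icc (-((4 * k : ℕ) : ℤ)) (4 * k : ℕ),
            Real.exp (-(z : ℝ) ^ 2) := by
          rw [← Finset.mul_sum, Finset.prod_univ_sum]
      _ ≤ Real.exp (4 * k) * ∏ i : ι, Real.exp 2 := by
          gcongr with i
          exact sum_Icc_exp_neg_sq_le _
      _ = Real.exp (6 * k) := by
          rw [Finset.prod_const, Finset.card_univ, ← Real.exp_nat_mul, ← Real.exp_add, ← hk]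
          ring_nf
  · intro x hx
    obtain ⟨z, hz, rfl⟩ := Finset.mem_image.1 hx
    have h := (Finset.mem_filter.1 hz).2
    simp only [div_pow, mul_pow, Real.sq_sqrt (Nat.cast_nonneg k), ← Finset.sum_div]
    exact div_le_one_of_le₀ (by linarith) (by positivity)
  · intro a t hS
    have ht : 0 ≤ t := by
      have := hS (fun i => ((0 : ℤ) : ℝ) / (2 * √k)) (Finset.mem_image.2 ⟨fun _ => 0, by simp [hT], rfl⟩)
      simpa using this
    set A := √(∑ i, a i ^ 2) with hA
    have hA0 : 0 ≤ A := Real.sqrt_nonneg _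
    rcases hA0.eq_or_lt with h0 | hApos
    · linarith
    have hAsq : A ^ 2 = ∑ i, a i ^ 2 := Real.sq_sqrt (Finset.sum_nonneg fun i _ => sq_nonneg _)
    have hkpos : 0 < (k : ℝ) := by
      rw [hk, Nat.cast_pos, Fintype.card_pos_iff]
      by_contra hne
      rw [not_nonempty_iff] at hne
      simp [hA] at hApos
    have hsk : 0 < √(k : ℝ) := Real.sqrt_pos.2 hkpos
    -- Rounding towards zero keeps the lattice point in the ball. The error per coordinate is at
    -- most 1/(2√k), hence at most 1/2 in norm, which accounts for the factor 2 in the conclusion.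
    choose z hz1 hz2 using fun i => exists_int_abs_le_abs_sub_le_one (2 * √k * (a i / A))
    have hzsq : ∑ i, (z i : ℝ) ^ 2 ≤ 4 * k := by
      calc ∑ i, (z i : ℝ) ^ 2 ≤ ∑ i, (2 * √k * (a i / A)) ^ 2 :=
            Finset.sum_le_sum fun i _ => sq_le_sq.2 (hz1 i)
        _ = 4 * k * ((∑ i, a i ^ 2) / A ^ 2) := by
            simp only [mul_pow, Real.sq_sqrt hkpos.le, div_pow, ← Finset.mul_sum, Finset.sum_div]
            norm_num
        _ = 4 * k := by rw [← hAsq]; field_simp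
    have hzT : z ∈ T := by
      rw [hT, Finset.mem_filter]
      refine ⟨Fintype.mem_piFinset.2 fun i => ?_, hzsq⟩
      have h1 : (z i : ℝ) ^ 2 ≤ 4 * k :=
        (Finset.single_le_sum (f := fun i => (z i : ℝ) ^ 2) (fun i _ => sq_nonneg _)
          (Finset.mem_univ i)).trans hzsq
      have h2 : (z i) ^ 2 ≤ ((4 * k : ℕ) : ℤ) := by exact_mod_cast h1
      rw [Finset.mem_Icc]
      constructor <;> nlinarith
    have hmain := hS _ (Finset.mem_image_of_mem _ hzT)
    set u : ι → ℝ := fun i => a i / A - (z i : ℝ) / (2 * √k) with hu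
    have husq : ∑ i, u i ^ 2 ≤ 1 / 4 := by
      calc ∑ i, u i ^ 2 ≤ ∑ i : ι, 1 / (4 * (k : ℝ)) := by
            refine Finset.sum_le_sum fun i _ => ?_
            have h1 : u i = (2 * √k * (a i / A) - z i) / (2 * √k) := by
              rw [hu]; field_simp
            rw [h1, div_pow, mul_pow, Real.sq_sqrt hkpos.le]
            have : (2 * √k * (a i / A) - z i) ^ 2 ≤ 1 := by
              rw [← sq_abs]; exact pow_le_one₀ (abs_nonneg _) (hz2 i)
            norm_num
            calc _ ≤ 1 / (4 * (k : ℝ)) := by gcongr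
              _ = _ := by ring
        _ = 1 / 4 := by
            rw [Finset.sum_const, Finset.card_univ, ← hk, nsmul_eq_mul]; field_simp
    have hCS := Finset.sum_mul_sq_le_sq_mul_sq Finset.univ u a
    have hua : ∑ i, u i * a i ≤ A / 2 := by
      refine (abs_le_of_sq_le_sq' ?_ (by positivity)).2
      rw [← hAsq] at hCS
      nlinarith [sq_nonneg A]
    have hsum : ∑ i, u i * a i = A - ∑ i, (z i : ℝ) / (2 * √k) * a i := by
      simp only [hu, sub_mul, Finset.sum_sub_distrib]
      congr 1
      have : ∀ i, a i / A * a i = a i ^ 2 / A := fun i => by ring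
      simp only [this, ← Finset.sum_div, ← hAsq]
      field_simp
    linarith

end ProbabilityTools

/-! ### Borel–Cantelli over distinct size vectors -/

section Summability

/-- The sum over ℕ^R is dominated by a product of R geometric series. -/
theorem summable_exp_neg_mul_sum (R : ℕ) {c : ℝ} (hc : 0 < c) :
    Summable fun k : Fin R → ℕ => Real.exp (-(c * ∑ i, (k i : ℝ))) := by
  classical
  have hgeo : Summable fun j : ℕ => Real.exp (-c) ^ j :=
    summable_geometric_of_lt_one (Real.exp_pos _).le (by simpa using hc)
  refine summable_of_sum_le (c := (∑' j : ℕ, Real.exp (-c) ^ j) ^ R)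
    (fun _ => (Real.exp_pos _).le) fun u => ?_
  have hterm : ∀ k : Fin R → ℕ, Real.exp (-(c * ∑ i, (k i : ℝ))) = ∏ i, Real.exp (-c) ^ k i := by
    intro k
    simp only [← Real.exp_nat_mul, ← Real.exp_sum]
    congr 1
    rw [← neg_mul, Finset.mul_sum]
    exact Finset.sum_congr rfl fun i _ => mul_comm _ _
  set M := u.sup fun k => Finset.univ.sup k with hM
  have hu : u ⊆ Fintype.piFinset fun _ => Finset.range (M + 1) := by
    intro k hk
    refine Fintype.mem_piFinset.2 fun i => Finset.mem_range.2 (Nat.lt_succ_of_le ?_)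
    exact (Finset.le_sup (f := k) (Finset.mem_univ i)).trans
      (Finset.le_sup (f := fun k : Fin R → ℕ => Finset.univ.sup k) hk)
  calc ∑ k ∈ u, Real.exp (-(c * ∑ i, (k i : ℝ)))
      ≤ ∑ k ∈ Fintype.piFinset fun _ : Fin R => Finset.range (M + 1),
          ∏ i, Real.exp (-c) ^ k i := by
        simp only [hterm]
        exact Finset.sum_le_sum_of_subset_of_nonneg hu fun _ _ _ => by positivity
    _ = ∏ _i : Fin R, ∑ j ∈ Finset.range (M + 1), Real.exp (-c) ^ j := by
        rw [Finset.prod_univ_sum]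
    _ ≤ ∏ _i : Fin R, ∑' j : ℕ, Real.exp (-c) ^ j := by
        refine Finset.prod_le_prod (fun _ _ => by positivity) fun _ _ => ?_
        exact hgeo.sum_le_tsum _ fun _ _ => by positivity
    _ = _ := by simp

variable {Ω : Type*} [mΩ : MeasurableSpace Ω] {P : Measure Ω} [IsProbabilityMeasure P]

/-- Borel–Cantelli along a sequence of pairwise different size vectors. -/
theorem ae_eventually_of_measureReal_le_exp {r : ℕ} {n : ℕ → Fin (r + 1) → ℕ}
    (hn : Function.Injective n) (E : ℕ → Ω → Prop) {C c : ℝ} (hc : 0 < c)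
    (h : ∀ᶠ m in atTop, P.real {ω | ¬ E m ω} ≤ C * Real.exp (-(c * totalSize (n m)))) :
    ∀ᵐ ω ∂P, ∀ᶠ m in atTop, E m ω := by
  classical
  -- Replacing the event by the empty set where the bound fails makes the estimate hold for every m;
  -- the two families agree for late m.
  set s : ℕ → Set Ω := fun m =>
    if P.real {ω | ¬ E m ω} ≤ C * Real.exp (-(c * totalSize (n m))) then {ω | ¬ E m ω} else ∅
    with hs
  have hsum : Summable fun m => |C| * Real.exp (-(c * totalSize (n m))) := by
    have := (summable_exp_neg_mul_sum (r + 1) hc).comp_injective hn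
    refine Summable.mul_left _ (this.congr fun m => ?_)
    simp [totalSize]
  have hbd : ∀ m, P (s m) ≤ ENNReal.ofReal (|C| * Real.exp (-(c * totalSize (n m)))) := by
    intro m
    simp only [hs]
    split_ifs with hm
    · rw [← ofReal_measureReal]
      refine ENNReal.ofReal_le_ofReal (hm.trans ?_)
      gcongr
      exact le_abs_self C
    · simp
  have hfin : ∑' m, P (s m) ≠ ⊤ :=
    ne_top_of_le_ne_top hsum.tsum_ofReal_ne_top (ENNReal.tsum_le_tsum hbd)
  filter_upwards [ae_eventually_notMem hfin] with ω hω
  filter_upwards [hω, h] with m hm hm'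
  simpa [hs, hm'] using hm

end Summability

/-! ### Degree deviations, the inner and outer σ-algebras, and Hoeffding for edges -/

section Graph

variable {r : ℕ} {n : Fin (r + 1) → ℕ}

open Classical in
/-- The centred adjacency matrix between different clusters. -/
noncomputable def edgeDev (p : Fin (r + 1) → Fin (r + 1) → ℝ) (g : SimpleGraph (ClusterNode n))
    (u v : ClusterNode n) : ℝ :=
  (if g.Adj u v then 1 else 0) - p u.1 v.1

/-- Deviation of the number of neighbours in cluster `j` from its mean. -/
noncomputable def clusterDev (p : Fin (r + 1) → Fin (r + 1) → ℝ)
    (g : SimpleGraph (ClusterNode n)) (i j : Fin (r + 1)) (x : Fin (n i)) : ℝ :=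
  ∑ y : Fin (n j), edgeDev p g ⟨i, x⟩ ⟨j, y⟩

/-- Deviation of the number of neighbours outside the own cluster from its mean. -/
noncomputable def outDev (p : Fin (r + 1) → Fin (r + 1) → ℝ)
    (g : SimpleGraph (ClusterNode n)) (i : Fin (r + 1)) (x : Fin (n i)) : ℝ :=
  ∑ j ∈ Finset.univ.erase i, clusterDev p g i j x

/-- The subgraph induced on a cluster. -/
def innerGraph (g : SimpleGraph (ClusterNode n)) (i : Fin (r + 1)) : SimpleGraph (Fin (n i)) :=
  g.comap fun x => ⟨i, x⟩

theorem card_clusterNode : Fintype.card (ClusterNode n) = totalSize n := by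
  simp [ClusterNode, totalSize]

theorem le_totalSize (i : Fin (r + 1)) : n i ≤ totalSize n :=
  Finset.single_le_sum (f := n) (fun _ _ => Nat.zero_le _) (Finset.mem_univ i)

variable {Ω : Type*} [mΩ : MeasurableSpace Ω] {P : Measure Ω} [IsProbabilityMeasure P]
  {p : Fin (r + 1) → Fin (r + 1) → ℝ} {G : Ω → SimpleGraph (ClusterNode n)}

/-- The σ-algebra of the edges inside clusters. -/
@[reducible] def intraSigma (G : Ω → SimpleGraph (ClusterNode n)) : MeasurableSpace Ω :=
  MeasurableSpace.generateFrom
    {s : Set Ω | ∃ u v : ClusterNode n, u.1 = v.1 ∧ s = {ω | (G ω).Adj u v}}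

/-- The σ-algebra of the edges between clusters. -/
@[reducible] def interSigma (G : Ω → SimpleGraph (ClusterNode n)) : MeasurableSpace Ω :=
  MeasurableSpace.generateFrom
    {s : Set Ω | ∃ u v : ClusterNode n, u.1 ≠ v.1 ∧ s = {ω | (G ω).Adj u v}}

theorem IsRIM.intraSigma_le (hG : IsRIM P n p G) : intraSigma G ≤ mΩ :=
  MeasurableSpace.generateFrom_le fun _ ⟨u, v, _, hs⟩ => hs ▸ hG.measurable_adj u v

theorem IsRIM.indep (hG : IsRIM P n p G) : Indep (intraSigma G) (interSigma G) P :=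
  hG.indep_intra_inter

theorem measurableSet_innerGraph_preimage (i : Fin (r + 1)) (h : SimpleGraph (Fin (n i))) :
    MeasurableSet[intraSigma G] ((fun ω => innerGraph (G ω) i) ⁻¹' {h}) := by
  have : (fun ω => innerGraph (G ω) i) ⁻¹' {h} =
      ⋂ x : Fin (n i), ⋂ y : Fin (n i), {ω | (G ω).Adj ⟨i, x⟩ ⟨i, y⟩ ↔ h.Adj x y} := by
    ext ω
    simp only [Set.mem_preimage, Set.mem_singleton_iff, Set.mem_iInter, Set.mem_ofPred_eq]
    constructor
    · rintro rfl x y; rfl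
    · intro H; ext x y; exact H x y
  rw [this]
  refine MeasurableSet.iInter fun x => MeasurableSet.iInter fun y => ?_
  have hm : MeasurableSet[intraSigma G] {ω | (G ω).Adj ⟨i, x⟩ ⟨i, y⟩} :=
    MeasurableSpace.measurableSet_generateFrom ⟨⟨i, x⟩, ⟨i, y⟩, rfl, rfl⟩
  by_cases hxy : h.Adj x y
  · simpa [hxy] using hm
  · convert hm.compl using 1
    ext ω
    simp [hxy]

theorem measurable_edgeDev {u v : ClusterNode n} (huv : u.1 ≠ v.1) :
    Measurable[interSigma G] fun ω => edgeDev p (G ω) u v := by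
  have hm : MeasurableSet[interSigma G] {ω | (G ω).Adj u v} :=
    MeasurableSpace.measurableSet_generateFrom ⟨u, v, huv, rfl⟩
  unfold edgeDev
  exact (Measurable.ite hm measurable_const measurable_const).sub_const _

theorem measurable_clusterDev {i j : Fin (r + 1)} (hij : i ≠ j) :
    Measurable[interSigma G] fun ω => clusterDev p (G ω) i j := by
  refine @measurable_pi_lambda _ _ _ (interSigma G) _ _ fun x => ?_
  exact Finset.measurable_sum _ fun y _ => measurable_edgeDev hij

theorem measurable_outDev (i : Fin (r + 1)) :
    Measurable[interSigma G] fun ω => outDev p (G ω) i := by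
  refine @measurable_pi_lambda _ _ _ (interSigma G) _ _ fun x => ?_
  refine Finset.measurable_sum _ fun j hj => ?_
  exact Finset.measurable_sum _ fun y _ => measurable_edgeDev (Finset.ne_of_mem_erase hj).symm

/-- Independence is assumed for pairs oriented by increasing cluster label. Orienting each edge that
leaves cluster i in this way is injective, so independence is inherited without regard to direction.
-/
theorem IsRIM.iIndepSet_star (hG : IsRIM P n p G) (i : Fin (r + 1)) :
    iIndepSet (fun e : Fin (n i) × {u : ClusterNode n // u.1 ≠ i} =>
      {ω | (G ω).Adj ⟨i, e.1⟩ e.2.1}) P := by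
  let f : Fin (n i) × {u : ClusterNode n // u.1 ≠ i} →
      {e : ClusterNode n × ClusterNode n // e.1.1 < e.2.1} := fun e =>
    if h : i < e.2.1.1 then ⟨(⟨i, e.1⟩, e.2.1), h⟩
    else ⟨(e.2.1, ⟨i, e.1⟩), lt_of_le_of_ne (not_lt.1 h) e.2.2⟩
  have hf : Function.Injective f := by
    rintro ⟨x, u, hu⟩ ⟨y, v, hv⟩ h
    simp only [f] at h
    split_ifs at h with h1 h2 h2
    · simp only [Subtype.mk.injEq, Prod.mk.injEq] at h
      obtain ⟨h3, rfl⟩ := h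
      simp at h3
      simp [h3]
    · simp only [Subtype.mk.injEq, Prod.mk.injEq] at h
      exact absurd (congrArg Sigma.fst h.1).symm hv
    · simp only [Subtype.mk.injEq, Prod.mk.injEq] at h
      exact absurd (congrArg Sigma.fst h.1) hu
    · simp only [Subtype.mk.injEq, Prod.mk.injEq] at h
      obtain ⟨rfl, h3⟩ := h
      simp at h3
      simp [h3]
  have := iIndepSet.precomp hf hG.indep_inter
  convert this using 1
  ext e ω
  simp only [f, Function.comp]
  split_ifs with h
  · rfl
  · exact SimpleGraph.adj_comm _ _ _

theorem IsRIM.measureReal_adj (hG : IsRIM P n p G)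
    (hp : ∀ i j, i ≠ j → p i j ∈ Set.Icc (0 : ℝ) 1 ∧ p i j = p j i)
    {u v : ClusterNode n} (huv : u.1 ≠ v.1) : P.real {ω | (G ω).Adj u v} = p u.1 v.1 := by
  rw [measureReal_def, hG.prob_inter u v huv, ENNReal.toReal_ofReal (hp _ _ huv).1.1]

theorem IsRIM.edgeDev_eq (hG : IsRIM P n p G)
    (hp : ∀ i j, i ≠ j → p i j ∈ Set.Icc (0 : ℝ) 1 ∧ p i j = p j i)
    {u v : ClusterNode n} (huv : u.1 ≠ v.1) (ω : Ω) :
    edgeDev p (G ω) u v = {ω | (G ω).Adj u v}.indicator (fun _ => (1 : ℝ)) ω -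
      P.real {ω | (G ω).Adj u v} := by
  rw [hG.measureReal_adj hp huv, edgeDev]
  by_cases h : (G ω).Adj u v <;> simp [h]

/-- Concentration of linear functionals of the edges between two clusters. -/
theorem IsRIM.measureReal_sum_edgeDev_ge_le (hG : IsRIM P n p G)
    (hp : ∀ i j, i ≠ j → p i j ∈ Set.Icc (0 : ℝ) 1 ∧ p i j = p j i)
    {i j : Fin (r + 1)} (hij : i ≠ j) (a : Fin (n i) → Fin (n j) → ℝ) {t s : ℝ} (ht : 0 ≤ t)
    (hs : 0 < s) (has : ∑ x, ∑ y, a x y ^ 2 ≤ s) :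
    P.real {ω | t ≤ ∑ x, ∑ y, a x y * edgeDev p (G ω) ⟨i, x⟩ ⟨j, y⟩}
      ≤ Real.exp (-(2 * t ^ 2 / s)) := by
  let f : Fin (n i) × Fin (n j) → Fin (n i) × {u : ClusterNode n // u.1 ≠ i} :=
    fun e => (e.1, ⟨⟨j, e.2⟩, hij.symm⟩)
  have hf : Function.Injective f := by
    rintro ⟨x, y⟩ ⟨x', y'⟩ h
    simp only [f, Prod.mk.injEq, Subtype.mk.injEq, Sigma.mk.injEq, heq_eq_eq, true_and] at h
    simp [h.1, h.2]
  have hind := (hG.iIndepSet_star i).precomp hf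
  have hH := measureReal_sum_mul_indicator_ge_le (P := P)
    (A := fun e : Fin (n i) × Fin (n j) => {ω | (G ω).Adj ⟨i, e.1⟩ ⟨j, e.2⟩})
    (fun e => hG.measurable_adj _ _) hind (fun e => a e.1 e.2) ht hs
    (by rwa [Fintype.sum_prod_type])
  refine le_trans (le_of_eq ?_) hH
  congr 1
  ext ω
  simp only [Set.mem_ofPred_eq, Fintype.sum_prod_type]
  simp only [hG.edgeDev_eq hp (u := ⟨i, _⟩) (v := ⟨j, _⟩) hij]

end Graph

/-! ### Probability bounds for the exceptional events -/

section GraphEvents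

variable {r : ℕ} {n : Fin (r + 1) → ℕ} {Ω : Type*} [mΩ : MeasurableSpace Ω] {P : Measure Ω}
  [IsProbabilityMeasure P] {p : Fin (r + 1) → Fin (r + 1) → ℝ} {G : Ω → SimpleGraph (ClusterNode n)}

theorem measureReal_le_sum_of_subset_biUnion {γ : Type*} {s : Set Ω} (T : Finset γ)
    (D : γ → Set Ω) {δ : ℝ} (hs : s ⊆ ⋃ c ∈ T, D c) (hD : ∀ c ∈ T, P.real (D c) ≤ δ) :
    P.real s ≤ T.card * δ := by
  refine (measureReal_mono hs (measure_ne_top _ _)).trans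
    ((measureReal_biUnion_finset_le _ _).trans ((Finset.sum_le_sum hD).trans (le_of_eq ?_)))
  rw [Finset.sum_const, nsmul_eq_mul]

/-- The centred adjacency blocks between different clusters have spectral norm `O(√N)`. -/
def CrossBound (p : Fin (r + 1) → Fin (r + 1) → ℝ) (g : SimpleGraph (ClusterNode n)) : Prop :=
  ∀ i j, i ≠ j → ∀ y : Fin (n j) → ℝ,
    √(∑ a, (∑ b, edgeDev p g ⟨i, a⟩ ⟨j, b⟩ * y b) ^ 2) ≤ 8 * √(totalSize n) * √(∑ b, y b ^ 2)

theorem add_le_totalSize {i j : Fin (r + 1)} (hij : i ≠ j) : n i + n j ≤ totalSize n := by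
  rw [totalSize, ← Finset.sum_pair hij]
  exact Finset.sum_le_sum_of_subset (Finset.subset_univ _)

/-- The operator norm is controlled by the bilinear form on a product of two nets, at a cost of a
factor 2 per side. -/
theorem IsRIM.measureReal_not_block_bound_le (hG : IsRIM P n p G)
    (hp : ∀ i j, i ≠ j → p i j ∈ Set.Icc (0 : ℝ) 1 ∧ p i j = p j i) {i j : Fin (r + 1)}
    (hij : i ≠ j) :
    P.real {ω | ¬ ∀ y : Fin (n j) → ℝ,
      √(∑ a, (∑ b, edgeDev p (G ω) ⟨i, a⟩ ⟨j, b⟩ * y b) ^ 2) ≤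
        8 * √(totalSize n) * √(∑ b, y b ^ 2)} ≤ Real.exp (-(2 * totalSize n)) := by
  classical
  obtain ⟨S, hScard, hSnorm, hSnet⟩ := exists_unitBall_net (Fin (n i))
  obtain ⟨S', hScard', hSnorm', hSnet'⟩ := exists_unitBall_net (Fin (n j))
  obtain ⟨N, hN⟩ : ∃ N : ℝ, N = totalSize n := ⟨_, rfl⟩
  rw [← hN]
  have hN0 : 0 ≤ N := hN ▸ Nat.cast_nonneg _
  -- With this level Hoeffding gives exp(-8N) per pair, against at most exp(6N) pairs; the two net
  -- factors turn 2√N into 8√N.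
  obtain ⟨t, ht⟩ : ∃ t : ℝ, t = 2 * √N := ⟨_, rfl⟩
  have ht0 : 0 ≤ t := by rw [ht]; positivity
  have hsub : {ω | ¬ ∀ y : Fin (n j) → ℝ,
      √(∑ a, (∑ b, edgeDev p (G ω) ⟨i, a⟩ ⟨j, b⟩ * y b) ^ 2) ≤ 8 * √N * √(∑ b, y b ^ 2)} ⊆
      ⋃ xy ∈ S ×ˢ S',
        {ω | t ≤ ∑ a, ∑ b, (xy.1 a * xy.2 b) * edgeDev p (G ω) ⟨i, a⟩ ⟨j, b⟩} := by
    intro ω hω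
    by_contra hcon
    refine hω fun y => ?_
    have hall : ∀ x ∈ S, ∀ y ∈ S',
        ∑ b, y b * ∑ a, x a * edgeDev p (G ω) ⟨i, a⟩ ⟨j, b⟩ ≤ t := by
      intro x hx y hy
      by_contra hlt
      refine hcon (Set.mem_iUnion₂.2 ⟨(x, y), Finset.mem_product.2 ⟨hx, hy⟩, ?_⟩)
      rw [Set.mem_ofPred_eq]
      have heq : ∑ b, y b * ∑ a, x a * edgeDev p (G ω) ⟨i, a⟩ ⟨j, b⟩ =
          ∑ a, ∑ b, (x a * y b) * edgeDev p (G ω) ⟨i, a⟩ ⟨j, b⟩ := by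
        simp only [Finset.mul_sum]
        rw [Finset.sum_comm]
        exact Finset.sum_congr rfl fun a _ => Finset.sum_congr rfl fun b _ => by ring
      rw [← heq]
      exact (not_le.1 hlt).le
    have h1 : ∀ x ∈ S, ∑ a, x a * ∑ b, edgeDev p (G ω) ⟨i, a⟩ ⟨j, b⟩ * y b ≤
        2 * t * √(∑ b, y b ^ 2) := by
      intro x hx
      have h2 := hSnet' _ t (hall x hx)
      have h3 : ∑ a, x a * ∑ b, edgeDev p (G ω) ⟨i, a⟩ ⟨j, b⟩ * y b =
          ∑ b, (∑ a, x a * edgeDev p (G ω) ⟨i, a⟩ ⟨j, b⟩) * y b := by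
        simp only [Finset.mul_sum, Finset.sum_mul]
        rw [Finset.sum_comm]
        exact Finset.sum_congr rfl fun a _ => Finset.sum_congr rfl fun b _ => by ring
      rw [h3]
      exact (Real.sum_mul_le_sqrt_mul_sqrt _ _ _).trans
        (mul_le_mul_of_nonneg_right h2 (Real.sqrt_nonneg _))
    refine (hSnet _ _ h1).trans (le_of_eq ?_)
    rw [ht]; ring
  have hone : ∀ xy ∈ S ×ˢ S', P.real
      {ω | t ≤ ∑ a, ∑ b, (xy.1 a * xy.2 b) * edgeDev p (G ω) ⟨i, a⟩ ⟨j, b⟩} ≤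
      Real.exp (-(2 * t ^ 2 / 1)) := by
    intro xy hxy
    rw [Finset.mem_product] at hxy
    refine hG.measureReal_sum_edgeDev_ge_le hp hij _ ht0 one_pos ?_
    simp only [mul_pow, ← Finset.mul_sum, ← Finset.sum_mul]
    exact mul_le_one₀ (hSnorm _ hxy.1) (Finset.sum_nonneg fun _ _ => sq_nonneg _)
      (hSnorm' _ hxy.2)
  rw [Fintype.card_fin] at hScard hScard'
  calc _ ≤ ((S ×ˢ S').card : ℝ) * Real.exp (-(2 * t ^ 2 / 1)) :=
        measureReal_le_sum_of_subset_biUnion _ _ hsub hone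
    _ = ((S.card : ℝ) * S'.card) * Real.exp (-(8 * N)) := by
        rw [Finset.card_product, Nat.cast_mul, ht, mul_pow, Real.sq_sqrt hN0]
        ring_nf
    _ ≤ (Real.exp (6 * n i) * Real.exp (6 * n j)) * Real.exp (-(8 * N)) := by
        gcongr
    _ ≤ Real.exp (-(2 * N)) := by
        rw [← Real.exp_add, ← Real.exp_add]
        refine Real.exp_le_exp.2 ?_
        have : ((n i + n j : ℕ) : ℝ) ≤ N := by
          rw [hN]; exact_mod_cast add_le_totalSize hij
        push_cast at this
        linarith

theorem IsRIM.measureReal_not_crossBound_le (hG : IsRIM P n p G)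
    (hp : ∀ i j, i ≠ j → p i j ∈ Set.Icc (0 : ℝ) 1 ∧ p i j = p j i) :
    P.real {ω | ¬ CrossBound p (G ω)} ≤
      (Fintype.card (Fin (r + 1) × Fin (r + 1)) : ℝ) * Real.exp (-(2 * totalSize n)) := by
  classical
  refine measureReal_le_sum_of_subset_biUnion Finset.univ (fun ij => {ω | ij.1 ≠ ij.2 ∧
    ¬ ∀ y : Fin (n ij.2) → ℝ, √(∑ a, (∑ b, edgeDev p (G ω) ⟨ij.1, a⟩ ⟨ij.2, b⟩ * y b) ^ 2) ≤
      8 * √(totalSize n) * √(∑ b, y b ^ 2)}) (fun ω hω => ?_) fun ij _ => ?_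
  · simp only [Set.mem_ofPred_eq, CrossBound, not_forall] at hω
    obtain ⟨i, j, hij, hy⟩ := hω
    exact Set.mem_iUnion₂.2 ⟨(i, j), Finset.mem_univ _, hij, not_forall.2 hy⟩
  · by_cases hij : ij.1 = ij.2
    · simp only [hij, ne_eq, not_true, false_and, Set.ofPred_false, measureReal_empty]
      positivity
    · simp only [ne_eq, hij, not_false_eq_true, true_and]
      exact hG.measureReal_not_block_bound_le hp hij

/-- The projection of a degree deviation vector onto subspaces determined by the inner graph. -/
theorem IsRIM.measureReal_projection_gt_le (hG : IsRIM P n p G)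
    (hp : ∀ i j, i ≠ j → p i j ∈ Set.Icc (0 : ℝ) 1 ∧ p i j = p j i)
    {i j : Fin (r + 1)} (hij : i ≠ j) (hN : 0 < (totalSize n : ℝ)) {γ : Type*} (T : Finset γ)
    (I : SimpleGraph (Fin (n i)) → γ → Finset (Fin (n i)))
    (ψ : SimpleGraph (Fin (n i)) → γ → Fin (n i) → Fin (n i) → ℝ)
    (hψ : ∀ h c a b, ∑ v, ψ h c a v * ψ h c b v = if a = b then 1 else 0)
    {k η : ℝ} (hη : 0 ≤ η) :
    P.real {ω | ∃ c ∈ T, ((I (innerGraph (G ω) i) c).card : ℝ) ≤ k ∧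
      η * totalSize n < √(∑ a ∈ I (innerGraph (G ω) i) c,
        (∑ v, ψ (innerGraph (G ω) i) c a v * clusterDev p (G ω) i j v) ^ 2)} ≤
      T.card * (Real.exp (6 * k) * Real.exp (-(η ^ 2 * totalSize n / 2))) := by
  classical
  set N : ℝ := (totalSize n : ℝ) with hNdef
  -- Freezing the inner graph makes the subspaces deterministic while the deviations keep their law.
  let F : SimpleGraph (Fin (n i)) → Set Ω := fun h => {ω | ∃ c ∈ T, ((I h c).card : ℝ) ≤ k ∧
      η * N < √(∑ a ∈ I h c, (∑ v, ψ h c a v * clusterDev p (G ω) i j v) ^ 2)}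
  refine measureReal_mem_comp_le_of_indep (m₁ := intraSigma G) (m₂ := interSigma G)
    hG.intraSigma_le hG.indep (fun ω => innerGraph (G ω) i)
    (fun h => measurableSet_innerGraph_preimage i h) F (fun h => ?_) (fun h => ?_)
  · have hset : F h = (fun ω => clusterDev p (G ω) i j) ⁻¹' (⋃ c ∈ T, {b : Fin (n i) → ℝ |
        ((I h c).card : ℝ) ≤ k ∧ η * N < √(∑ a ∈ I h c, (∑ v, ψ h c a v * b v) ^ 2)}) := by
      ext ω
      simp only [F, Set.mem_ofPred_eq, Set.mem_preimage, Set.mem_iUnion, exists_prop]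
    rw [hset]
    refine measurable_clusterDev hij ?_
    refine Finset.measurableSet_biUnion _ fun c _ => ?_
    refine (MeasurableSet.const _).inter (?_ : MeasurableSet {b : Fin (n i) → ℝ |
      η * N < √(∑ a ∈ I h c, (∑ v, ψ h c a v * b v) ^ 2)})
    refine measurableSet_lt measurable_const ?_
    fun_prop
  · have hone : ∀ c ∈ T, P.real {ω | ((I h c).card : ℝ) ≤ k ∧
        η * N < √(∑ a ∈ I h c, (∑ v, ψ h c a v * clusterDev p (G ω) i j v) ^ 2)} ≤
        Real.exp (6 * k) * Real.exp (-(η ^ 2 * N / 2)) := by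
      intro c _
      by_cases hk : ((I h c).card : ℝ) ≤ k
      swap
      · simp only [hk, false_and, Set.ofPred_false, measureReal_empty]; positivity
      obtain ⟨S, hScard, hSnorm, hSnet⟩ := exists_unitBall_net (I h c)
      have hsub : {ω | ((I h c).card : ℝ) ≤ k ∧
          η * N < √(∑ a ∈ I h c, (∑ v, ψ h c a v * clusterDev p (G ω) i j v) ^ 2)} ⊆
          ⋃ x ∈ S, {ω | η * N / 2 ≤ ∑ v, ∑ y, (∑ a : I h c, x a * ψ h c a v) *
            edgeDev p (G ω) ⟨i, v⟩ ⟨j, y⟩} := by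
        rintro ω ⟨-, hω⟩
        by_contra hcon
        refine absurd hω (not_lt.2 ?_)
        have hnet := hSnet (fun a => ∑ v, ψ h c a v * clusterDev p (G ω) i j v) (η * N / 2) ?_
        · rw [← Finset.sum_coe_sort (I h c)]
          linarith
        · intro x hx
          by_contra hlt
          refine hcon (Set.mem_biUnion hx ?_)
          refine (not_le.1 hlt).le.trans (le_of_eq ?_)
          simp only [Finset.mul_sum, clusterDev, Finset.sum_mul]
          rw [Finset.sum_comm]
          refine Finset.sum_congr rfl fun v _ => ?_
          rw [Finset.sum_comm]
          exact Finset.sum_congr rfl fun y _ => Finset.sum_congr rfl fun a _ => by ring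
      calc _ ≤ S.card * Real.exp (-(2 * (η * N / 2) ^ 2 / N)) := by
            refine measureReal_le_sum_of_subset_biUnion S _ hsub fun x hx => ?_
            refine hG.measureReal_sum_edgeDev_ge_le hp hij _ (by positivity) hN ?_
            -- Orthonormality shows that the coefficient vector has the norm of x. Repeated over the
            -- n_j columns, its squared norm is at most N, so Hoeffding at level ηN/2 gives
            -- exp(-η²N/2).
            have hpyth : ∑ v, (∑ a : I h c, x a * ψ h c a v) ^ 2 = ∑ a, x a ^ 2 := by
              have h1 : ∀ v, (∑ a : I h c, x a * ψ h c a v) ^ 2 =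
                  ∑ a : I h c, ∑ b : I h c, x a * x b * (ψ h c a v * ψ h c b v) := by
                intro v
                rw [sq, Finset.sum_mul_sum]
                exact Finset.sum_congr rfl fun a _ => Finset.sum_congr rfl fun b _ => by ring
              simp only [h1]
              rw [Finset.sum_comm]
              refine Finset.sum_congr rfl fun a _ => ?_
              rw [Finset.sum_comm]
              simp only [← Finset.mul_sum, hψ, Subtype.coe_inj]
              simp [sq]
            simp only [Finset.sum_const, Finset.card_univ, Fintype.card_fin, nsmul_eq_mul]
            rw [← Finset.mul_sum, hpyth]
            calc (n j : ℝ) * ∑ a, x a ^ 2 ≤ n j * 1 := by gcongr; exact hSnorm x hx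
              _ ≤ N := by rw [mul_one, hNdef]; exact_mod_cast le_totalSize j
        _ = S.card * Real.exp (-(η ^ 2 * N / 2)) := by
            congr 3
            field_simp
            try norm_num
        _ ≤ _ := by
            gcongr
            refine hScard.trans (Real.exp_le_exp.2 ?_)
            rw [Fintype.card_coe]
            gcongr
    refine measureReal_le_sum_of_subset_biUnion T (fun c => {ω | ((I h c).card : ℝ) ≤ k ∧
      η * N < √(∑ a ∈ I h c, (∑ v, ψ h c a v * clusterDev p (G ω) i j v) ^ 2)}) ?_ hone
    rintro ω ⟨c, hc, hω⟩
    exact Set.mem_biUnion hc hω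

theorem outDev_eq_sum (g : SimpleGraph (ClusterNode n)) (i : Fin (r + 1)) (x : Fin (n i)) :
    outDev p g i x = ∑ u : {u : ClusterNode n // u.1 ≠ i}, edgeDev p g ⟨i, x⟩ u.1 := by
  classical
  rw [← Finset.sum_subtype (p := fun u : ClusterNode n => u.1 ≠ i)
    ((Finset.univ.erase i).sigma fun _ => Finset.univ) (by simp) (fun u => edgeDev p g ⟨i, x⟩ u),
    Finset.sum_sigma]
  rfl

/-- Edges leaving cluster i from different nodes of that cluster are different, so these events
depend on disjoint blocks of an independent family. -/
theorem IsRIM.iIndepSet_outDev_le (hG : IsRIM P n p G) (i : Fin (r + 1)) (t : ℝ) :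
    iIndepSet (fun x : Fin (n i) => {ω | outDev p (G ω) i x ≤ t}) P := by
  have h := (iIndepSet_iff_iIndep _ _).1 (hG.iIndepSet_star i)
  refine iIndepSet_of_iIndep_prod (fun e => MeasurableSpace.generateFrom_le fun s hs => ?_) h _
    fun x => ?_
  · rw [Set.mem_singleton_iff.1 hs]
    exact hG.measurable_adj _ _
  · simp only [outDev_eq_sum]
    refine (?_ : Measurable[⨆ e ∈ {e : Fin (n i) × {u : ClusterNode n // u.1 ≠ i} | e.1 = x},
      MeasurableSpace.generateFrom {{ω | (G ω).Adj ⟨i, e.1⟩ e.2.1}}] fun ω =>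
      ∑ u : {u : ClusterNode n // u.1 ≠ i}, edgeDev p (G ω) ⟨i, x⟩ u.1) measurableSet_Iic
    refine Finset.measurable_sum _ fun u _ => ?_
    unfold edgeDev
    refine (Measurable.ite ?_ measurable_const measurable_const).sub_const _
    have hle := le_biSup (fun e : Fin (n i) × {u : ClusterNode n // u.1 ≠ i} =>
      MeasurableSpace.generateFrom {{ω | (G ω).Adj ⟨i, e.1⟩ e.2.1}})
      (show (x, u) ∈ {e : Fin (n i) × {u : ClusterNode n // u.1 ≠ i} | e.1 = x} from rfl)
    exact hle _ (MeasurableSpace.measurableSet_generateFrom rfl)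

theorem IsRIM.measureReal_card_lt_le (hG : IsRIM P n p G) (i : Fin (r + 1)) {q t : ℝ} (hq : 0 < q)
    (hqt : ∀ x, q ≤ P.real {ω | outDev p (G ω) i x ≤ t}) (S : Finset (Fin (n i))) {K : ℕ}
    (hS : 0 < S.card) (hK : (K : ℝ) ≤ q * S.card / 2) :
    P.real {ω | (S.filter fun x => outDev p (G ω) i x ≤ t).card < K} ≤
      Real.exp (-(q ^ 2 * S.card / 2)) := by
  classical
  have hS' : (0 : ℝ) < S.card := by exact_mod_cast hS
  have hm : ∀ x : Fin (n i), MeasurableSet {ω | outDev p (G ω) i x ≤ t} := by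
    intro x
    have hle : interSigma G ≤ mΩ :=
      MeasurableSpace.generateFrom_le fun _ ⟨u, v, _, hs⟩ => hs ▸ hG.measurable_adj u v
    have := (measurable_outDev (p := p) (G := G) i).mono hle le_rfl
    exact measurableSet_le ((measurable_pi_apply x).comp this) measurable_const
  -- Weights -1 on S turn the upper-tail inequality into a lower-tail one. The expected count is at
  -- least q|S|, so a count below K ≤ q|S|/2 is a deviation of at least q|S|/2.
  have hH := measureReal_sum_mul_indicator_ge_le hm (hG.iIndepSet_outDev_le i t)
    (fun x => if x ∈ S then (-1 : ℝ) else 0) (t := q * S.card / 2) (s := S.card) (by positivity) hS'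
    (by simp [ite_pow])
  have h2 : 2 * (q * S.card / 2) ^ 2 / (S.card : ℝ) = q ^ 2 * S.card / 2 := by
    field_simp
  rw [h2] at hH
  refine le_trans (measureReal_mono fun ω hω => ?_) hH
  simp only [Set.mem_ofPred_eq, ite_mul, zero_mul] at hω ⊢
  rw [Finset.sum_ite_mem, Finset.univ_inter]
  have h3 : ∑ x ∈ S, {ω | outDev p (G ω) i x ≤ t}.indicator (fun _ => (1 : ℝ)) ω =
      (S.filter fun x => outDev p (G ω) i x ≤ t).card := by
    rw [Finset.card_filter]
    push_cast
    refine Finset.sum_congr rfl fun x _ => ?_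
    by_cases hx : outDev p (G ω) i x ≤ t <;> simp [hx]
  have h4 : q * S.card ≤ ∑ x ∈ S, P.real {ω | outDev p (G ω) i x ≤ t} := by
    calc q * S.card = ∑ x ∈ S, q := by rw [Finset.sum_const, nsmul_eq_mul]; ring
      _ ≤ _ := Finset.sum_le_sum fun x _ => hqt x
  rw [← Finset.mul_sum, Finset.sum_sub_distrib, h3]
  have h5 : ((S.filter fun x => outDev p (G ω) i x ≤ t).card : ℝ) ≤ K := by exact_mod_cast hω.le
  linarith

/-- Every large set of nodes from a family determined by the inner graph contains several nodes of
small outer degree. -/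
theorem IsRIM.measureReal_exists_card_lt_le (hG : IsRIM P n p G) (i : Fin (r + 1)) {q t s : ℝ}
    (hq : 0 < q) (hqt : ∀ x, q ≤ P.real {ω | outDev p (G ω) i x ≤ t})
    {γ : Type*} (T : Finset γ) (S : SimpleGraph (Fin (n i)) → γ → Finset (Fin (n i))) {K : ℕ}
    (hs : 0 < s) (hK : (K : ℝ) ≤ q * s / 2) :
    P.real {ω | ∃ c ∈ T, s ≤ (S (innerGraph (G ω) i) c).card ∧
        ((S (innerGraph (G ω) i) c).filter fun x => outDev p (G ω) i x ≤ t).card < K} ≤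
      T.card * Real.exp (-(q ^ 2 * s / 2)) := by
  classical
  let F : SimpleGraph (Fin (n i)) → Set Ω := fun h => {ω | ∃ c ∈ T, s ≤ (S h c).card ∧
    ((S h c).filter fun x => outDev p (G ω) i x ≤ t).card < K}
  refine measureReal_mem_comp_le_of_indep (m₁ := intraSigma G) (m₂ := interSigma G)
    hG.intraSigma_le hG.indep (fun ω => innerGraph (G ω) i)
    (fun h => measurableSet_innerGraph_preimage i h) F (fun h => ?_) (fun h => ?_)
  · have hset : F h = (fun ω => outDev p (G ω) i) ⁻¹' (⋃ c ∈ T, {b : Fin (n i) → ℝ |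
        s ≤ (S h c).card ∧ ((S h c).filter fun x => b x ≤ t).card < K}) := by
      ext ω
      simp only [F, Set.mem_ofPred_eq, Set.mem_preimage, Set.mem_iUnion, exists_prop]
    rw [hset]
    refine measurable_outDev i ?_
    refine Finset.measurableSet_biUnion _ fun c _ => ?_
    refine (MeasurableSet.const _).inter (?_ : MeasurableSet {b : Fin (n i) → ℝ |
      ((S h c).filter fun x => b x ≤ t).card < K})
    refine measurableSet_lt ?_ measurable_const
    simp only [Finset.card_filter]
    refine Finset.measurable_sum _ fun x _ => ?_
    exact Measurable.ite (measurableSet_le (measurable_pi_apply x) measurable_const)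
      measurable_const measurable_const
  · refine measureReal_le_sum_of_subset_biUnion T (fun c => {ω | s ≤ (S h c).card ∧
      ((S h c).filter fun x => outDev p (G ω) i x ≤ t).card < K}) ?_ fun c _ => ?_
    · rintro ω ⟨c, hc, hω⟩
      exact Set.mem_biUnion hc hω
    by_cases hc : s ≤ (S h c).card
    · have hpos : 0 < (S h c).card := by exact_mod_cast hs.trans_le hc
      simp only [hc, true_and]
      refine (hG.measureReal_card_lt_le i hq hqt (S h c) hpos (hK.trans (by gcongr))).trans ?_
      gcongr
    · simp only [hc, false_and, Set.ofPred_false, measureReal_empty]; positivity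

/-- The edges into the single cluster j already supply variance of order N, so the outer degree
falls C√N below its mean with probability bounded below, uniformly in the sizes and the node. -/
theorem exists_le_measureReal_outDev_le (P : Measure Ω) [IsProbabilityMeasure P]
    (hp : ∀ i j, i ≠ j → p i j ∈ Set.Icc (0 : ℝ) 1 ∧ p i j = p j i)
    {i j : Fin (r + 1)} (hij : i ≠ j) (h0 : p i j ≠ 0) (h1 : p i j ≠ 1) {κ C : ℝ} (hκ : 0 < κ)
    (hC : 0 ≤ C) :
    ∃ q : ℝ, 0 < q ∧ ∃ N₀ : ℝ, ∀ (n : Fin (r + 1) → ℕ) (G : Ω → SimpleGraph (ClusterNode n)),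
      IsRIM P n p G → N₀ ≤ totalSize n → κ * totalSize n ≤ n j → ∀ x,
      q ≤ P.real {ω | outDev p (G ω) i x ≤ -(C * √(totalSize n))} := by
  classical
  have hpij := (hp i j hij).1
  have hlt0 : 0 < p i j := lt_of_le_of_ne hpij.1 (Ne.symm h0)
  have hlt1 : p i j < 1 := lt_of_le_of_ne hpij.2 h1
  have hv : 0 < p i j * (1 - p i j) := mul_pos hlt0 (by linarith)
  obtain ⟨q, hq, N₀, H⟩ := exists_le_measureReal_sum_indicator_le P hv (by nlinarith) hκ hC
  refine ⟨q, hq, N₀, fun n G hG hN hnj x => ?_⟩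
  let f : {u : ClusterNode n // u.1 ≠ i} → Fin (n i) × {u : ClusterNode n // u.1 ≠ i} :=
    fun u => (x, u)
  have hf : Function.Injective f := fun u v h => (Prod.mk.inj h).2
  have hind := (hG.iIndepSet_star i).precomp hf
  have hcardle : (Fintype.card {u : ClusterNode n // u.1 ≠ i} : ℝ) ≤ totalSize n := by
    rw [← card_clusterNode]; exact_mod_cast Fintype.card_subtype_le _
  set J : Finset {u : ClusterNode n // u.1 ≠ i} := Finset.univ.filter fun u => u.1.1 = j with hJ
  have hJcard : n j ≤ J.card := by
    have : (Finset.univ.image fun y : Fin (n j) =>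
        (⟨⟨j, y⟩, hij.symm⟩ : {u : ClusterNode n // u.1 ≠ i})) ⊆ J := by
      intro u hu
      obtain ⟨y, -, rfl⟩ := Finset.mem_image.1 hu
      simp [hJ]
    refine le_trans (le_of_eq ?_) (Finset.card_le_card this)
    rw [Finset.card_image_of_injective]
    · simp
    · intro y z hyz
      simpa using hyz
  refine (H _ (fun u => {ω | (G ω).Adj ⟨i, x⟩ u.1}) (fun u => hG.measurable_adj _ _) hind _ hN
    hcardle J (fun u hu => ?_) (hnj.trans (by exact_mod_cast hJcard))).trans (le_of_eq ?_)
  · have hu' := (Finset.mem_filter.1 hu).2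
    rw [hG.measureReal_adj hp (u := ⟨i, x⟩) (v := u.1) u.2.symm, hu']
  · congr 1
    ext ω
    simp only [Set.mem_ofPred_eq, outDev_eq_sum]
    rw [Finset.sum_congr rfl fun u _ => (hG.edgeDev_eq hp (u := ⟨i, x⟩) (v := u.1) u.2.symm ω).symm]

end GraphEvents

/-! ### Near-kernels: the span of singular vectors with small singular value -/

section NearKernel

open Matrix

variable {ι : Type*} [Fintype ι] [DecidableEq ι]

/-- Rows of an orthogonal matrix. -/
def IsOrthoRows (ψ : ι → ι → ℝ) : Prop :=
  ∀ a b, ∑ v, ψ a v * ψ b v = if a = b then 1 else 0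

theorem IsOrthoRows.sum_mul {ψ : ι → ι → ℝ} (h : IsOrthoRows ψ) (v w : ι) :
    ∑ a, ψ a v * ψ a w = if v = w then 1 else 0 := by
  have h1 : (Matrix.of ψ) * (Matrix.of ψ)ᵀ = 1 := by
    ext a b
    simp [Matrix.mul_apply, h a b, Matrix.one_apply]
  have h3 := mul_eq_one_comm.1 h1
  have h2 := congrFun (congrFun h3 v) w
  simpa [Matrix.mul_apply, Matrix.one_apply] using h2

theorem IsOrthoRows.parseval {ψ : ι → ι → ℝ} (h : IsOrthoRows ψ) (x y : ι → ℝ) :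
    ∑ a, (∑ v, ψ a v * x v) * (∑ v, ψ a v * y v) = ∑ v, x v * y v := by
  simp only [Finset.sum_mul_sum]
  rw [Finset.sum_comm]
  refine Finset.sum_congr rfl fun v _ => ?_
  rw [Finset.sum_comm]
  have : ∀ w, ∑ a, ψ a v * x v * (ψ a w * y w) = (if v = w then 1 else 0) * (x v * y w) := by
    intro w
    rw [← h.sum_mul v w, Finset.sum_mul]
    exact Finset.sum_congr rfl fun a _ => by ring
  simp [this]

/-- Splitting of a space into a part where `T` is small and a part where `T` is large. -/
theorem exists_nearKernel (T : Matrix ι ι ℝ) (ρ : ℝ) :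
    ∃ (I : Finset ι) (ψ : ι → ι → ℝ), IsOrthoRows ψ ∧
      (∀ a ∈ I, ∑ v, (T *ᵥ ψ a) v ^ 2 ≤ ρ ^ 2) ∧
      (0 < ρ → ∀ b y : ι → ℝ, |∑ v, b v * y v| ≤
        √(∑ a ∈ I, (∑ v, ψ a v * b v) ^ 2) * √(∑ v, y v ^ 2) +
          √(∑ v, b v ^ 2) * (√(∑ v, (T *ᵥ y) v ^ 2) / ρ)) := by
  -- Take an eigenbasis of TᵀT, with I the eigenvalues at most ρ². Outside I the component of y has
  -- norm at most |Ty|/ρ; Cauchy–Schwarz on both parts gives the bound. The choice of I and ψ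
  -- precedes b and y, so it depends on T and ρ only.
  have hS : (Tᵀ * T).IsHermitian := by
    have := isHermitian_conjTranspose_mul_self T
    rwa [conjTranspose_eq_transpose_of_trivial] at this
  set ψ : ι → ι → ℝ := fun a => ⇑(hS.eigenvectorBasis a) with hψ
  set σ := hS.eigenvalues with hσ
  have hortho : IsOrthoRows ψ := by
    intro a b
    have := (orthonormal_iff_ite.1 hS.eigenvectorBasis.orthonormal) b a
    rw [EuclideanSpace.inner_eq_star_dotProduct] at this
    simp only [dotProduct, star_trivial, eq_comm (a := b)] at this
    exact this
  have heig : ∀ a, (Tᵀ * T) *ᵥ ψ a = σ a • ψ a := fun a => hS.mulVec_eigenvectorBasis a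
  have hnorm : ∀ x : ι → ℝ, ∑ v, (T *ᵥ x) v ^ 2 = x ⬝ᵥ ((Tᵀ * T) *ᵥ x) := by
    intro x
    rw [← mulVec_mulVec, dotProduct_mulVec, vecMul_transpose]
    simp [dotProduct, sq]
  have hexp : ∀ x : ι → ℝ, ∑ v, (T *ᵥ x) v ^ 2 = ∑ a, σ a * (∑ v, ψ a v * x v) ^ 2 := by
    intro x
    rw [hnorm]
    have := hortho.parseval x ((Tᵀ * T) *ᵥ x)
    simp only [dotProduct]
    rw [← this]
    refine Finset.sum_congr rfl fun a _ => ?_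
    have h1 : ∑ v, ψ a v * ((Tᵀ * T) *ᵥ x) v = σ a * ∑ v, ψ a v * x v := by
      change ψ a ⬝ᵥ ((Tᵀ * T) *ᵥ x) = σ a * (ψ a ⬝ᵥ x)
      rw [dotProduct_mulVec, ← mulVec_transpose, transpose_mul, transpose_transpose, heig,
        smul_dotProduct, smul_eq_mul]
    rw [h1]; ring
  refine ⟨Finset.univ.filter fun a => σ a ≤ ρ ^ 2, ψ, hortho, fun a ha => ?_, fun hρ b y => ?_⟩
  · rw [hnorm, heig, dotProduct_smul, smul_eq_mul]
    have : ψ a ⬝ᵥ ψ a = 1 := (hortho a a).trans (if_pos rfl)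
    rw [this, mul_one]
    exact (Finset.mem_filter.1 ha).2
  · have hσ0 : ∀ a, 0 ≤ σ a := by
      intro a
      have h1 := hnorm (ψ a)
      rw [heig, dotProduct_smul, smul_eq_mul] at h1
      have : ψ a ⬝ᵥ ψ a = 1 := (hortho a a).trans (if_pos rfl)
      rw [this, mul_one] at h1
      rw [← h1]
      exact Finset.sum_nonneg fun _ _ => sq_nonneg _
    rw [← hortho.parseval b y, ← Finset.sum_filter_add_sum_filter_not Finset.univ
      (fun a => σ a ≤ ρ ^ 2)]
    have hsum : ∀ x : ι → ℝ, ∑ a, (∑ v, ψ a v * x v) ^ 2 = ∑ v, x v ^ 2 := by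
      intro x
      simpa only [sq] using hortho.parseval x x
    have habs : ∀ (J : Finset ι), |∑ a ∈ J, (∑ v, ψ a v * b v) * ∑ v, ψ a v * y v| ≤
        √(∑ a ∈ J, (∑ v, ψ a v * b v) ^ 2) * √(∑ a ∈ J, (∑ v, ψ a v * y v) ^ 2) := by
      intro J
      rw [← Real.sqrt_mul (Finset.sum_nonneg fun _ _ => sq_nonneg _)]
      exact Real.abs_le_sqrt (Finset.sum_mul_sq_le_sq_mul_sq _ _ _)
    refine (abs_add_le _ _).trans (add_le_add ((habs _).trans ?_) ((habs _).trans ?_))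
    · gcongr
      rw [← hsum y]
      exact Finset.sum_le_sum_of_subset_of_nonneg (Finset.filter_subset _ _)
        fun _ _ _ => sq_nonneg _
    · gcongr
      · rw [← hsum b]
        exact Finset.sum_le_sum_of_subset_of_nonneg (Finset.filter_subset _ _)
          fun _ _ _ => sq_nonneg _
      · rw [← Real.sqrt_sq hρ.le, ← Real.sqrt_div (Finset.sum_nonneg fun _ _ => sq_nonneg _)]
        refine Real.sqrt_le_sqrt ?_
        rw [Real.sqrt_sq hρ.le, le_div_iff₀ (by positivity), hexp, Finset.sum_mul]
        calc ∑ a ∈ Finset.univ.filter (fun a => ¬ σ a ≤ ρ ^ 2), (∑ v, ψ a v * y v) ^ 2 * ρ ^ 2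
            ≤ ∑ a ∈ Finset.univ.filter (fun a => ¬ σ a ≤ ρ ^ 2),
                σ a * (∑ v, ψ a v * y v) ^ 2 := by
              refine Finset.sum_le_sum fun a ha => ?_
              have := (not_le.1 (Finset.mem_filter.1 ha).2).le
              nlinarith [sq_nonneg (∑ v, ψ a v * y v)]
          _ ≤ _ := Finset.sum_le_sum_of_subset_of_nonneg (Finset.filter_subset _ _)
              fun a _ _ => mul_nonneg (hσ0 a) (sq_nonneg _)

/-- The eigenspace index set of `exists_nearKernel`. -/
noncomputable def nearKernelIndex (T : Matrix ι ι ℝ) (ρ : ℝ) : Finset ι :=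
  (exists_nearKernel T ρ).choose

/-- The eigenbasis of `exists_nearKernel`. -/
noncomputable def nearKernelBasis (T : Matrix ι ι ℝ) (ρ : ℝ) : ι → ι → ℝ :=
  (exists_nearKernel T ρ).choose_spec.choose

theorem isOrthoRows_nearKernelBasis (T : Matrix ι ι ℝ) (ρ : ℝ) :
    IsOrthoRows (nearKernelBasis T ρ) :=
  (exists_nearKernel T ρ).choose_spec.choose_spec.1

theorem sum_mulVec_nearKernelBasis_le (T : Matrix ι ι ℝ) (ρ : ℝ) :
    ∀ a ∈ nearKernelIndex T ρ, ∑ v, (T *ᵥ nearKernelBasis T ρ a) v ^ 2 ≤ ρ ^ 2 :=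
  (exists_nearKernel T ρ).choose_spec.choose_spec.2.1

theorem abs_sum_mul_le_nearKernel (T : Matrix ι ι ℝ) {ρ : ℝ} (hρ : 0 < ρ) (b y : ι → ℝ) :
    |∑ v, b v * y v| ≤ √(∑ a ∈ nearKernelIndex T ρ, (∑ v, nearKernelBasis T ρ a v * b v) ^ 2) *
      √(∑ v, y v ^ 2) + √(∑ v, b v ^ 2) * (√(∑ v, (T *ᵥ y) v ^ 2) / ρ) :=
  (exists_nearKernel T ρ).choose_spec.choose_spec.2.2 hρ b y

/-- A perturbation `Δ - A` of a large diagonal matrix by a matrix of small Hilbert–Schmidt norm has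
a near-kernel of small dimension. -/
theorem card_nearKernelIndex_le (T A : Matrix ι ι ℝ) {ρ : ℝ} (hρ : 0 < ρ) (Γ : Finset ι)
    (Δ : ι → ℝ) (hT : ∀ v ∈ Γ, ∀ x : ι → ℝ, (T *ᵥ x) v = Δ v * x v - (A *ᵥ x) v)
    (hΔ : ∀ v ∈ Γ, 2 * ρ ≤ Δ v) :
    ρ ^ 2 * (nearKernelIndex T ρ).card ≤
      ∑ v, ∑ u, A v u ^ 2 + 2 * ρ ^ 2 * (Γᶜ.card : ℝ) := by
  set I := nearKernelIndex T ρ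
  set ψ := nearKernelBasis T ρ
  have hψ : IsOrthoRows ψ := isOrthoRows_nearKernelBasis T ρ
  have hcol : ∀ v, ∑ a, ψ a v ^ 2 = 1 := fun v => by simpa [sq] using hψ.sum_mul v v
  have hrow : ∀ a, ∑ v, ψ a v ^ 2 = 1 := fun a => by simpa [sq] using hψ a a
  -- On Γ the identity Δψ = Tψ + Aψ holds with Δ ≥ 2ρ, while |Tψ| ≤ ρ for a near-kernel vector ψ.
  have h1 : ∀ a ∈ I, ∑ v ∈ Γ, 4 * ρ ^ 2 * ψ a v ^ 2 ≤
      2 * ρ ^ 2 + 2 * ∑ v, (A *ᵥ ψ a) v ^ 2 := by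
    intro a ha
    calc ∑ v ∈ Γ, 4 * ρ ^ 2 * ψ a v ^ 2
        ≤ ∑ v ∈ Γ, (2 * (T *ᵥ ψ a) v ^ 2 + 2 * (A *ᵥ ψ a) v ^ 2) := by
          refine Finset.sum_le_sum fun v hv => ?_
          have hd : (Δ v * ψ a v) = (T *ᵥ ψ a) v + (A *ᵥ ψ a) v := by rw [hT v hv]; ring
          have h2 : 4 * ρ ^ 2 * ψ a v ^ 2 ≤ (Δ v * ψ a v) ^ 2 := by
            rw [mul_pow]
            have : 4 * ρ ^ 2 ≤ Δ v ^ 2 := by nlinarith [hΔ v hv]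
            gcongr
          rw [hd] at h2
          nlinarith [sq_nonneg ((T *ᵥ ψ a) v - (A *ᵥ ψ a) v)]
      _ ≤ ∑ v, (2 * (T *ᵥ ψ a) v ^ 2 + 2 * (A *ᵥ ψ a) v ^ 2) :=
          Finset.sum_le_sum_of_subset_of_nonneg (Finset.subset_univ _) fun _ _ _ => by positivity
      _ ≤ _ := by
          rw [Finset.sum_add_distrib, ← Finset.mul_sum, ← Finset.mul_sum]
          have := sum_mulVec_nearKernelBasis_le T ρ a ha
          linarith
  have h2 : ∑ a ∈ I, ∑ v, (A *ᵥ ψ a) v ^ 2 ≤ ∑ v, ∑ u, A v u ^ 2 := by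
    calc ∑ a ∈ I, ∑ v, (A *ᵥ ψ a) v ^ 2 ≤ ∑ a, ∑ v, (A *ᵥ ψ a) v ^ 2 :=
          Finset.sum_le_sum_of_subset_of_nonneg (Finset.subset_univ _)
            fun _ _ _ => Finset.sum_nonneg fun _ _ => sq_nonneg _
      _ = ∑ v, ∑ u, A v u ^ 2 := by
          rw [Finset.sum_comm]
          refine Finset.sum_congr rfl fun v _ => ?_
          have := hψ.parseval (A v) (A v)
          simp only [← sq] at this
          rw [← this]
          refine Finset.sum_congr rfl fun a _ => ?_
          simp only [mulVec, dotProduct, mul_comm]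
  -- The |I| unit vectors lose at most |Γᶜ| of total squared mass outside Γ, because the columns of
  -- ψ are unit vectors too. Comparison with the sum of `h1` leaves 2ρ²|I| on the left.
  have h3 : 4 * ρ ^ 2 * ((I.card : ℝ) - Γᶜ.card) ≤ ∑ a ∈ I, ∑ v ∈ Γ, 4 * ρ ^ 2 * ψ a v ^ 2 := by
    have h4 : ∀ a, ∑ v ∈ Γ, ψ a v ^ 2 = 1 - ∑ v ∈ Γᶜ, ψ a v ^ 2 := fun a => by
      rw [← hrow a, ← Finset.sum_add_sum_compl Γ]; ring
    have h5 : ∑ a ∈ I, ∑ v ∈ Γᶜ, ψ a v ^ 2 ≤ Γᶜ.card := by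
      rw [Finset.sum_comm]
      calc ∑ v ∈ Γᶜ, ∑ a ∈ I, ψ a v ^ 2 ≤ ∑ v ∈ Γᶜ, 1 := by
            refine Finset.sum_le_sum fun v _ => ?_
            rw [← hcol v]
            exact Finset.sum_le_sum_of_subset_of_nonneg (Finset.subset_univ _)
              fun _ _ _ => sq_nonneg _
        _ = _ := by simp
    simp only [← Finset.mul_sum, h4, Finset.sum_sub_distrib, Finset.sum_const, nsmul_eq_mul,
      mul_one]
    gcongr
  have h6 := Finset.sum_le_sum h1
  rw [Finset.sum_add_distrib, Finset.sum_const, nsmul_eq_mul, ← Finset.mul_sum] at h6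
  nlinarith

end NearKernel

/-! ### Laplacian, degrees and adjacency matrix -/

section Laplacian

open Matrix

variable {V : Type*} [Fintype V]

open Classical in
/-- The number of neighbours of a node. -/
noncomputable def nodeDeg (g : SimpleGraph V) (v : V) : ℕ := (Finset.univ.filter (g.Adj v)).card

open Classical in
/-- The real adjacency matrix. -/
noncomputable def adjM (g : SimpleGraph V) : Matrix V V ℝ := g.adjMatrix ℝ

theorem nodeDeg_eq_sum (g : SimpleGraph V) (v : V) : (nodeDeg g v : ℝ) = ∑ u, adjM g v u := by
  classical
  simp [nodeDeg, adjM, SimpleGraph.adjMatrix_apply]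

theorem adjM_comm (g : SimpleGraph V) (u v : V) : adjM g u v = adjM g v u := by
  classical
  simp [adjM, SimpleGraph.adjMatrix_apply, SimpleGraph.adj_comm]

theorem adjM_nonneg (g : SimpleGraph V) (u v : V) : 0 ≤ adjM g u v := by
  classical
  simp only [adjM, SimpleGraph.adjMatrix_apply]; split_ifs <;> norm_num

theorem adjM_le_one (g : SimpleGraph V) (u v : V) : adjM g u v ≤ 1 := by
  classical
  simp only [adjM, SimpleGraph.adjMatrix_apply]; split_ifs <;> norm_num

theorem graphLaplacian_mulVec (g : SimpleGraph V) (x : V → ℝ) (v : V) :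
    (graphLaplacian g *ᵥ x) v = nodeDeg g v * x v - (adjM g *ᵥ x) v := by
  classical
  rw [graphLaplacian, SimpleGraph.lapMatrix_mulVec_apply]
  congr 1
  · congr 2
    rw [nodeDeg, ← SimpleGraph.card_neighborFinset_eq_degree]
    congr 1
    ext u; simp
  · simp only [adjM, SimpleGraph.adjMatrix_mulVec_apply]

theorem graphLaplacian_mulVec_eq_sum (g : SimpleGraph V) (x : V → ℝ) (v : V) :
    (graphLaplacian g *ᵥ x) v = ∑ u, adjM g v u * (x v - x u) := by
  rw [graphLaplacian_mulVec, nodeDeg_eq_sum]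
  simp only [mul_sub, Finset.sum_sub_distrib, Finset.sum_mul, mulVec, dotProduct]

theorem sum_graphLaplacian_mulVec (g : SimpleGraph V) (x : V → ℝ) :
    ∑ v, (graphLaplacian g *ᵥ x) v = 0 := by
  simp only [graphLaplacian_mulVec_eq_sum, mul_sub, Finset.sum_sub_distrib]
  rw [sub_eq_zero]
  conv_rhs => rw [Finset.sum_comm]
  simp only [adjM_comm g]

theorem nodeDeg_le (g : SimpleGraph V) (v : V) : nodeDeg g v ≤ Fintype.card V :=
  Finset.card_le_univ _

end Laplacian

/-! ### The eigenvalue equation on one cluster -/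

section Cluster

open Matrix

variable {r : ℕ} {n : Fin (r + 1) → ℕ} {p : Fin (r + 1) → Fin (r + 1) → ℝ}

/-- The mean number of neighbours outside the own cluster. -/
def meanOut (n : Fin (r + 1) → ℕ) (p : Fin (r + 1) → Fin (r + 1) → ℝ) (i : Fin (r + 1)) : ℝ :=
  ∑ j ∈ Finset.univ.erase i, (n j : ℝ) * p i j

/-- The sum of the entries belonging to a cluster. -/
def clusterSum (y : ClusterNode n → ℝ) (k : Fin (r + 1)) : ℝ := ∑ x : Fin (n k), y ⟨k, x⟩

theorem adjM_eq_edgeDev_add (g : SimpleGraph (ClusterNode n)) (u v : ClusterNode n) :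
    adjM g u v = edgeDev p g u v + p u.1 v.1 := by
  classical
  simp only [adjM, SimpleGraph.adjMatrix_apply, edgeDev, sub_add_cancel]

theorem adjM_innerGraph (g : SimpleGraph (ClusterNode n)) (i : Fin (r + 1)) (x y : Fin (n i)) :
    adjM (innerGraph g i) x y = adjM g ⟨i, x⟩ ⟨i, y⟩ := rfl

/-- Each outer adjacency entry is split into mean and deviation; the means contribute only through
the mean outer degree and the cluster sums. -/
theorem graphLaplacian_mulVec_cluster (p : Fin (r + 1) → Fin (r + 1) → ℝ)
    (g : SimpleGraph (ClusterNode n)) (y : ClusterNode n → ℝ) (i : Fin (r + 1)) (x : Fin (n i)) :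
    (graphLaplacian g *ᵥ y) ⟨i, x⟩ =
      (graphLaplacian (innerGraph g i) *ᵥ fun a => y ⟨i, a⟩) x +
        (meanOut n p i + outDev p g i x) * y ⟨i, x⟩ -
        ∑ j ∈ Finset.univ.erase i, (∑ b, edgeDev p g ⟨i, x⟩ ⟨j, b⟩ * y ⟨j, b⟩ +
          p i j * clusterSum y j) := by
  rw [graphLaplacian_mulVec_eq_sum, Fintype.sum_sigma,
    ← Finset.add_sum_erase _ _ (Finset.mem_univ i), add_sub_assoc]
  congr 1
  · rw [graphLaplacian_mulVec_eq_sum]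
    simp only [adjM_innerGraph]
  · rw [meanOut, outDev, ← Finset.sum_add_distrib, Finset.sum_mul, ← Finset.sum_sub_distrib]
    refine Finset.sum_congr rfl fun j _ => ?_
    simp only [adjM_eq_edgeDev_add (p := p), clusterDev, clusterSum]
    simp only [add_mul, mul_sub, Finset.sum_add_distrib, Finset.sum_sub_distrib, Finset.sum_const,
      Finset.card_univ, Fintype.card_fin, nsmul_eq_mul, Finset.mul_sum, Finset.sum_mul]
    ring

theorem nodeDeg_cluster (p : Fin (r + 1) → Fin (r + 1) → ℝ) (g : SimpleGraph (ClusterNode n))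
    (i : Fin (r + 1)) (x : Fin (n i)) :
    (nodeDeg g ⟨i, x⟩ : ℝ) = nodeDeg (innerGraph g i) x + meanOut n p i + outDev p g i x := by
  rw [nodeDeg_eq_sum, nodeDeg_eq_sum, Fintype.sum_sigma,
    ← Finset.add_sum_erase _ _ (Finset.mem_univ i), add_assoc]
  congr 1
  rw [meanOut, outDev, ← Finset.sum_add_distrib]
  refine Finset.sum_congr rfl fun j _ => ?_
  simp only [adjM_eq_edgeDev_add (p := p), clusterDev, Finset.sum_add_distrib, Finset.sum_const,
    Finset.card_univ, Fintype.card_fin, nsmul_eq_mul]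
  ring

theorem edgeDev_comm (hp : ∀ i j, i ≠ j → p i j ∈ Set.Icc (0 : ℝ) 1 ∧ p i j = p j i)
    (g : SimpleGraph (ClusterNode n)) {u v : ClusterNode n} (huv : u.1 ≠ v.1) :
    edgeDev p g u v = edgeDev p g v u := by
  classical
  simp only [edgeDev, SimpleGraph.adj_comm, (hp _ _ huv).2]

/-- The error term in the equation for the cluster sums. -/
noncomputable def clusterErr (p : Fin (r + 1) → Fin (r + 1) → ℝ) (g : SimpleGraph (ClusterNode n))
    (y : ClusterNode n → ℝ) (i : Fin (r + 1)) : ℝ :=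
  ∑ j ∈ Finset.univ.erase i, (∑ x, clusterDev p g i j x * y ⟨i, x⟩ -
    ∑ b, clusterDev p g j i b * y ⟨j, b⟩)

/-- The arbitrary inner graph disappears because its Laplacian has zero column sums. What remains is
linear in the cluster sums, up to the degree-deviation error. -/
theorem sum_graphLaplacian_mulVec_cluster
    (hp : ∀ i j, i ≠ j → p i j ∈ Set.Icc (0 : ℝ) 1 ∧ p i j = p j i)
    (g : SimpleGraph (ClusterNode n)) (y : ClusterNode n → ℝ) (i : Fin (r + 1)) :
    ∑ x, (graphLaplacian g *ᵥ y) ⟨i, x⟩ = meanOut n p i * clusterSum y i -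
      n i * ∑ j ∈ Finset.univ.erase i, p i j * clusterSum y j + clusterErr p g y i := by
  simp only [graphLaplacian_mulVec_cluster p]
  rw [Finset.sum_sub_distrib, Finset.sum_add_distrib, sum_graphLaplacian_mulVec, zero_add]
  simp only [add_mul, Finset.sum_add_distrib, ← Finset.mul_sum, Finset.sum_const, Finset.card_univ,
    Fintype.card_fin, nsmul_eq_mul]
  have h1 : ∑ x : Fin (n i), outDev p g i x * y ⟨i, x⟩ =
      ∑ j ∈ Finset.univ.erase i, ∑ x, clusterDev p g i j x * y ⟨i, x⟩ := by
    simp only [outDev, Finset.sum_mul]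
    rw [Finset.sum_comm]
  have h2 : ∑ x : Fin (n i), ∑ j ∈ Finset.univ.erase i,
      ∑ b, edgeDev p g ⟨i, x⟩ ⟨j, b⟩ * y ⟨j, b⟩ =
      ∑ j ∈ Finset.univ.erase i, ∑ b, clusterDev p g j i b * y ⟨j, b⟩ := by
    rw [Finset.sum_comm]
    refine Finset.sum_congr rfl fun j hj => ?_
    rw [Finset.sum_comm]
    refine Finset.sum_congr rfl fun b _ => ?_
    rw [clusterDev, Finset.sum_mul]
    refine Finset.sum_congr rfl fun x _ => ?_
    rw [edgeDev_comm hp g (u := ⟨i, x⟩) (v := ⟨j, b⟩) (Finset.ne_of_mem_erase hj).symm]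
  rw [h1, h2, clusterErr, Finset.sum_sub_distrib]
  simp only [clusterSum]
  ring

/-- The deviation vector is the centred block applied to the all-ones vector of cluster j, which has
norm √n_j. -/
theorem CrossBound.sum_clusterDev_sq_le {g : SimpleGraph (ClusterNode n)} (h : CrossBound p g)
    {i j : Fin (r + 1)} (hij : i ≠ j) :
    √(∑ x, clusterDev p g i j x ^ 2) ≤ 8 * totalSize n := by
  have h1 := h i j hij (fun _ => 1)
  simp only [mul_one, one_pow, Finset.sum_const, Finset.card_univ, Fintype.card_fin,
    nsmul_eq_mul] at h1
  calc √(∑ x, clusterDev p g i j x ^ 2) ≤ 8 * √(totalSize n) * √(n j) := h1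
    _ ≤ 8 * √(totalSize n) * √(totalSize n) := by
        gcongr; exact le_totalSize j
    _ = 8 * totalSize n := by rw [mul_assoc, Real.mul_self_sqrt (Nat.cast_nonneg _)]

theorem sum_cluster_sq_le (y : ClusterNode n → ℝ) (i : Fin (r + 1)) :
    ∑ x : Fin (n i), y ⟨i, x⟩ ^ 2 ≤ ∑ v, y v ^ 2 := by
  rw [Fintype.sum_sigma]
  exact Finset.single_le_sum (f := fun i => ∑ x : Fin (n i), y ⟨i, x⟩ ^ 2)
    (fun _ _ => Finset.sum_nonneg fun _ _ => sq_nonneg _) (Finset.mem_univ i)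

theorem CrossBound.abs_sum_clusterDev_mul_le {g : SimpleGraph (ClusterNode n)}
    (h : CrossBound p g) {i j : Fin (r + 1)} (hij : i ≠ j) {y : ClusterNode n → ℝ}
    (hy : ∑ v, y v ^ 2 ≤ 1) : |∑ x, clusterDev p g i j x * y ⟨i, x⟩| ≤ 8 * totalSize n := by
  calc |∑ x, clusterDev p g i j x * y ⟨i, x⟩|
      ≤ √((∑ x, clusterDev p g i j x ^ 2) * ∑ x, y ⟨i, x⟩ ^ 2) :=
        Real.abs_le_sqrt (Finset.sum_mul_sq_le_sq_mul_sq _ _ _)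
    _ = √(∑ x, clusterDev p g i j x ^ 2) * √(∑ x, y ⟨i, x⟩ ^ 2) :=
        Real.sqrt_mul (Finset.sum_nonneg fun _ _ => sq_nonneg _) _
    _ ≤ (8 * totalSize n) * 1 := by
        have := h.sum_clusterDev_sq_le hij
        gcongr
        exact Real.sqrt_le_one.2 ((sum_cluster_sq_le y i).trans hy)
    _ = _ := mul_one _

theorem abs_clusterErr_le {g : SimpleGraph (ClusterNode n)} {y : ClusterNode n → ℝ} {B : ℝ}
    (hB : ∀ i j, i ≠ j → |∑ x, clusterDev p g i j x * y ⟨i, x⟩| ≤ B) (i : Fin (r + 1)) :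
    |clusterErr p g y i| ≤ r * (2 * B) := by
  calc |clusterErr p g y i| ≤ ∑ j ∈ Finset.univ.erase i, |∑ x, clusterDev p g i j x * y ⟨i, x⟩ -
        ∑ b, clusterDev p g j i b * y ⟨j, b⟩| := Finset.abs_sum_le_sum_abs _ _
    _ ≤ ∑ j ∈ Finset.univ.erase i, 2 * B := by
        refine Finset.sum_le_sum fun j hj => (abs_sub _ _).trans ?_
        have hji := Finset.ne_of_mem_erase hj
        linarith [hB i j hji.symm, hB j i hji]
    _ = r * (2 * B) := by
        rw [Finset.sum_const, Finset.card_erase_of_mem (Finset.mem_univ i)]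
        simp

theorem sum_outDev_sq_le {g : SimpleGraph (ClusterNode n)} (h : CrossBound p g)
    (i : Fin (r + 1)) : ∑ x, outDev p g i x ^ 2 ≤ 64 * r ^ 2 * (totalSize n : ℝ) ^ 2 := by
  have hcard : (Finset.univ.erase i).card = r := by
    rw [Finset.card_erase_of_mem (Finset.mem_univ i)]; simp
  calc ∑ x, outDev p g i x ^ 2
      ≤ ∑ x, (r : ℝ) * ∑ j ∈ Finset.univ.erase i, clusterDev p g i j x ^ 2 := by
        refine Finset.sum_le_sum fun x _ => ?_
        have := sq_sum_le_card_mul_sum_sq (s := Finset.univ.erase i)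
          (f := fun j => clusterDev p g i j x)
        rwa [hcard] at this
    _ = r * ∑ j ∈ Finset.univ.erase i, ∑ x, clusterDev p g i j x ^ 2 := by
        rw [← Finset.mul_sum, Finset.sum_comm]
    _ ≤ r * ∑ j ∈ Finset.univ.erase i, (8 * (totalSize n : ℝ)) ^ 2 := by
        gcongr with j hj
        have := h.sum_clusterDev_sq_le (Finset.ne_of_mem_erase hj).symm
        exact (Real.sqrt_le_left (by positivity)).1 this
    _ = _ := by rw [Finset.sum_const, hcard, nsmul_eq_mul]; ring

/-- The rows in `Γ` of the shifted Laplacian. -/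
noncomputable def shiftedRows {k : ℕ} (h : SimpleGraph (Fin k)) (Γ : Finset (Fin k)) (θ : ℤ) :
    Matrix (Fin k) (Fin k) ℝ :=
  Matrix.of fun v u => if v ∈ Γ then (graphLaplacian h + (θ : ℝ) • (1 : Matrix (Fin k) (Fin k) ℝ)) v u
    else 0

theorem shiftedRows_mulVec {k : ℕ} (h : SimpleGraph (Fin k)) (Γ : Finset (Fin k)) (θ : ℤ)
    (x : Fin k → ℝ) (v : Fin k) : (shiftedRows h Γ θ *ᵥ x) v =
      if v ∈ Γ then (graphLaplacian h *ᵥ x) v + θ * x v else 0 := by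
  by_cases hv : v ∈ Γ
  · have : (shiftedRows h Γ θ *ᵥ x) v =
        ((graphLaplacian h + (θ : ℝ) • (1 : Matrix (Fin k) (Fin k) ℝ)) *ᵥ x) v := by
      simp only [mulVec, dotProduct, shiftedRows, Matrix.of_apply, hv, if_true]
    rw [this, add_mulVec, smul_mulVec, one_mulVec]
    simp [hv]
  · simp [mulVec, dotProduct, shiftedRows, hv]

theorem sq_add_four_le (a b c d : ℝ) :
    (a + b + c + d) ^ 2 ≤ 4 * (a ^ 2 + b ^ 2 + c ^ 2 + d ^ 2) := by
  nlinarith [sq_nonneg (a - b), sq_nonneg (a - c), sq_nonneg (a - d), sq_nonneg (b - c),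
    sq_nonneg (b - d), sq_nonneg (c - d)]

theorem meanOut_mem (hp : ∀ i j, i ≠ j → p i j ∈ Set.Icc (0 : ℝ) 1 ∧ p i j = p j i)
    (i : Fin (r + 1)) : 0 ≤ meanOut n p i ∧ meanOut n p i ≤ totalSize n := by
  constructor
  · exact Finset.sum_nonneg fun j hj =>
      mul_nonneg (Nat.cast_nonneg _) (hp i j (Finset.ne_of_mem_erase hj).symm).1.1
  · rw [totalSize, Nat.cast_sum]
    calc meanOut n p i ≤ ∑ j ∈ Finset.univ.erase i, (n j : ℝ) := by
          refine Finset.sum_le_sum fun j hj => mul_le_of_le_one_right (Nat.cast_nonneg _)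
            (hp i j (Finset.ne_of_mem_erase hj).symm).1.2
      _ ≤ _ := Finset.sum_le_sum_of_subset_of_nonneg (Finset.subset_univ _)
          fun _ _ _ => Nat.cast_nonneg _

/-- On the nodes with moderate outer degree deviation, an eigenvector is nearly in the kernel of a
shift of the inner Laplacian. -/
theorem sum_shiftedRows_mulVec_sq_le
    (hp : ∀ i j, i ≠ j → p i j ∈ Set.Icc (0 : ℝ) 1 ∧ p i j = p j i)
    {g : SimpleGraph (ClusterNode n)} (hcross : CrossBound p g) {y : ClusterNode n → ℝ} {l : ℝ}
    (hy : ∑ v, y v ^ 2 ≤ 1) (hly : graphLaplacian g *ᵥ y = l • y) {Z : ℝ}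
    (hZ : ∀ k, |clusterSum y k| ≤ Z) (i : Fin (r + 1)) (Γ : Finset (Fin (n i))) {θ : ℤ}
    (hθ : |θ - (meanOut n p i - l)| ≤ 1) {T : ℝ} (hN : 1 ≤ (totalSize n : ℝ))
    (hΓ : ∀ x ∈ Γ, |outDev p g i x| ≤ T * √(totalSize n)) :
    ∑ x, (shiftedRows (innerGraph g i) Γ θ *ᵥ fun a => y ⟨i, a⟩) x ^ 2 ≤
      4 * (1 + T ^ 2 + 64 * r ^ 2 + r ^ 2 * Z ^ 2) * totalSize n := by
  have hni : (n i : ℝ) ≤ totalSize n := by exact_mod_cast le_totalSize i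
  generalize hNdef : (totalSize n : ℝ) = N at *
  have hN0 : 0 ≤ N := by linarith
  have hcard : (Finset.univ.erase i).card = r := by
    rw [Finset.card_erase_of_mem (Finset.mem_univ i)]; simp
  have hyi : ∑ x, y ⟨i, x⟩ ^ 2 ≤ 1 := (sum_cluster_sq_le y i).trans hy
  set f : Fin (n i) → ℝ := fun x =>
    ∑ j ∈ Finset.univ.erase i, ∑ b, edgeDev p g ⟨i, x⟩ ⟨j, b⟩ * y ⟨j, b⟩ with hf
  set d : ℝ := ∑ j ∈ Finset.univ.erase i, p i j * clusterSum y j with hd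
  have hpt : ∀ x, (shiftedRows (innerGraph g i) Γ θ *ᵥ fun a => y ⟨i, a⟩) x ^ 2 ≤
      4 * (y ⟨i, x⟩ ^ 2 + T ^ 2 * N * y ⟨i, x⟩ ^ 2 + f x ^ 2 + d ^ 2) := by
    intro x
    rw [shiftedRows_mulVec]
    split_ifs with hx
    · have heq := graphLaplacian_mulVec_cluster p g y i x
      rw [hly, Pi.smul_apply, smul_eq_mul, Finset.sum_add_distrib] at heq
      -- Four remainders: rounding of the shift, outer degree deviation, centred blocks applied to
      -- the other parts of y, and a constant from the cluster sums. They produce the four terms of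
      -- the final constant.
      have h1 : (graphLaplacian (innerGraph g i) *ᵥ fun a => y ⟨i, a⟩) x + θ * y ⟨i, x⟩ =
          (θ - (meanOut n p i - l)) * y ⟨i, x⟩ + -(outDev p g i x * y ⟨i, x⟩) + f x + d := by
        rw [hf, hd]; linear_combination -heq
      rw [h1]
      refine (sq_add_four_le _ _ _ _).trans ?_
      have h2 : ((θ - (meanOut n p i - l)) * y ⟨i, x⟩) ^ 2 ≤ y ⟨i, x⟩ ^ 2 := by
        rw [mul_pow]
        refine mul_le_of_le_one_left (sq_nonneg _) ?_
        rw [← sq_abs]; exact pow_le_one₀ (abs_nonneg _) hθ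
      have h3 : (-(outDev p g i x * y ⟨i, x⟩)) ^ 2 ≤ T ^ 2 * N * y ⟨i, x⟩ ^ 2 := by
        rw [neg_sq, mul_pow]
        gcongr
        rw [← sq_abs, ← Real.sq_sqrt hN0, ← mul_pow]
        have := hΓ x hx
        gcongr
      linarith
    · rw [zero_pow two_ne_zero]
      positivity
  have hfsum : ∑ x, f x ^ 2 ≤ 64 * r ^ 2 * N := by
    calc ∑ x, f x ^ 2 ≤ ∑ x, (r : ℝ) * ∑ j ∈ Finset.univ.erase i,
          (∑ b, edgeDev p g ⟨i, x⟩ ⟨j, b⟩ * y ⟨j, b⟩) ^ 2 := by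
          refine Finset.sum_le_sum fun x _ => ?_
          have := sq_sum_le_card_mul_sum_sq (s := Finset.univ.erase i)
            (f := fun j => ∑ b, edgeDev p g ⟨i, x⟩ ⟨j, b⟩ * y ⟨j, b⟩)
          rwa [hcard] at this
      _ = r * ∑ j ∈ Finset.univ.erase i, ∑ x,
          (∑ b, edgeDev p g ⟨i, x⟩ ⟨j, b⟩ * y ⟨j, b⟩) ^ 2 := by
          rw [← Finset.mul_sum, Finset.sum_comm]
      _ ≤ r * ∑ j ∈ Finset.univ.erase i, (8 * √N) ^ 2 := by
          gcongr with j hj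
          have h1 := hcross i j (Finset.ne_of_mem_erase hj).symm fun b => y ⟨j, b⟩
          refine (Real.sqrt_le_left (by positivity)).1 (h1.trans ?_)
          rw [hNdef]
          refine mul_le_of_le_one_right (by positivity) (Real.sqrt_le_one.2 ?_)
          exact (sum_cluster_sq_le y j).trans hy
      _ = _ := by
          rw [Finset.sum_const, hcard, nsmul_eq_mul, mul_pow, Real.sq_sqrt hN0]; ring
  have hd2 : d ^ 2 ≤ r ^ 2 * Z ^ 2 := by
    have : |d| ≤ r * Z := by
      calc |d| ≤ ∑ j ∈ Finset.univ.erase i, |p i j * clusterSum y j| :=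
            Finset.abs_sum_le_sum_abs _ _
        _ ≤ ∑ j ∈ Finset.univ.erase i, Z := by
            refine Finset.sum_le_sum fun j hj => ?_
            have hpij := (hp i j (Finset.ne_of_mem_erase hj).symm).1
            rw [abs_mul, abs_of_nonneg hpij.1]
            calc p i j * |clusterSum y j| ≤ 1 * |clusterSum y j| := by gcongr; exact hpij.2
              _ ≤ Z := by rw [one_mul]; exact hZ j
        _ = r * Z := by rw [Finset.sum_const, hcard, nsmul_eq_mul]
    rw [← mul_pow, ← sq_abs]
    gcongr
  calc _ ≤ ∑ x, 4 * (y ⟨i, x⟩ ^ 2 + T ^ 2 * N * y ⟨i, x⟩ ^ 2 + f x ^ 2 + d ^ 2) :=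
        Finset.sum_le_sum fun x _ => hpt x
    _ = 4 * (∑ x, y ⟨i, x⟩ ^ 2 + T ^ 2 * N * ∑ x, y ⟨i, x⟩ ^ 2 + ∑ x, f x ^ 2 +
          n i * d ^ 2) := by
        rw [← Finset.mul_sum]
        simp only [Finset.sum_add_distrib, ← Finset.mul_sum, Finset.sum_const, Finset.card_univ,
          Fintype.card_fin, nsmul_eq_mul]
    _ ≤ 4 * (1 * N + T ^ 2 * N * 1 + 64 * r ^ 2 * N + N * (r ^ 2 * Z ^ 2)) := by
        gcongr
        linarith
    _ = _ := by ring

/-- The degree deviations of a cluster are almost orthogonal to a low eigenvector. -/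
theorem abs_sum_clusterDev_mul_le_of_events
    (hp : ∀ i j, i ≠ j → p i j ∈ Set.Icc (0 : ℝ) 1 ∧ p i j = p j i)
    {g : SimpleGraph (ClusterNode n)} (hcross : CrossBound p g) {y : ClusterNode n → ℝ} {l : ℝ}
    (hy : ∑ v, y v ^ 2 ≤ 1) (hly : graphLaplacian g *ᵥ y = l • y) (hl0 : 0 ≤ l)
    (hl : l ≤ 2 * totalSize n) {Z : ℝ} (hZ : ∀ k, |clusterSum y k| ≤ Z)
    (hN : (r : ℝ) + 3 ≤ √(totalSize n)) {i j : Fin (r + 1)} (hij : i ≠ j) {τ c T U η : ℝ}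
    (hc : 0 < c) (hη : 0 ≤ η) (hcτ : 1 ≤ c ^ 2 * τ) (hT : 0 < T)
    (hTτ : 128 * r ^ 2 ≤ T ^ 2 * τ)
    (hU : 4 * (1 + T ^ 2 + 64 * r ^ 2 + r ^ 2 * Z ^ 2) ≤ U ^ 2) (hU0 : 0 ≤ U)
    (hUc : 8 * U ≤ η * c)
    (htrial : ∀ S : Finset (Fin (n i)), r + 1 ≤ S.card →
      ∃ x ∈ S, l ≤ nodeDeg g ⟨i, x⟩ + ((r : ℝ) + 1))
    (hlow : ∀ t : ℕ, τ / 2 * totalSize n ≤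
        (Finset.univ.filter fun x => nodeDeg (innerGraph g i) x < t).card →
      r + 1 ≤ ((Finset.univ.filter fun x => nodeDeg (innerGraph g i) x < t).filter
        fun x => outDev p g i x ≤ -((2 * c + 1) * √(totalSize n))).card)
    (hproj : ∀ (Γ : Finset (Fin (n i))) (θ : ℤ), (Γᶜ.card : ℝ) ≤ τ * totalSize n →
      |(θ : ℝ)| ≤ 3 * totalSize n →
      ((nearKernelIndex (shiftedRows (innerGraph g i) Γ θ) (c * √(totalSize n))).card : ℝ) ≤
        3 * τ * totalSize n →
      √(∑ a ∈ nearKernelIndex (shiftedRows (innerGraph g i) Γ θ) (c * √(totalSize n)),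
        (∑ v, nearKernelBasis (shiftedRows (innerGraph g i) Γ θ) (c * √(totalSize n)) a v *
          clusterDev p g i j v) ^ 2) ≤ η * totalSize n) :
    |∑ x, clusterDev p g i j x * y ⟨i, x⟩| ≤ 2 * η * totalSize n := by
  have hNN : (totalSize n : ℝ) = √(totalSize n) ^ 2 := (Real.sq_sqrt (Nat.cast_nonneg _)).symm
  have hs : 0 < √(totalSize n : ℝ) := by
    have : (0 : ℝ) ≤ r := Nat.cast_nonneg r
    linarith
  have hN1 : 1 ≤ (totalSize n : ℝ) := by
    rw [hNN]
    have : (0 : ℝ) ≤ r := Nat.cast_nonneg r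
    nlinarith
  have hmean := meanOut_mem (n := n) hp i
  have hni : (n i : ℝ) ≤ totalSize n := by exact_mod_cast le_totalSize i
  have hout := sum_outDev_sq_le hcross i
  have hdev := hcross.sum_clusterDev_sq_le hij
  have hnear := fun (Γ : Finset (Fin (n i))) (θ : ℤ) hθ hΓ =>
    sum_shiftedRows_mulVec_sq_le hp hcross hy hly hZ i Γ (θ := θ) hθ (T := T) hN1 hΓ
  generalize hNdef : (totalSize n : ℝ) = N at *
  generalize √N = s at *
  -- Rounding the shift to an integer leaves O(N) candidates for the union bound and costs only an
  -- error of norm at most 1.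
  set θ : ℤ := ⌊meanOut n p i - l⌋ with hθdef
  have hθ1 : (θ : ℝ) ≤ meanOut n p i - l := Int.floor_le _
  have hθ2 : meanOut n p i - l < θ + 1 := Int.lt_floor_add_one _
  have hθabs : |(θ : ℝ) - (meanOut n p i - l)| ≤ 1 := by
    rw [abs_le]; constructor <;> linarith
  set ρ : ℝ := c * s with hρdef
  have hρ : 0 < ρ := by positivity
  -- Rows are discarded for two reasons: a large outer deviation, rare by Chebyshev's inequality, or
  -- an inner degree too small for the shifted diagonal to reach 2ρ.
  set big : Finset (Fin (n i)) := Finset.univ.filter fun x => T * s < |outDev p g i x| with hbig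
  set bad : Finset (Fin (n i)) :=
    Finset.univ.filter fun x => nodeDeg (innerGraph g i) x < ⌈2 * ρ - θ⌉₊ with hbad
  set Γ : Finset (Fin (n i)) := (big ∪ bad)ᶜ with hΓ
  have hbigcard : (big.card : ℝ) ≤ τ / 2 * N := by
    have h1 : (big.card : ℝ) * (T * s) ^ 2 ≤ 64 * r ^ 2 * N ^ 2 := by
      calc (big.card : ℝ) * (T * s) ^ 2 = ∑ x ∈ big, (T * s) ^ 2 := by
            rw [Finset.sum_const, nsmul_eq_mul]
        _ ≤ ∑ x ∈ big, outDev p g i x ^ 2 := by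
            refine Finset.sum_le_sum fun x hx => ?_
            rw [← sq_abs (outDev p g i x)]
            have := (Finset.mem_filter.1 hx).2
            gcongr
        _ ≤ ∑ x, outDev p g i x ^ 2 :=
            Finset.sum_le_sum_of_subset_of_nonneg (Finset.subset_univ _) fun _ _ _ => sq_nonneg _
        _ ≤ _ := hout
    rw [mul_pow, ← hNN] at h1
    have hTN : 0 < T ^ 2 * N := by positivity
    refine le_of_mul_le_mul_right (h1.trans ?_) hTN
    nlinarith [sq_nonneg N]
  -- Were there too many, r + 1 of them would have outer deviation at most -(2c+1)√N. Their degree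
  -- plus r + 1 is then below l + r + 2 - √N < l, against the trial bound; hence the requirement √N
  -- ≥ r + 3.
  have hbadcard : (bad.card : ℝ) ≤ τ / 2 * N := by
    by_contra hcon
    obtain ⟨x, hx, hlx⟩ := htrial _ (hlow _ (not_le.1 hcon).le)
    rw [Finset.mem_filter, Finset.mem_filter] at hx
    obtain ⟨⟨-, hx1⟩, hx2⟩ := hx
    have hx1' := Nat.lt_ceil.1 hx1
    rw [nodeDeg_cluster p] at hlx
    nlinarith
  have hΓc : (Γᶜ.card : ℝ) ≤ τ * N := by
    have : (Γᶜ.card : ℝ) ≤ big.card + bad.card := by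
      rw [hΓ, compl_compl]; exact_mod_cast Finset.card_union_le _ _
    linarith
  have hΓout : ∀ x ∈ Γ, |outDev p g i x| ≤ T * s := by
    intro x hx
    rw [hΓ, Finset.mem_compl, Finset.mem_union, not_or] at hx
    by_contra hcon
    exact hx.1 (Finset.mem_filter.2 ⟨Finset.mem_univ _, not_le.1 hcon⟩)
  have hΓdeg : ∀ x ∈ Γ, 2 * ρ ≤ nodeDeg (innerGraph g i) x + θ := by
    intro x hx
    rw [hΓ, Finset.mem_compl, Finset.mem_union, not_or] at hx
    by_contra hcon
    refine hx.2 (Finset.mem_filter.2 ⟨Finset.mem_univ _, Nat.lt_ceil.2 ?_⟩)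
    linarith [not_le.1 hcon]
  set M := shiftedRows (innerGraph g i) Γ θ with hM
  -- The Hilbert–Schmidt term contributes N²/ρ² = N/c² ≤ τN and the discarded rows 2τN, so the
  -- dimension is at most 3τN.
  have hdim := card_nearKernelIndex_le M (adjM (innerGraph g i)) hρ Γ
    (fun x => nodeDeg (innerGraph g i) x + θ) (fun v hv x => by
      rw [hM, shiftedRows_mulVec, if_pos hv, graphLaplacian_mulVec]; ring) hΓdeg
  have hHS : ∑ v, ∑ u, adjM (innerGraph g i) v u ^ 2 ≤ N ^ 2 := by
    calc ∑ v, ∑ u, adjM (innerGraph g i) v u ^ 2 ≤ ∑ _v : Fin (n i), ∑ _u : Fin (n i), (1 : ℝ) :=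
          Finset.sum_le_sum fun v _ => Finset.sum_le_sum fun u _ =>
            pow_le_one₀ (adjM_nonneg _ _ _) (adjM_le_one _ _ _)
      _ = (n i : ℝ) ^ 2 := by simp [sq]
      _ ≤ N ^ 2 := by gcongr
  have hcard : ((nearKernelIndex M ρ).card : ℝ) ≤ 3 * τ * N := by
    have hρ2 : ρ ^ 2 = c ^ 2 * N := by rw [hρdef, mul_pow, ← hNN]
    have h1 : N ^ 2 ≤ ρ ^ 2 * (τ * N) := by
      rw [hρ2]; nlinarith [sq_nonneg N]
    have h2 : 2 * ρ ^ 2 * (Γᶜ.card : ℝ) ≤ 2 * ρ ^ 2 * (τ * N) := by gcongr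
    refine le_of_mul_le_mul_left (hdim.trans ?_) (by positivity : 0 < ρ ^ 2)
    linarith
  have hP := hproj Γ θ hΓc (by rw [abs_le]; constructor <;> linarith [hmean.1, hmean.2]) hcard
  have hnear' := hnear Γ θ hθabs hΓout
  have hsq : √(∑ x, (M *ᵥ fun a => y ⟨i, a⟩) x ^ 2) ≤ U * s := by
    refine (Real.sqrt_le_left (by positivity)).2 (hnear'.trans ?_)
    rw [mul_pow, ← hNN]
    gcongr
  -- The near-kernel part costs at most ηN by `hproj`; the rest costs at most 8N · U/c ≤ ηN.
  refine (abs_sum_mul_le_nearKernel M hρ _ fun a => y ⟨i, a⟩).trans ?_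
  have hy1 : √(∑ x, y ⟨i, x⟩ ^ 2) ≤ 1 := Real.sqrt_le_one.2 ((sum_cluster_sq_le y i).trans hy)
  calc _ ≤ η * N * 1 + 8 * N * (U * s / ρ) := by gcongr
    _ = η * N + N * (8 * U / c) := by rw [hρdef]; field_simp
    _ ≤ η * N + N * η := by
        gcongr
        rw [div_le_iff₀ hc]; exact hUc
    _ = 2 * η * N := by ring

end Cluster

/-! ### Inverting the linear system for the cluster sums -/

section Breakdown

open Matrix

variable {r : ℕ} {n : Fin (r + 1) → ℕ} {p : Fin (r + 1) → Fin (r + 1) → ℝ}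

theorem sum_erase_castSucc (f : Fin (r + 1) → ℝ) (i : Fin r) :
    ∑ j ∈ Finset.univ.erase i.castSucc, f j =
      ∑ j ∈ Finset.univ.erase i, f j.castSucc + f (Fin.last r) := by
  have h1 := Finset.add_sum_erase Finset.univ f (Finset.mem_univ i.castSucc)
  have h2 := Finset.add_sum_erase Finset.univ (fun j : Fin r => f j.castSucc) (Finset.mem_univ i)
  rw [Fin.sum_univ_castSucc] at h1
  linarith

/-- Eliminating the last sum through the zero total turns the drift of all r + 1 cluster sums into
the matrix Ã acting on the first r. -/
theorem breakdownMatrix_mulVec (n : Fin (r + 1) → ℕ) (p : Fin (r + 1) → Fin (r + 1) → ℝ)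
    {s : Fin (r + 1) → ℝ} (hs : ∑ k, s k = 0) (i : Fin r) :
    (breakdownMatrix n p *ᵥ fun j => s j.castSucc) i =
      meanOut n p i.castSucc * s i.castSucc -
        n i.castSucc * ∑ j ∈ Finset.univ.erase i.castSucc, p i.castSucc j * s j := by
  have hsum : s (Fin.last r) = -s i.castSucc - ∑ j ∈ Finset.univ.erase i, s j.castSucc := by
    rw [Fin.sum_univ_castSucc,
      ← Finset.add_sum_erase Finset.univ (fun j : Fin r => s j.castSucc) (Finset.mem_univ i)] at hs
    linarith
  rw [meanOut, sum_erase_castSucc, sum_erase_castSucc, hsum]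
  simp only [mulVec, dotProduct]
  rw [← Finset.add_sum_erase Finset.univ _ (Finset.mem_univ i)]
  have h1 : ∑ j ∈ Finset.univ.erase i, breakdownMatrix n p i j * s j.castSucc =
      ∑ j ∈ Finset.univ.erase i, (n i.castSucc : ℝ) *
        (p i.castSucc (Fin.last r) - p i.castSucc j.castSucc) * s j.castSucc := by
    refine Finset.sum_congr rfl fun j hj => ?_
    rw [breakdownMatrix, of_apply, if_neg (Finset.ne_of_mem_erase hj).symm]
  rw [h1, breakdownMatrix, of_apply, if_pos rfl]
  have h2 : ∑ j ∈ Finset.univ.erase i, (n i.castSucc : ℝ) *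
        (p i.castSucc (Fin.last r) - p i.castSucc j.castSucc) * s j.castSucc =
      n i.castSucc * (p i.castSucc (Fin.last r) * ∑ j ∈ Finset.univ.erase i, s j.castSucc -
        ∑ j ∈ Finset.univ.erase i, p i.castSucc j.castSucc * s j.castSucc) := by
    rw [Finset.mul_sum, ← Finset.sum_sub_distrib, Finset.mul_sum]
    exact Finset.sum_congr rfl fun j _ => by ring
  rw [h2]
  ring

/-- Multiply by the adjugate: its entries are determinants of matrices with entries at most B, hence
at most r! B^r. -/
theorem abs_apply_le_of_abs_mulVec_le (M : Matrix (Fin r) (Fin r) ℝ) {D B E : ℝ} (hD : 0 < D)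
    (hdet : D ≤ |M.det|) (hB1 : 1 ≤ B) (hM : ∀ i j, |M i j| ≤ B) (z : Fin r → ℝ)
    (h : ∀ i, |(M *ᵥ z) i| ≤ E) (i : Fin r) :
    |z i| ≤ r * (r.factorial * B ^ r) * E / D := by
  have hadj : ∀ i j, |M.adjugate i j| ≤ r.factorial * B ^ r := by
    intro i j
    rw [adjugate_apply]
    have := det_le (A := M.updateRow j (Pi.single i 1)) (abv := AbsoluteValue.abs) (x := B) (by
      intro a b
      rw [AbsoluteValue.abs_apply, updateRow_apply]
      split_ifs with hab
      · by_cases hb : b = i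
        · subst hb; simpa using hB1
        · rw [Pi.single_eq_of_ne hb]; simp; linarith
      · exact hM a b)
    simpa [nsmul_eq_mul] using this
  have h1 : M.det * z i = ∑ j, M.adjugate i j * (M *ᵥ z) j := by
    have h2 : (M.adjugate *ᵥ (M *ᵥ z)) i = M.det * z i := by
      rw [mulVec_mulVec, adjugate_mul, smul_mulVec, one_mulVec]; rfl
    rw [← h2]; rfl
  have hE : 0 ≤ E := (abs_nonneg _).trans (h i)
  rw [le_div_iff₀ hD]
  calc |z i| * D ≤ |z i| * |M.det| := by gcongr
    _ = |∑ j, M.adjugate i j * (M *ᵥ z) j| := by rw [← h1, abs_mul, mul_comm]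
    _ ≤ ∑ j, |M.adjugate i j * (M *ᵥ z) j| := Finset.abs_sum_le_sum_abs _ _
    _ ≤ ∑ _j : Fin r, (r.factorial * B ^ r) * E := by
        refine Finset.sum_le_sum fun j _ => ?_
        rw [abs_mul]
        exact mul_le_mul (hadj i j) (h j) (abs_nonneg _) (by positivity)
    _ = r * (r.factorial * B ^ r) * E := by simp; ring

/-- The determinant is the scaled characteristic polynomial at l, a product over the roots with
multiplicity. The roots are taken over ℂ because Ã need not be symmetric. -/
theorem pow_le_abs_det_of_spectrum (A : Matrix (Fin r) (Fin r) ℝ) {l ε N : ℝ} (hε : 0 ≤ ε)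
    (h : ∀ a ∈ spectrum ℂ (A.map (algebraMap ℝ ℂ)), ε ≤ ‖a / (N : ℂ) - ((l / N : ℝ) : ℂ)‖) :
    ε ^ r ≤ |((1 / N) • (l • (1 : Matrix (Fin r) (Fin r) ℝ) - A)).det| := by
  set Ac := A.map (algebraMap ℝ ℂ) with hAc
  have hdet : ((((1 / N) • (l • (1 : Matrix (Fin r) (Fin r) ℝ) - A)).det : ℝ) : ℂ) =
      (1 / (N : ℂ)) ^ r * Ac.charpoly.eval (l : ℂ) := by
    rw [eval_charpoly, det_smul, Fintype.card_fin]
    push_cast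
    congr 1
    have := (algebraMap ℝ ℂ).map_det (l • (1 : Matrix (Fin r) (Fin r) ℝ) - A)
    rw [Complex.coe_algebraMap] at this
    rw [this]
    congr 1
    ext a b
    simp only [hAc, RingHom.mapMatrix_apply, map_apply, Matrix.scalar_apply, Matrix.diagonal_apply,
      Matrix.one_apply, Matrix.sub_apply, Matrix.smul_apply, map_sub, smul_eq_mul]
    split_ifs <;> simp
  have hsplit : Ac.charpoly.Splits := IsAlgClosed.splits _
  rw [← Real.norm_eq_abs, ← Complex.norm_real, hdet, hsplit.eval_eq_prod_roots_of_monic Ac.charpoly_monic]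
  have hcard : Ac.charpoly.roots.card = r := by
    rw [← hsplit.natDegree_eq_card_roots, charpoly_natDegree_eq_dim, Fintype.card_fin]
  rw [norm_mul, norm_pow]
  have key : ∀ s : Multiset ℂ, (∀ a ∈ s, ε ≤ ‖a / (N : ℂ) - ((l / N : ℝ) : ℂ)‖) →
      ε ^ s.card ≤ ‖(1 / (N : ℂ))‖ ^ s.card * ‖(s.map fun a => (l : ℂ) - a).prod‖ := by
    intro s
    induction s using Multiset.induction_on with
    | empty => intro _; simp
    | cons a s ih =>
      intro hs
      have h1 := ih fun b hb => hs b (Multiset.mem_cons_of_mem hb)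
      have h2 := hs a (Multiset.mem_cons_self a s)
      rw [Multiset.card_cons, Multiset.map_cons, Multiset.prod_cons, norm_mul, pow_succ, pow_succ]
      have h3 : ‖a / (N : ℂ) - ((l / N : ℝ) : ℂ)‖ = ‖(1 / (N : ℂ))‖ * ‖(l : ℂ) - a‖ := by
        rw [← norm_mul, ← norm_neg]
        congr 1
        push_cast
        ring
      rw [h3] at h2
      calc ε ^ s.card * ε ≤ (‖(1 / (N : ℂ))‖ ^ s.card * ‖(s.map fun a => (l : ℂ) - a).prod‖) *
            (‖(1 / (N : ℂ))‖ * ‖(l : ℂ) - a‖) := mul_le_mul h1 h2 hε (by positivity)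
        _ = _ := by ring
  have := key Ac.charpoly.roots fun a ha =>
    h a (mem_spectrum_of_isRoot_charpoly ((Polynomial.mem_roots Ac.charpoly_monic.ne_zero).1 ha))
  rwa [hcard] at this

theorem abs_breakdownMatrix_le (hp : ∀ i j, i ≠ j → p i j ∈ Set.Icc (0 : ℝ) 1 ∧ p i j = p j i)
    (i j : Fin r) : |breakdownMatrix n p i j| ≤ 2 * totalSize n := by
  have hN : (totalSize n : ℝ) = ∑ k : Fin r, (n k.castSucc : ℝ) + n (Fin.last r) := by
    rw [totalSize, Fin.sum_univ_castSucc]; push_cast; rfl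
  have hlast : ∀ i : Fin r, i.castSucc ≠ Fin.last r := fun i => (Fin.castSucc_lt_last i).ne
  have hpi := (hp _ _ (hlast i)).1
  have hle : (n i.castSucc : ℝ) ≤ totalSize n := by exact_mod_cast le_totalSize i.castSucc
  rw [breakdownMatrix, of_apply]
  split_ifs with hij
  · have h1 : ∀ z ∈ Finset.univ.erase i, (n z.castSucc : ℝ) * p i.castSucc z.castSucc ∈
        Set.Icc 0 (n z.castSucc : ℝ) := by
      intro z hz
      have := (hp i.castSucc z.castSucc (by
        simpa [Fin.castSucc_inj] using (Finset.ne_of_mem_erase hz).symm)).1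
      exact ⟨mul_nonneg (Nat.cast_nonneg _) this.1, mul_le_of_le_one_right (Nat.cast_nonneg _) this.2⟩
    have h2 : 0 ≤ ∑ z ∈ Finset.univ.erase i, (n z.castSucc : ℝ) * p i.castSucc z.castSucc :=
      Finset.sum_nonneg fun z hz => (h1 z hz).1
    have h3 : ∑ z ∈ Finset.univ.erase i, (n z.castSucc : ℝ) * p i.castSucc z.castSucc ≤
        ∑ z ∈ Finset.univ.erase i, (n z.castSucc : ℝ) := Finset.sum_le_sum fun z hz => (h1 z hz).2
    have h4 := Finset.add_sum_erase Finset.univ (fun z : Fin r => (n z.castSucc : ℝ))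
      (Finset.mem_univ i)
    have h5 : 0 ≤ ((n i.castSucc : ℝ) + n (Fin.last r)) * p i.castSucc (Fin.last r) :=
      mul_nonneg (by positivity) hpi.1
    have h6 : ((n i.castSucc : ℝ) + n (Fin.last r)) * p i.castSucc (Fin.last r) ≤
        (n i.castSucc : ℝ) + n (Fin.last r) := mul_le_of_le_one_right (by positivity) hpi.2
    have h7 : (0 : ℝ) ≤ totalSize n := Nat.cast_nonneg _
    rw [abs_of_nonneg (by linarith)]
    linarith
  · have := (hp i.castSucc j.castSucc (by simpa [Fin.castSucc_inj] using hij)).1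
    rw [abs_mul, abs_of_nonneg (Nat.cast_nonneg _)]
    have h1 : |p i.castSucc (Fin.last r) - p i.castSucc j.castSucc| ≤ 1 :=
      abs_le.2 ⟨by linarith [hpi.1, this.2], by linarith [hpi.2, this.1]⟩
    calc (n i.castSucc : ℝ) * _ ≤ totalSize n * 1 := by gcongr
      _ ≤ 2 * totalSize n := by linarith [Nat.cast_nonneg (α := ℝ) (totalSize n)]

/-- The factor between the relative error and the cluster sums of an eigenvector. -/
noncomputable def breakdownFactor (r : ℕ) (ε : ℝ) : ℝ := r * (r * (r.factorial * 4 ^ r)) / ε ^ r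

theorem abs_clusterSum_le (hp : ∀ i j, i ≠ j → p i j ∈ Set.Icc (0 : ℝ) 1 ∧ p i j = p j i)
    (hr : 1 ≤ r) {g : SimpleGraph (ClusterNode n)} {y : ClusterNode n → ℝ} {l ε E : ℝ}
    (hN : 0 < (totalSize n : ℝ)) (hε : 0 < ε)
    (hly : graphLaplacian g *ᵥ y = l • y) (hl : |l| ≤ 2 * totalSize n) (hy0 : ∑ v, y v = 0)
    (hspec : ∀ a ∈ spectrum ℂ ((breakdownMatrix n p).map (algebraMap ℝ ℂ)),
      ε ≤ ‖a / (totalSize n : ℂ) - ((l / (totalSize n : ℝ) : ℝ) : ℂ)‖)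
    (hE : ∀ i, |clusterErr p g y i| ≤ E * totalSize n) (k : Fin (r + 1)) :
    |clusterSum y k| ≤ breakdownFactor r ε * E := by
  set N : ℝ := (totalSize n : ℝ) with hNdef
  have hs0 : ∑ k, clusterSum y k = 0 := by
    rw [← hy0, Fintype.sum_sigma]; rfl
  have heq : ∀ i : Fin r, (((1 / N) • (l • (1 : Matrix (Fin r) (Fin r) ℝ) - breakdownMatrix n p)) *ᵥ
      fun j => clusterSum y j.castSucc) i = (1 / N) * clusterErr p g y i.castSucc := by
    intro i
    have h1 := sum_graphLaplacian_mulVec_cluster hp g y i.castSucc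
    rw [hly] at h1
    simp only [Pi.smul_apply, smul_eq_mul, ← Finset.mul_sum] at h1
    have h2 := breakdownMatrix_mulVec n p hs0 i
    rw [smul_mulVec, sub_mulVec, smul_mulVec, one_mulVec]
    simp only [Pi.smul_apply, Pi.sub_apply, smul_eq_mul]
    rw [h2]
    congr 1
    change l * clusterSum y i.castSucc = _ at h1
    linarith
  have hbound : ∀ i : Fin r, |clusterSum y i.castSucc| ≤
      r * (r.factorial * 4 ^ r) * E / ε ^ r := by
    refine abs_apply_le_of_abs_mulVec_le
      ((1 / N) • (l • (1 : Matrix (Fin r) (Fin r) ℝ) - breakdownMatrix n p)) (pow_pos hε r)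
      (pow_le_abs_det_of_spectrum (breakdownMatrix n p) hε.le ?_) (by norm_num) ?_ _ ?_
    · simpa [hNdef] using hspec
    · intro i j
      rw [Matrix.smul_apply, smul_eq_mul, abs_mul, abs_of_pos (by positivity : 0 < 1 / N), Matrix.sub_apply,
        one_div, inv_mul_le_iff₀ hN]
      have h1 := abs_breakdownMatrix_le (n := n) hp i j
      have h2 : |(l • (1 : Matrix (Fin r) (Fin r) ℝ)) i j| ≤ 2 * N := by
        rw [Matrix.smul_apply, one_apply, smul_eq_mul]
        split_ifs
        · simpa using hl
        · simp; positivity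
      calc _ ≤ _ := abs_sub _ _
        _ ≤ 2 * N + 2 * N := add_le_add h2 h1
        _ = N * 4 := by ring
    · intro i
      rw [heq, abs_mul, abs_of_pos (by positivity : 0 < 1 / N), one_div, inv_mul_le_iff₀ hN,
        mul_comm N]
      exact hE _
  have hr' : (1 : ℝ) ≤ r := by exact_mod_cast hr
  have hE0 : 0 ≤ E := by
    have := (abs_nonneg _).trans (hE 0)
    exact nonneg_of_mul_nonneg_left this hN
  have hF : breakdownFactor r ε * E = r * (r * (r.factorial * 4 ^ r) * E / ε ^ r) := by
    rw [breakdownFactor]; ring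
  have hnn : 0 ≤ r * (r.factorial * 4 ^ r) * E / ε ^ r := by positivity
  rw [hF]
  -- The last cluster sum is minus the sum of the r others; this is the outer factor r in
  -- `breakdownFactor`.
  induction k using Fin.lastCases with
  | cast i => exact (hbound i).trans (le_mul_of_one_le_left hnn hr')
  | last =>
    rw [Fin.sum_univ_castSucc] at hs0
    have : clusterSum y (Fin.last r) = -∑ i : Fin r, clusterSum y i.castSucc := by linarith
    rw [this, abs_neg]
    refine (Finset.abs_sum_le_sum_abs _ _).trans ((Finset.sum_le_sum fun i _ => hbound i).trans ?_)
    simp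

end Breakdown

/-! ### Minimizers of the trace are transforms of eigenvectors -/

section Spectral

open Matrix

variable {V : Type*} [Fintype V] [DecidableEq V] {r : ℕ}

theorem isOrthoRows_eigenvectorBasis {S : Matrix V V ℝ} (hS : S.IsHermitian) :
    IsOrthoRows fun a => ⇑(hS.eigenvectorBasis a) := by
  intro a b
  have := (orthonormal_iff_ite.1 hS.eigenvectorBasis.orthonormal) b a
  rw [EuclideanSpace.inner_eq_star_dotProduct] at this
  simp only [dotProduct, star_trivial, eq_comm (a := b)] at this
  exact this

theorem exists_ne_zero_sum_mul_eq_zero (f : Fin r → Fin (r + 1) → ℝ) :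
    ∃ t : Fin (r + 1) → ℝ, t ≠ 0 ∧ ∀ c, ∑ j, f c j * t j = 0 := by
  have h : LinearMap.ker (Matrix.of f).mulVecLin ≠ ⊥ :=
    LinearMap.ker_ne_bot_of_finrank_lt (by simp)
  obtain ⟨t, ht, ht0⟩ := (Submodule.ne_bot_iff _).1 h
  exact ⟨t, ht0, fun c => congrFun (LinearMap.mem_ker.1 ht) c⟩

theorem isSpectralFeasible_iff {X : Matrix V (Fin r) ℝ} : IsSpectralFeasible X ↔
    (∀ a b, Xᵀ a ⬝ᵥ Xᵀ b = if a = b then 1 else 0) ∧ ∀ a, Xᵀ a ⬝ᵥ (fun _ => 1) = 0 := by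
  refine and_congr ⟨fun h a b => ?_, fun h => ?_⟩ ⟨fun h a => congrFun h a, fun h => funext h⟩
  · have := congrFun (congrFun h a) b
    rwa [one_apply] at this
  · ext a b
    rw [one_apply]
    exact h a b

theorem trace_transpose_mul_mul (L : Matrix V V ℝ) (X : Matrix V (Fin r) ℝ) :
    (Xᵀ * L * X).trace = ∑ a, Xᵀ a ⬝ᵥ (L *ᵥ Xᵀ a) := by
  rw [trace]
  refine Finset.sum_congr rfl fun a _ => ?_
  rw [Matrix.mul_assoc]
  rfl

theorem IsSpectralSolution.mul_orthogonal {L : Matrix V V ℝ} {Y : Matrix V (Fin r) ℝ}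
    (hY : IsSpectralSolution L Y) {R : Matrix (Fin r) (Fin r) ℝ} (hR : Rᵀ * R = 1) :
    IsSpectralSolution L (Y * R) := by
  have hR' : R * Rᵀ = 1 := mul_eq_one_comm.1 hR
  refine ⟨⟨?_, ?_⟩, fun X hX => ?_⟩
  · rw [transpose_mul, Matrix.mul_assoc, ← Matrix.mul_assoc Yᵀ, hY.1.1, Matrix.one_mul, hR]
  · rw [transpose_mul, ← mulVec_mulVec, hY.1.2, mulVec_zero]
  · have : ((Y * R)ᵀ * L * (Y * R)).trace = (Yᵀ * L * Y).trace := by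
      rw [transpose_mul, show Rᵀ * Yᵀ * L * (Y * R) = Rᵀ * ((Yᵀ * L * Y) * R) by
        simp only [Matrix.mul_assoc], trace_mul_comm, Matrix.mul_assoc, hR', Matrix.mul_one]
    rw [this]
    exact hY.2 X hX

/-- The columns of R are orthonormal eigenvectors of the compression YᵀLY. -/
theorem IsSpectralSolution.exists_diagonalizing {L : Matrix V V ℝ} (hL : Lᵀ = L)
    {Y : Matrix V (Fin r) ℝ} : ∃ R : Matrix (Fin r) (Fin r) ℝ, Rᵀ * R = 1 ∧
      ∀ a b, a ≠ b → (Y * R)ᵀ a ⬝ᵥ (L *ᵥ (Y * R)ᵀ b) = 0 := by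
  have hS : (Yᵀ * L * Y).IsHermitian := by
    rw [IsHermitian, conjTranspose_eq_transpose_of_trivial, transpose_mul, transpose_mul,
      transpose_transpose, hL, Matrix.mul_assoc]
  have hortho := isOrthoRows_eigenvectorBasis hS
  set R : Matrix (Fin r) (Fin r) ℝ := Matrix.of fun b a => hS.eigenvectorBasis a b with hRdef
  refine ⟨R, ?_, fun a b hab => ?_⟩
  · ext a b
    rw [one_apply]
    exact hortho a b
  · have h1 : (Y * R)ᵀ a ⬝ᵥ (L *ᵥ (Y * R)ᵀ b) = ((Y * R)ᵀ * L * (Y * R)) a b := by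
      rw [Matrix.mul_assoc]; rfl
    have h2 : (Y * R)ᵀ * L * (Y * R) = Rᵀ * ((Yᵀ * L * Y) * R) := by
      rw [transpose_mul]; simp only [Matrix.mul_assoc]
    have h3 : (Rᵀ * ((Yᵀ * L * Y) * R)) a b =
        Rᵀ a ⬝ᵥ ((Yᵀ * L * Y) *ᵥ Rᵀ b) := rfl
    have h4 : (Yᵀ * L * Y) *ᵥ Rᵀ b = hS.eigenvalues b • Rᵀ b := hS.mulVec_eigenvectorBasis b
    have h5 : Rᵀ a ⬝ᵥ Rᵀ b = 0 := (hortho a b).trans (if_neg hab)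
    rw [h1, h2, h3, h4, dotProduct_smul, h5, smul_zero]

/-- Replacing column a by the normalised x keeps feasibility and changes only one term of the trace.
-/
theorem IsSpectralSolution.mul_le_of_orthogonal {L : Matrix V V ℝ} {W : Matrix V (Fin r) ℝ}
    (hW : IsSpectralSolution L W) (a : Fin r) {x : V → ℝ} (hx1 : x ⬝ᵥ (fun _ => 1) = 0)
    (hx : ∀ c, c ≠ a → x ⬝ᵥ Wᵀ c = 0) :
    (Wᵀ a ⬝ᵥ (L *ᵥ Wᵀ a)) * (x ⬝ᵥ x) ≤ x ⬝ᵥ (L *ᵥ x) := by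
  by_cases hx0 : x = 0
  · subst hx0; simp
  have hpos : 0 < x ⬝ᵥ x := by
    refine lt_of_le_of_ne (Finset.sum_nonneg fun v _ => mul_self_nonneg _) fun h => hx0 ?_
    exact dotProduct_self_eq_zero.1 h.symm
  set s : ℝ := (√(x ⬝ᵥ x))⁻¹ with hs
  have hs2 : s * s * (x ⬝ᵥ x) = 1 := by
    rw [hs, ← mul_inv, Real.mul_self_sqrt hpos.le, inv_mul_cancel₀ hpos.ne']
  obtain ⟨hW1, hW2⟩ := isSpectralFeasible_iff.1 hW.1
  set X := W.updateCol a (s • x) with hX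
  have hXa : Xᵀ a = s • x := by ext v; simp [hX]
  have hXc : ∀ c, c ≠ a → Xᵀ c = Wᵀ c := fun c hc => by ext v; simp [hX, updateCol_ne hc]
  have hfeas : IsSpectralFeasible X := by
    refine isSpectralFeasible_iff.2 ⟨fun b c => ?_, fun b => ?_⟩
    · by_cases hb : b = a
      · by_cases hc : c = a
        · rw [hb, hc, if_pos rfl, hXa, smul_dotProduct, dotProduct_smul, smul_eq_mul, smul_eq_mul,
            ← mul_assoc, hs2]
        · rw [hb, if_neg (Ne.symm hc), hXa, hXc c hc, smul_dotProduct, hx c hc, smul_zero]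
      · by_cases hc : c = a
        · rw [hc, if_neg hb, hXa, hXc b hb, dotProduct_comm, smul_dotProduct, hx b hb, smul_zero]
        · rw [hXc b hb, hXc c hc, hW1]
    · by_cases hb : b = a
      · rw [hb, hXa, smul_dotProduct, hx1, smul_zero]
      · rw [hXc b hb, hW2]
  have hsame : ∑ c ∈ Finset.univ.erase a, Xᵀ c ⬝ᵥ (L *ᵥ Xᵀ c) =
      ∑ c ∈ Finset.univ.erase a, Wᵀ c ⬝ᵥ (L *ᵥ Wᵀ c) :=
    Finset.sum_congr rfl fun c hc => by rw [hXc c (Finset.ne_of_mem_erase hc)]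
  have h := hW.2 X hfeas
  rw [trace_transpose_mul_mul, trace_transpose_mul_mul,
    ← Finset.add_sum_erase _ _ (Finset.mem_univ a),
    ← Finset.add_sum_erase Finset.univ (fun c => Xᵀ c ⬝ᵥ (L *ᵥ Xᵀ c)) (Finset.mem_univ a),
    hsame] at h
  have h1 : Wᵀ a ⬝ᵥ (L *ᵥ Wᵀ a) ≤ s * s * (x ⬝ᵥ (L *ᵥ x)) := by
    have := le_of_add_le_add_right h
    rwa [hXa, mulVec_smul, smul_dotProduct, dotProduct_smul, smul_eq_mul, smul_eq_mul,
      ← mul_assoc] at this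
  calc (Wᵀ a ⬝ᵥ (L *ᵥ Wᵀ a)) * (x ⬝ᵥ x) ≤ s * s * (x ⬝ᵥ (L *ᵥ x)) * (x ⬝ᵥ x) := by gcongr
    _ = (s * s * (x ⬝ᵥ x)) * (x ⬝ᵥ (L *ᵥ x)) := by ring
    _ = x ⬝ᵥ (L *ᵥ x) := by rw [hs2, one_mul]

theorem dotProduct_mulVec_comm {L : Matrix V V ℝ} (hL : Lᵀ = L) (x y : V → ℝ) :
    x ⬝ᵥ (L *ᵥ y) = y ⬝ᵥ (L *ᵥ x) := by
  rw [dotProduct_mulVec, ← mulVec_transpose, hL, dotProduct_comm]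

/-- First variation: the residual u = Lw - lw is orthogonal to w, to the all-ones vector and, by
diagonality, to the other columns. Hence w + su is admissible for every s, and minimality forces u =
0. -/
theorem IsSpectralSolution.mulVec_eq_smul {L : Matrix V V ℝ} (hL : Lᵀ = L)
    (hL1 : L *ᵥ (fun _ => 1) = 0) {W : Matrix V (Fin r) ℝ} (hW : IsSpectralSolution L W)
    (hdiag : ∀ a b, a ≠ b → Wᵀ a ⬝ᵥ (L *ᵥ Wᵀ b) = 0) (a : Fin r) :
    L *ᵥ Wᵀ a = (Wᵀ a ⬝ᵥ (L *ᵥ Wᵀ a)) • Wᵀ a := by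
  obtain ⟨hW1, hW2⟩ := isSpectralFeasible_iff.1 hW.1
  obtain ⟨w, hw⟩ : ∃ w, w = Wᵀ a := ⟨_, rfl⟩
  obtain ⟨l, hl⟩ : ∃ l, l = w ⬝ᵥ (L *ᵥ w) := ⟨_, rfl⟩
  obtain ⟨u, hu⟩ : ∃ u, u = L *ᵥ w - l • w := ⟨_, rfl⟩
  have hww : w ⬝ᵥ w = 1 := by rw [hw, hW1, if_pos rfl]
  have huw : u ⬝ᵥ w = 0 := by
    rw [hu, sub_dotProduct, smul_dotProduct, hww, dotProduct_comm, ← hl]; simp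
  have hu1 : u ⬝ᵥ (fun _ => 1) = 0 := by
    rw [hu, sub_dotProduct, smul_dotProduct, hw, hW2, dotProduct_comm, dotProduct_mulVec_comm hL,
      hL1]
    simp
  have huc : ∀ c, c ≠ a → u ⬝ᵥ Wᵀ c = 0 := by
    intro c hc
    rw [hu, sub_dotProduct, smul_dotProduct, hw, hW1, if_neg (Ne.symm hc), dotProduct_comm,
      hdiag c a hc]
    simp
  have huLw : u ⬝ᵥ (L *ᵥ w) = u ⬝ᵥ u := by
    have : L *ᵥ w = u + l • w := by rw [hu]; abel
    rw [this, dotProduct_add, dotProduct_smul, huw]; simp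
  have key : ∀ s : ℝ, 0 ≤ 2 * s * (u ⬝ᵥ u) + s ^ 2 * (u ⬝ᵥ (L *ᵥ u) - l * (u ⬝ᵥ u)) := by
    intro s
    have h := hW.mul_le_of_orthogonal a (x := w + s • u)
      (by rw [add_dotProduct, smul_dotProduct, hu1, hw, hW2]; simp)
      (fun c hc => by
        rw [add_dotProduct, smul_dotProduct, huc c hc, hw, hW1, if_neg (Ne.symm hc)]; simp)
    rw [← hw, ← hl] at h
    simp only [mulVec_add, mulVec_smul, add_dotProduct, dotProduct_add, smul_dotProduct,
      dotProduct_smul, smul_eq_mul] at h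
    rw [dotProduct_mulVec_comm hL w u, huLw, dotProduct_comm w u, huw, hww, ← hl] at h
    nlinarith
  have hU0 : 0 ≤ u ⬝ᵥ u := Finset.sum_nonneg fun v _ => mul_self_nonneg _
  have hU : u ⬝ᵥ u = 0 := by
    by_contra hne
    have hpos : 0 < u ⬝ᵥ u := lt_of_le_of_ne hU0 (Ne.symm hne)
    generalize u ⬝ᵥ u = U at *
    generalize u ⬝ᵥ (L *ᵥ u) - l * U = k at *
    have hk : 0 < |k| + 1 := by positivity
    -- For a small negative s the linear term 2sU dominates; this s makes the expression negative
    -- whatever the sign of k.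
    have h := key (-(U / (|k| + 1)))
    have h1 : 2 * -(U / (|k| + 1)) * U + (-(U / (|k| + 1))) ^ 2 * k =
        (U / (|k| + 1)) ^ 2 * (k - 2 * (|k| + 1)) := by
      field_simp
      ring
    rw [h1] at h
    have h2 : 0 < (U / (|k| + 1)) ^ 2 := by positivity
    nlinarith [le_abs_self k, abs_nonneg k]
  have hu0 : u = 0 := dotProduct_self_eq_zero.1 hU
  rw [← hw, ← hl]
  rw [hu] at hu0
  exact sub_eq_zero.1 hu0

/-- Among `r + 1` independent directions there is one along which the quadratic form is large. -/
theorem IsSpectralSolution.exists_combination {L : Matrix V V ℝ} {W : Matrix V (Fin r) ℝ}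
    (hW : IsSpectralSolution L W) (a : Fin r) (f : Fin (r + 1) → V → ℝ) :
    ∃ t : Fin (r + 1) → ℝ, t ≠ 0 ∧
      (Wᵀ a ⬝ᵥ (L *ᵥ Wᵀ a)) * ((∑ j, t j • f j) ⬝ᵥ ∑ j, t j • f j) ≤
        (∑ j, t j • f j) ⬝ᵥ (L *ᵥ ∑ j, t j • f j) := by
  -- There are r constraints: orthogonality to the r - 1 columns other than a, and to the all-ones
  -- vector, which occupies the free slot a.
  obtain ⟨t, ht0, ht⟩ := exists_ne_zero_sum_mul_eq_zero
    (fun c j => f j ⬝ᵥ if c = a then (fun _ => 1) else Wᵀ c)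
  have hsum : ∀ c, (∑ j, t j • f j) ⬝ᵥ (if c = a then (fun _ => 1) else Wᵀ c) = 0 := by
    intro c
    rw [sum_dotProduct, ← ht c]
    exact Finset.sum_congr rfl fun j _ => by rw [smul_dotProduct, smul_eq_mul, mul_comm]
  refine ⟨t, ht0, hW.mul_le_of_orthogonal a ?_ fun c hc => ?_⟩
  · simpa using hsum a
  · simpa [hc] using hsum c

end Spectral

/-! ### Test vectors supported on few nodes -/

section SpectralGraph

open Matrix

variable {V : Type*} [Fintype V] [DecidableEq V] {r : ℕ}

theorem graphLaplacian_transpose (g : SimpleGraph V) : (graphLaplacian g)ᵀ = graphLaplacian g := by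
  have := graphLaplacian_isHermitian g
  rwa [IsHermitian, conjTranspose_eq_transpose_of_trivial] at this

theorem graphLaplacian_mulVec_one (g : SimpleGraph V) :
    graphLaplacian g *ᵥ (fun _ => 1) = 0 := by
  ext v
  simp [graphLaplacian_mulVec_eq_sum]

theorem graphLaplacian_quadratic_nonneg (g : SimpleGraph V) (x : V → ℝ) :
    0 ≤ x ⬝ᵥ (graphLaplacian g *ᵥ x) := by
  have h1 : x ⬝ᵥ (graphLaplacian g *ᵥ x) = ∑ v, ∑ u, adjM g v u * (x v * (x v - x u)) := by
    refine Finset.sum_congr rfl fun v _ => ?_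
    rw [graphLaplacian_mulVec_eq_sum, Finset.mul_sum]
    exact Finset.sum_congr rfl fun u _ => by ring
  have h2 : x ⬝ᵥ (graphLaplacian g *ᵥ x) = ∑ v, ∑ u, adjM g v u * (x u * (x u - x v)) := by
    rw [h1, Finset.sum_comm]
    simp only [adjM_comm g]
  have h3 : x ⬝ᵥ (graphLaplacian g *ᵥ x) + x ⬝ᵥ (graphLaplacian g *ᵥ x) =
      ∑ v, ∑ u, adjM g v u * (x v - x u) ^ 2 := by
    nth_rw 1 [h1]
    rw [h2]
    simp only [← Finset.sum_add_distrib]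
    exact Finset.sum_congr rfl fun v _ => Finset.sum_congr rfl fun u _ => by ring
  have h4 : 0 ≤ ∑ v, ∑ u, adjM g v u * (x v - x u) ^ 2 :=
    Finset.sum_nonneg fun v _ => Finset.sum_nonneg fun u _ =>
      mul_nonneg (adjM_nonneg g v u) (sq_nonneg _)
  linarith

/-- On vectors supported on r + 1 nodes the quadratic form is a degree-weighted sum of squares plus
an adjacency term of at most r + 1 times the squared norm. If all these degrees were too small, the
admissible combination would violate the variational bound. -/
theorem IsSpectralSolution.exists_le_nodeDeg {g : SimpleGraph V} {W : Matrix V (Fin r) ℝ}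
    (hW : IsSpectralSolution (graphLaplacian g) W) (a : Fin r) {S : Finset V}
    (hS : r + 1 ≤ S.card) :
    ∃ v ∈ S, Wᵀ a ⬝ᵥ (graphLaplacian g *ᵥ Wᵀ a) ≤ nodeDeg g v + ((r : ℝ) + 1) := by
  by_contra! hcon
  obtain ⟨S', hS', hcard⟩ := Finset.exists_subset_card_eq hS
  let e : Fin (r + 1) ≃ S' := (S'.equivFinOfCardEq hcard).symm
  obtain ⟨t, ht0, ht⟩ := hW.exists_combination a fun j => Pi.single (e j : V) (1 : ℝ)
  generalize hΛ : Wᵀ a ⬝ᵥ (graphLaplacian g *ᵥ Wᵀ a) = Λ at *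
  have hval : ∀ y : V → ℝ, (∑ j, t j • (Pi.single (e j : V) (1 : ℝ) : V → ℝ)) ⬝ᵥ y =
      ∑ j, t j * y (e j) := by
    intro y
    rw [sum_dotProduct]
    exact Finset.sum_congr rfl fun j _ => by rw [smul_dotProduct, single_one_dotProduct, smul_eq_mul]
  have hx : ∀ k, (∑ j, t j • (Pi.single (e j : V) (1 : ℝ) : V → ℝ)) (e k : V) = t k := by
    intro k
    rw [Finset.sum_apply, Finset.sum_eq_single k]
    · simp
    · intro j _ hj
      have : (e k : V) ≠ e j := fun h => hj (e.injective (Subtype.ext h)).symm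
      simp [Pi.single_eq_of_ne this]
    · simp
  have hadj : ∀ v, (adjM g *ᵥ ∑ j, t j • (Pi.single (e j : V) (1 : ℝ) : V → ℝ)) v =
      ∑ j, t j * adjM g v (e j) := by
    intro v
    rw [mulVec, dotProduct_comm, hval]
  rw [hval, hval] at ht
  simp only [graphLaplacian_mulVec, hx, hadj] at ht
  have hAb : ∀ j, -(t j * ∑ k, t k * adjM g (e j) (e k)) ≤ ∑ k, (t j ^ 2 + t k ^ 2) / 2 := by
    intro j
    rw [Finset.mul_sum, ← Finset.sum_neg_distrib]
    refine Finset.sum_le_sum fun k _ => ?_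
    have h0 := adjM_nonneg g (e j) (e k)
    have h1 := adjM_le_one g (e j) (e k)
    have h2 : |t j * t k| ≤ (t j ^ 2 + t k ^ 2) / 2 := by
      rw [abs_le]; constructor <;> nlinarith [sq_nonneg (t j + t k), sq_nonneg (t j - t k)]
    have h3 : |t j * t k| * adjM g (e j) (e k) ≤ |t j * t k| :=
      mul_le_of_le_one_right (abs_nonneg _) h1
    nlinarith [neg_abs_le (t j * t k)]
  have hsumA : ∑ j, -(t j * ∑ k, t k * adjM g (e j) (e k)) ≤ ((r : ℝ) + 1) * ∑ j, t j ^ 2 := by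
    refine (Finset.sum_le_sum fun j _ => hAb j).trans (le_of_eq ?_)
    simp only [add_div, Finset.sum_add_distrib, Finset.sum_const, Finset.card_univ,
      Fintype.card_fin, nsmul_eq_mul, ← Finset.mul_sum, ← Finset.sum_div]
    push_cast
    ring
  have h1 : Λ * ∑ j, t j * t j ≤ ∑ j, (nodeDeg g (e j) + ((r : ℝ) + 1)) * t j ^ 2 := by
    refine ht.trans ?_
    have : ∑ j, t j * (nodeDeg g (e j) * t j - ∑ k, t k * adjM g (e j) (e k)) =
        ∑ j, nodeDeg g (e j) * t j ^ 2 + ∑ j, -(t j * ∑ k, t k * adjM g (e j) (e k)) := by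
      rw [← Finset.sum_add_distrib]
      exact Finset.sum_congr rfl fun j _ => by ring
    rw [this]
    simp only [add_mul _ _ (t _ ^ 2), Finset.sum_add_distrib]
    rw [add_mul, Finset.mul_sum, Finset.mul_sum] at hsumA
    linarith
  have h2 : ∑ j, (nodeDeg g (e j) + ((r : ℝ) + 1)) * t j ^ 2 < ∑ j, Λ * t j ^ 2 := by
    obtain ⟨k, hk⟩ := Function.ne_iff.1 ht0
    refine Finset.sum_lt_sum (fun j _ => ?_) ⟨k, Finset.mem_univ k, ?_⟩
    · exact mul_le_mul_of_nonneg_right (hcon _ (hS' (e j).2)).le (sq_nonneg _)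
    · exact mul_lt_mul_of_pos_right (hcon _ (hS' (e k).2)) (by
        have : t k ≠ 0 := hk
        positivity)
  rw [Finset.mul_sum] at h1
  simp only [← sq] at h1
  linarith

end SpectralGraph

/-! ### Locating the eigenvalues among the second to the K-th smallest -/

section LaplacianEigenvalue

open Matrix

variable {V : Type*} [Fintype V] [DecidableEq V] {r : ℕ}

theorem monotone_laplacianEigenvalue (g : SimpleGraph V) : Monotone (laplacianEigenvalue g) :=
  fun _ _ hab => (graphLaplacian_isHermitian g).eigenvalues₀_antitone (Fin.rev_le_rev.2 hab)

theorem exists_laplacian_eigenbasis (g : SimpleGraph V) :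
    ∃ φ : Fin (Fintype.card V) → V → ℝ, (∀ a b, φ a ⬝ᵥ φ b = if a = b then 1 else 0) ∧
      (∀ x y, ∑ a, (φ a ⬝ᵥ x) * (φ a ⬝ᵥ y) = x ⬝ᵥ y) ∧
      ∀ a, graphLaplacian g *ᵥ φ a = laplacianEigenvalue g a • φ a := by
  have hH := graphLaplacian_isHermitian g
  have hortho := isOrthoRows_eigenvectorBasis hH
  let e : Fin (Fintype.card V) ≃ V := Fintype.equivOfCardEq (Fintype.card_fin _)
  let idx : Fin (Fintype.card V) ≃ V := Fin.revPerm.trans e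
  refine ⟨fun a => ⇑(hH.eigenvectorBasis (idx a)), fun a b => ?_, fun x y => ?_, fun a => ?_⟩
  · refine (hortho (idx a) (idx b)).trans ?_
    simp only [idx.injective.eq_iff]
  · refine Eq.trans ?_ (hortho.parseval x y)
    exact idx.sum_comp fun v => (∑ u, hH.eigenvectorBasis v u * x u) *
      ∑ u, hH.eigenvectorBasis v u * y u
  · have h := hH.mulVec_eigenvectorBasis (idx a)
    have h2 : hH.eigenvalues (idx a) = laplacianEigenvalue g a := by
      rw [IsHermitian.eigenvalues, laplacianEigenvalue]
      congr 1
      exact e.symm_apply_apply _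
    rw [← h2]
    exact h

theorem laplacian_eigenvalue_nonneg {g : SimpleGraph V} {w : V → ℝ} {Λ : ℝ} (hw : w ⬝ᵥ w = 1)
    (hΛ : graphLaplacian g *ᵥ w = Λ • w) : 0 ≤ Λ := by
  have := graphLaplacian_quadratic_nonneg g w
  rwa [hΛ, dotProduct_smul, hw, smul_eq_mul, mul_one] at this

/-- If w meets a basis vector of positive index, Λ is the eigenvalue there, and an index beyond r is
brought back to r by the upper bound. The graph may be disconnected, so the basis vector of index 0
need not be constant and w may be a multiple of it. Then the all-ones vector meets another basis
vector, so 0 also occurs at a positive index and Λ equals the eigenvalue of index 1. -/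
theorem exists_laplacianEigenvalue_eq {g : SimpleGraph V} {w : V → ℝ} {Λ : ℝ} (hr : 1 ≤ r)
    (hcard : r < Fintype.card V) (hw : w ⬝ᵥ w = 1) (hw1 : w ⬝ᵥ (fun _ => 1) = 0)
    (hΛ : graphLaplacian g *ᵥ w = Λ • w) (hle : Λ ≤ laplacianEigenvalue g ⟨r, hcard⟩) :
    ∃ j : Fin (Fintype.card V), 1 ≤ (j : ℕ) ∧ (j : ℕ) ≤ r ∧ laplacianEigenvalue g j = Λ := by
  obtain ⟨φ, hφ, hpars, heig⟩ := exists_laplacian_eigenbasis g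
  have hL := graphLaplacian_transpose g
  have hmono := monotone_laplacianEigenvalue g
  have heq : ∀ (x : V → ℝ) (l : ℝ), graphLaplacian g *ᵥ x = l • x → ∀ a, φ a ⬝ᵥ x ≠ 0 →
      laplacianEigenvalue g a = l := by
    intro x l hx a ha
    have h := dotProduct_mulVec_comm hL (φ a) x
    rw [hx, heig, dotProduct_smul, dotProduct_smul, dotProduct_comm x, smul_eq_mul,
      smul_eq_mul] at h
    exact (mul_right_cancel₀ ha h).symm
  by_cases hex : ∃ a : Fin (Fintype.card V), 1 ≤ (a : ℕ) ∧ φ a ⬝ᵥ w ≠ 0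
  · obtain ⟨a, ha1, ha⟩ := hex
    have hla := heq w Λ hΛ a ha
    by_cases har : (a : ℕ) ≤ r
    · exact ⟨a, ha1, har, hla⟩
    · refine ⟨⟨r, hcard⟩, hr, le_rfl, le_antisymm ?_ hle⟩
      rw [← hla]
      exact hmono (Fin.mk_le_of_le_val (by omega))
  · push Not at hex
    let a0 : Fin (Fintype.card V) := ⟨0, by omega⟩
    have hother : ∀ a, a ≠ a0 → φ a ⬝ᵥ w = 0 := fun a ha =>
      hex a (Nat.one_le_iff_ne_zero.2 fun h => ha (Fin.ext h))
    have hsingle : ∀ y, (φ a0 ⬝ᵥ w) * (φ a0 ⬝ᵥ y) = w ⬝ᵥ y := by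
      intro y
      rw [← hpars w y, Finset.sum_eq_single a0]
      · intro a _ ha; rw [hother a ha, zero_mul]
      · simp
    have hne : φ a0 ⬝ᵥ w ≠ 0 := by
      intro h
      have := hsingle w
      rw [h, hw] at this
      simp at this
    have hone : φ a0 ⬝ᵥ (fun _ => 1) = 0 := by
      have := hsingle fun _ => 1
      rw [hw1] at this
      exact (mul_eq_zero.1 this).resolve_left hne
    have hex2 : ∃ a, φ a ⬝ᵥ (fun _ => (1 : ℝ)) ≠ 0 := by
      by_contra! hcon
      have h := hpars (fun _ => 1) (fun _ => 1)
      rw [Finset.sum_eq_zero fun a _ => by rw [hcon a, mul_zero]] at h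
      simp only [dotProduct, mul_one, Finset.sum_const, Finset.card_univ, nsmul_eq_mul] at h
      have h0 : (Fintype.card V : ℝ) ≠ 0 := Nat.cast_ne_zero.2 (by omega)
      exact h0 h.symm
    obtain ⟨a, ha⟩ := hex2
    have hla := heq (fun _ => 1) 0 (by rw [graphLaplacian_mulVec_one, zero_smul]) a ha
    have haa : a ≠ a0 := fun h => ha (h ▸ hone)
    have ha1 : 1 ≤ (a : ℕ) := Nat.one_le_iff_ne_zero.2 fun h => haa (Fin.ext h)
    have hl0 := heq w Λ hΛ a0 hne
    refine ⟨⟨1, by omega⟩, le_rfl, hr, le_antisymm ?_ ?_⟩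
    · calc laplacianEigenvalue g ⟨1, by omega⟩ ≤ laplacianEigenvalue g a :=
            hmono (Fin.mk_le_of_le_val ha1)
        _ = 0 := hla
        _ ≤ Λ := laplacian_eigenvalue_nonneg hw hΛ
    · rw [← hl0]
      exact hmono (Fin.mk_le_of_le_val (Nat.zero_le _))

/-- The first r + 1 eigenvectors span a space on which the form is at most the eigenvalue of index r
times the squared norm; some nonzero vector of it is admissible for column a. -/
theorem IsSpectralSolution.le_laplacianEigenvalue {g : SimpleGraph V} {W : Matrix V (Fin r) ℝ}
    (hW : IsSpectralSolution (graphLaplacian g) W) (a : Fin r) (hcard : r < Fintype.card V) :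
    Wᵀ a ⬝ᵥ (graphLaplacian g *ᵥ Wᵀ a) ≤ laplacianEigenvalue g ⟨r, hcard⟩ := by
  obtain ⟨φ, hφ, -, heig⟩ := exists_laplacian_eigenbasis g
  have hmono := monotone_laplacianEigenvalue g
  let k : Fin (r + 1) → Fin (Fintype.card V) := Fin.castLE hcard
  have hk : Function.Injective k := Fin.castLE_injective hcard
  obtain ⟨t, ht0, ht⟩ := hW.exists_combination a fun j => φ (k j)
  generalize Wᵀ a ⬝ᵥ (graphLaplacian g *ᵥ Wᵀ a) = Λ at *
  have hval : ∀ s : Fin (r + 1) → ℝ, (∑ j, t j • φ (k j)) ⬝ᵥ (∑ j, s j • φ (k j)) =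
      ∑ j, t j * s j := by
    intro s
    rw [sum_dotProduct]
    refine Finset.sum_congr rfl fun j _ => ?_
    rw [smul_dotProduct, dotProduct_sum, Finset.sum_eq_single j]
    · rw [dotProduct_smul, hφ, if_pos rfl]; simp
    · intro b _ hb
      rw [dotProduct_smul, hφ, if_neg (fun h => hb (hk h).symm), smul_zero]
    · simp
  have hLx : graphLaplacian g *ᵥ (∑ j, t j • φ (k j)) =
      ∑ j, (t j * laplacianEigenvalue g (k j)) • φ (k j) := by
    rw [mulVec_sum]
    exact Finset.sum_congr rfl fun j _ => by rw [mulVec_smul, heig, smul_smul]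
  rw [hLx, hval, hval] at ht
  obtain ⟨b, hb⟩ := Function.ne_iff.1 ht0
  have hpos : 0 < ∑ j, t j * t j :=
    Finset.sum_pos' (fun j _ => mul_self_nonneg _) ⟨b, Finset.mem_univ b, mul_self_pos.2 hb⟩
  refine le_of_mul_le_mul_right (ht.trans ?_) hpos
  rw [Finset.mul_sum]
  refine Finset.sum_le_sum fun j _ => ?_
  have : laplacianEigenvalue g (k j) ≤ laplacianEigenvalue g ⟨r, hcard⟩ :=
    hmono (Fin.mk_le_mk.2 (Nat.lt_succ_iff.1 j.2))
  nlinarith [mul_self_nonneg (t j)]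

/-- A solution of the spectral clustering problem is a rotation of a matrix of eigenvectors. -/
theorem IsSpectralSolution.exists_eigenvectors {g : SimpleGraph V} {Y : Matrix V (Fin r) ℝ}
    (hY : IsSpectralSolution (graphLaplacian g) Y) (hr : 1 ≤ r) (hcard : r < Fintype.card V) :
    ∃ (W : Matrix V (Fin r) ℝ) (R : Matrix (Fin r) (Fin r) ℝ) (Λ : Fin r → ℝ), Y = W * R ∧
      (∀ a b, |R a b| ≤ 1) ∧ ∀ a, ∑ v, Wᵀ a v ^ 2 = 1 ∧ ∑ v, Wᵀ a v = 0 ∧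
        graphLaplacian g *ᵥ Wᵀ a = Λ a • Wᵀ a ∧ 0 ≤ Λ a ∧
        (∃ j : Fin (Fintype.card V), 1 ≤ (j : ℕ) ∧ (j : ℕ) ≤ r ∧ laplacianEigenvalue g j = Λ a) ∧
        ∀ S : Finset V, r + 1 ≤ S.card → ∃ v ∈ S, Λ a ≤ nodeDeg g v + ((r : ℝ) + 1) := by
  have hL := graphLaplacian_transpose g
  obtain ⟨R, hR, hdiag⟩ := IsSpectralSolution.exists_diagonalizing hL (Y := Y)
  have hR' : R * Rᵀ = 1 := mul_eq_one_comm.1 hR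
  have hW := hY.mul_orthogonal hR
  have hYW : Y = (Y * R) * Rᵀ := by rw [Matrix.mul_assoc, hR', Matrix.mul_one]
  generalize Y * R = W at *
  obtain ⟨hW1, hW2⟩ := isSpectralFeasible_iff.1 hW.1
  refine ⟨W, Rᵀ, fun a => Wᵀ a ⬝ᵥ (graphLaplacian g *ᵥ Wᵀ a), hYW, fun a b => ?_, fun a => ?_⟩
  · have h := congrFun (congrFun hR a) a
    rw [one_apply_eq, mul_apply] at h
    rw [← sq_le_one_iff_abs_le_one, ← h]
    refine le_trans (le_of_eq ?_) (Finset.single_le_sum (f := fun c => Rᵀ a c * R c a)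
      (fun c _ => mul_self_nonneg _) (Finset.mem_univ b))
    simp [sq]
  · have hnorm : Wᵀ a ⬝ᵥ Wᵀ a = 1 := by rw [hW1, if_pos rfl]
    have hone : Wᵀ a ⬝ᵥ (fun _ => 1) = 0 := hW2 a
    have heig := hW.mulVec_eq_smul hL (graphLaplacian_mulVec_one g) hdiag a
    refine ⟨?_, ?_, heig, laplacian_eigenvalue_nonneg hnorm heig,
      exists_laplacianEigenvalue_eq hr hcard hnorm hone heig (hW.le_laplacianEigenvalue a hcard),
      fun S hS => hW.exists_le_nodeDeg a hS⟩
    · simpa [dotProduct, sq] using hnorm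
    · simpa [dotProduct] using hone

end LaplacianEigenvalue

/-! ### Failure of K-means when cluster sums are small -/

section KMeans

variable {r : ℕ} {n : Fin (r + 1) → ℕ}

theorem sum_sq_sub_le_sum_sub_sq {ι : Type*} [Fintype ι] [Nonempty ι] (y : ι → ℝ) (c : ℝ) :
    ∑ x, y x ^ 2 - (∑ x, y x) ^ 2 / Fintype.card ι ≤ ∑ x, (y x - c) ^ 2 := by
  have hn : (0 : ℝ) < Fintype.card ι := Nat.cast_pos.2 Fintype.card_pos
  have h1 : ∑ x, (y x - c) ^ 2 = ∑ x, y x ^ 2 - 2 * c * ∑ x, y x + Fintype.card ι * c ^ 2 := by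
    simp only [sub_sq, Finset.sum_add_distrib, Finset.sum_sub_distrib, Finset.sum_const,
      Finset.card_univ, nsmul_eq_mul, Finset.mul_sum]
    congr 2
    exact Finset.sum_congr rfl fun x _ => by ring
  have h2 : (Fintype.card ι * c ^ 2 - 2 * c * ∑ x, y x + (∑ x, y x) ^ 2 / Fintype.card ι) =
      (Fintype.card ι * c - ∑ x, y x) ^ 2 / Fintype.card ι := by
    field_simp
    ring
  have h3 : 0 ≤ (Fintype.card ι * c - ∑ x, y x) ^ 2 / Fintype.card ι := by positivity
  linarith

/-- If the cluster sums are small, isolating a single row is cheaper than the true clusters. -/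
theorem not_recoversClusters_of_sum_small (hr : 1 ≤ r) (hn : ∀ k, 0 < n k)
    {Y : Matrix (ClusterNode n) (Fin r) ℝ} (hY : ∀ j, ∑ v, Y v j ^ 2 = 1)
    (hz : ∑ k, ∑ j, clusterSum (fun v => Y v j) k ^ 2 / n k < r / totalSize n)
    {s : ClusterNode n → Fin (r + 1)} (hs : IsKMeansSolution Y s) : ¬ RecoversClusters s := by
  rintro ⟨π, hπ⟩
  obtain ⟨c, hc⟩ := hs
  have htot : ∑ v, ∑ j, Y v j ^ 2 = r := by
    rw [Finset.sum_comm]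
    simp [hY]
  have hlower : (r : ℝ) - ∑ k, ∑ j, clusterSum (fun v => Y v j) k ^ 2 / n k ≤
      kMeansCost Y s c := by
    rw [kMeansCost, ← htot, Fintype.sum_sigma, Fintype.sum_sigma, ← Finset.sum_sub_distrib]
    refine Finset.sum_le_sum fun k _ => ?_
    rw [Finset.sum_comm, Finset.sum_comm (t := (Finset.univ : Finset (Fin r))),
      ← Finset.sum_sub_distrib]
    refine Finset.sum_le_sum fun j _ => ?_
    have : Nonempty (Fin (n k)) := Fin.pos_iff_nonempty.1 (hn k)
    have h := sum_sq_sub_le_sum_sub_sq (fun x : Fin (n k) => Y ⟨k, x⟩ j) (c (π k) j)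
    rw [Fintype.card_fin] at h
    simp only [hπ]
    exact h
  have hN : (0 : ℝ) < totalSize n := Nat.cast_pos.2 ((hn 0).trans_le (le_totalSize 0))
  -- The squared row norms sum to r, so some row reaches the average r/N.
  obtain ⟨v0, hv0⟩ : ∃ v0, (r : ℝ) / totalSize n ≤ ∑ j, Y v0 j ^ 2 := by
    by_contra! hcon
    have : Nonempty (ClusterNode n) := ⟨⟨0, ⟨0, hn 0⟩⟩⟩
    have h := Finset.sum_lt_sum_of_nonempty Finset.univ_nonempty fun v _ => hcon v
    rw [htot, Finset.sum_const, Finset.card_univ, card_clusterNode, nsmul_eq_mul,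
      mul_div_cancel₀ _ hN.ne'] at h
    exact lt_irrefl _ h
  -- The competitor puts `v0` alone with itself as centre and all other rows around the origin. The
  -- labels 0 and r differ because r ≥ 1.
  have hupper : kMeansCost Y (fun v => if v = v0 then Fin.last r else 0)
      (fun k => if k = 0 then 0 else Y v0) = r - ∑ j, Y v0 j ^ 2 := by
    have hlast : Fin.last r ≠ 0 := fun h => by
      have := congrArg Fin.val h
      simp at this
      omega
    rw [kMeansCost, ← htot, ← Finset.add_sum_erase _ _ (Finset.mem_univ v0),
      ← Finset.add_sum_erase Finset.univ (fun v => ∑ j, Y v j ^ 2) (Finset.mem_univ v0)]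
    simp only [if_true, hlast, if_false, sub_self, ne_eq, OfNat.ofNat_ne_zero, not_false_eq_true,
      zero_pow, Finset.sum_const_zero, zero_add, add_sub_cancel_left]
    refine Finset.sum_congr rfl fun v hv => ?_
    simp [Finset.ne_of_mem_erase hv]
  have := hc _ _ |>.trans_eq hupper
  linarith

end KMeans

/-! ### Exceptional events occur only finitely often -/

section AlmostSure

variable {Ω : Type*} [mΩ : MeasurableSpace Ω] {P : Measure Ω} [IsProbabilityMeasure P] {r : ℕ}
  {p : Fin (r + 1) → Fin (r + 1) → ℝ} {n : ℕ → Fin (r + 1) → ℕ}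
  {G : (m : ℕ) → Ω → SimpleGraph (ClusterNode (n m))}

/-- Absorbs the polynomial number of degree thresholds or shifts into an arbitrarily small
exponential rate. -/
theorem mul_add_le_mul_exp {a b δ N : ℝ} (ha : 0 ≤ a) (hb : 0 ≤ b) (hδ : 0 < δ) (hN : 0 ≤ N) :
    a * N + b ≤ (a / δ + b) * Real.exp (δ * N) := by
  have h1 := Real.add_one_le_exp (δ * N)
  have h2 : (1 : ℝ) ≤ Real.exp (δ * N) := Real.one_le_exp (by positivity)
  have h3 : a * N ≤ a / δ * Real.exp (δ * N) := by
    calc a * N = a / δ * (δ * N) := by field_simp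
      _ ≤ a / δ * Real.exp (δ * N) := by gcongr; linarith
  nlinarith

theorem ae_eventually_crossBound (hn : Function.Injective n) (hG : ∀ m, IsRIM P (n m) p (G m))
    (hp : ∀ i j, i ≠ j → p i j ∈ Set.Icc (0 : ℝ) 1 ∧ p i j = p j i) :
    ∀ᵐ ω ∂P, ∀ᶠ m in atTop, CrossBound p (G m ω) :=
  ae_eventually_of_measureReal_le_exp hn (fun m ω => CrossBound p (G m ω)) two_pos
    (Eventually.of_forall fun m => (hG m).measureReal_not_crossBound_le hp)

theorem ae_eventually_exists_low_outDev (hn : Function.Injective n)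
    (hG : ∀ m, IsRIM P (n m) p (G m))
    (hp : ∀ i j, i ≠ j → p i j ∈ Set.Icc (0 : ℝ) 1 ∧ p i j = p j i)
    (hN : Tendsto (fun m => (totalSize (n m) : ℝ)) atTop atTop) {i j : Fin (r + 1)} (hij : i ≠ j)
    (h0 : p i j ≠ 0) (h1 : p i j ≠ 1) {κ : ℝ} (hκ : 0 < κ)
    (hj : ∀ᶠ m in atTop, κ * totalSize (n m) ≤ n m j) {C τ : ℝ} (hC : 0 ≤ C) (hτ : 0 < τ) :
    ∀ᵐ ω ∂P, ∀ᶠ m in atTop, ∀ t : ℕ, τ * totalSize (n m) ≤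
        (Finset.univ.filter fun x => nodeDeg (innerGraph (G m ω) i) x < t).card →
      r + 1 ≤ ((Finset.univ.filter fun x => nodeDeg (innerGraph (G m ω) i) x < t).filter
        fun x => outDev p (G m ω) i x ≤ -(C * √(totalSize (n m)))).card := by
  obtain ⟨q, hq, N₀, hqN⟩ := exists_le_measureReal_outDev_le P hp hij h0 h1 hκ hC
  refine ae_eventually_of_measureReal_le_exp hn
    (fun m ω => ∀ t : ℕ, τ * totalSize (n m) ≤
        (Finset.univ.filter fun x => nodeDeg (innerGraph (G m ω) i) x < t).card →
      r + 1 ≤ ((Finset.univ.filter fun x => nodeDeg (innerGraph (G m ω) i) x < t).filter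
        fun x => outDev p (G m ω) i x ≤ -(C * √(totalSize (n m)))).card)
    (C := 1 / (q ^ 2 * τ / 4) + 2) (c := q ^ 2 * τ / 4) (by positivity) ?_
  filter_upwards [hj, hN.eventually_ge_atTop N₀, hN.eventually_ge_atTop 1,
    hN.eventually_ge_atTop (2 * (r + 1) / (q * τ))] with m hm hmN hm1 hmr
  have hs : 0 < τ * totalSize (n m) := by positivity
  have hK : ((r + 1 : ℕ) : ℝ) ≤ q * (τ * totalSize (n m)) / 2 := by
    rw [div_le_iff₀ (by positivity)] at hmr
    push_cast
    linarith
  have key := (hG m).measureReal_exists_card_lt_le i hq (hqN (n m) (G m) (hG m) hmN hm)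
    (Finset.range (n m i + 2)) (fun h t => Finset.univ.filter fun x => nodeDeg h x < t) hs hK
  refine (measureReal_mono (fun ω hω => ?_) (measure_ne_top _ _)).trans (key.trans ?_)
  · simp only [Set.mem_ofPred_eq, not_forall, not_le, exists_prop] at hω ⊢
    obtain ⟨t, ht1, ht2⟩ := hω
    by_cases ht : t < n m i + 2
    · exact ⟨t, Finset.mem_range.2 ht, ht1, ht2⟩
    -- Inner degrees are at most n_i, so every threshold above n_i selects all nodes and n_i + 1
    -- represents them; the union bound has only n_i + 2 terms.
    · have heq : (Finset.univ.filter fun x => nodeDeg (innerGraph (G m ω) i) x < t) =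
          Finset.univ.filter fun x => nodeDeg (innerGraph (G m ω) i) x < n m i + 1 := by
        refine Finset.filter_congr fun x _ => ?_
        have := nodeDeg_le (innerGraph (G m ω) i) x
        rw [Fintype.card_fin] at this
        omega
      rw [heq] at ht1 ht2
      exact ⟨n m i + 1, Finset.mem_range.2 (by omega), ht1, ht2⟩
  · rw [Finset.card_range]
    have hle : (n m i : ℝ) ≤ totalSize (n m) := by exact_mod_cast le_totalSize i
    have h2 := mul_add_le_mul_exp (a := 1) (b := 2) (δ := q ^ 2 * τ / 4)
      (N := (totalSize (n m) : ℝ)) zero_le_one zero_le_two (by positivity) (by positivity)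
    push_cast
    calc ((n m i : ℝ) + 2) * Real.exp (-(q ^ 2 * (τ * totalSize (n m)) / 2))
        ≤ ((1 / (q ^ 2 * τ / 4) + 2) * Real.exp (q ^ 2 * τ / 4 * totalSize (n m))) *
          Real.exp (-(q ^ 2 * (τ * totalSize (n m)) / 2)) := by
          gcongr
          linarith
      _ = (1 / (q ^ 2 * τ / 4) + 2) * Real.exp (-(q ^ 2 * τ / 4 * totalSize (n m))) := by
          rw [mul_assoc, ← Real.exp_add]
          congr 2
          ring

/-- Give each set the weight exp(-x|Γᶜ|): the total weight is (1 + exp(-x))^k, and each set counted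
has weight at least exp(-xt). -/
theorem card_filter_card_compl_le {k : ℕ} {t x : ℝ} (hx : 0 ≤ x) :
    (((Finset.univ : Finset (Finset (Fin k))).filter fun Γ => (Γᶜ.card : ℝ) ≤ t).card : ℝ) ≤
      Real.exp (x * t + Real.exp (-x) * k) := by
  classical
  have hsum := Finset.sum_pow_mul_eq_add_pow (1 : ℝ) (Real.exp (-x)) (Finset.univ : Finset (Fin k))
  simp only [one_pow, one_mul, Finset.powerset_univ, Finset.card_univ, Fintype.card_fin] at hsum
  have h1 : (((Finset.univ : Finset (Finset (Fin k))).filter fun Γ =>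
      (Γᶜ.card : ℝ) ≤ t).card : ℝ) * Real.exp (-(x * t)) ≤ (1 + Real.exp (-x)) ^ k := by
    rw [← hsum, ← nsmul_eq_mul, ← Finset.sum_const]
    refine (Finset.sum_le_sum fun Γ hΓ => ?_).trans
      (Finset.sum_le_sum_of_subset_of_nonneg (Finset.subset_univ _) fun Γ _ _ => by positivity)
    have hc : Γᶜ.card = k - Γ.card := by rw [Finset.card_compl, Fintype.card_fin]
    rw [← hc, ← Real.exp_nat_mul, Real.exp_le_exp]
    have := (Finset.mem_filter.1 hΓ).2
    nlinarith
  have h2 : (1 + Real.exp (-x)) ^ k ≤ Real.exp (Real.exp (-x) * k) := by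
    rw [mul_comm, Real.exp_nat_mul]
    have := Real.add_one_le_exp (Real.exp (-x))
    gcongr
    linarith
  calc _ = (((Finset.univ : Finset (Finset (Fin k))).filter fun Γ =>
        (Γᶜ.card : ℝ) ≤ t).card : ℝ) * Real.exp (-(x * t)) * Real.exp (x * t) := by
        rw [mul_assoc, ← Real.exp_add]; simp
    _ ≤ Real.exp (Real.exp (-x) * k) * Real.exp (x * t) := by
        gcongr; exact h1.trans h2
    _ = _ := by rw [← Real.exp_add, add_comm]

/-- The entropy of discarded sets, shifts and nets is made smaller than the Hoeffding exponent η²N/2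
by taking τ small against η⁴. -/
theorem ae_eventually_projection_le (hn : Function.Injective n)
    (hG : ∀ m, IsRIM P (n m) p (G m))
    (hp : ∀ i j, i ≠ j → p i j ∈ Set.Icc (0 : ℝ) 1 ∧ p i j = p j i)
    (hN : Tendsto (fun m => (totalSize (n m) : ℝ)) atTop atTop) {i j : Fin (r + 1)} (hij : i ≠ j)
    {c τ η : ℝ} (hη : 0 < η) (hη1 : η ≤ 1) (hτη : τ ≤ η ^ 4 / 1024) :
    ∀ᵐ ω ∂P, ∀ᶠ m in atTop, ∀ (Γ : Finset (Fin (n m i))) (θ : ℤ),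
      (Γᶜ.card : ℝ) ≤ τ * totalSize (n m) → |(θ : ℝ)| ≤ 3 * totalSize (n m) →
      ((nearKernelIndex (shiftedRows (innerGraph (G m ω) i) Γ θ)
        (c * √(totalSize (n m)))).card : ℝ) ≤ 3 * τ * totalSize (n m) →
      √(∑ a ∈ nearKernelIndex (shiftedRows (innerGraph (G m ω) i) Γ θ) (c * √(totalSize (n m))),
        (∑ v, nearKernelBasis (shiftedRows (innerGraph (G m ω) i) Γ θ)
          (c * √(totalSize (n m))) a v * clusterDev p (G m ω) i j v) ^ 2) ≤
        η * totalSize (n m) := by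
  refine ae_eventually_of_measureReal_le_exp hn (fun m ω => ∀ (Γ : Finset (Fin (n m i))) (θ : ℤ),
      (Γᶜ.card : ℝ) ≤ τ * totalSize (n m) → |(θ : ℝ)| ≤ 3 * totalSize (n m) →
      ((nearKernelIndex (shiftedRows (innerGraph (G m ω) i) Γ θ)
        (c * √(totalSize (n m)))).card : ℝ) ≤ 3 * τ * totalSize (n m) →
      √(∑ a ∈ nearKernelIndex (shiftedRows (innerGraph (G m ω) i) Γ θ) (c * √(totalSize (n m))),
        (∑ v, nearKernelBasis (shiftedRows (innerGraph (G m ω) i) Γ θ)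
          (c * √(totalSize (n m))) a v * clusterDev p (G m ω) i j v) ^ 2) ≤ η * totalSize (n m))
    (C := 6 / (η ^ 2 / 8) + 1) (c := η ^ 2 / 4) (by positivity) ?_
  filter_upwards [hN.eventually_gt_atTop 0] with m hm
  let T : Finset (Finset (Fin (n m i)) × ℤ) :=
    (Finset.univ.filter fun Γ => (Γᶜ.card : ℝ) ≤ τ * totalSize (n m)) ×ˢ
      Finset.Icc (-(3 * totalSize (n m) : ℤ)) (3 * totalSize (n m))
  have key := (hG m).measureReal_projection_gt_le hp hij hm T
    (fun h d => nearKernelIndex (shiftedRows h d.1 d.2) (c * √(totalSize (n m))))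
    (fun h d => nearKernelBasis (shiftedRows h d.1 d.2) (c * √(totalSize (n m))))
    (fun h d => isOrthoRows_nearKernelBasis _ _) (k := 3 * τ * totalSize (n m)) hη.le
  refine (measureReal_mono (fun ω hω => ?_) (measure_ne_top _ _)).trans (key.trans ?_)
  · simp only [Set.mem_ofPred_eq, not_forall, not_le, exists_prop] at hω ⊢
    obtain ⟨Γ, θ, hΓ, hθ, hcard, hgt⟩ := hω
    refine ⟨(Γ, θ), Finset.mem_product.2 ⟨Finset.mem_filter.2 ⟨Finset.mem_univ _, hΓ⟩,
      Finset.mem_Icc.2 ?_⟩, hcard, hgt⟩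
    rw [abs_le] at hθ
    exact ⟨by exact_mod_cast hθ.1, by exact_mod_cast hθ.2⟩
  · have hcardT : (T.card : ℝ) = ((Finset.univ.filter fun Γ : Finset (Fin (n m i)) =>
        (Γᶜ.card : ℝ) ≤ τ * totalSize (n m)).card : ℝ) * (6 * totalSize (n m) + 1) := by
      have h6 : (3 * (totalSize (n m) : ℤ) + 1 - -(3 * (totalSize (n m) : ℤ))).toNat =
          6 * totalSize (n m) + 1 := by omega
      rw [Finset.card_product, Int.card_Icc, h6]
      push_cast
      rfl
    have hle : (n m i : ℝ) ≤ totalSize (n m) := by exact_mod_cast le_totalSize i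
    -- With x = 32/η² the sets cost η²N/16. The shifts cost η²N/8 and the nets 18τN ≤ η²N/16, so a
    -- decay rate of η²/4 survives.
    have hx : 0 ≤ 32 / η ^ 2 := by positivity
    have hcount := card_filter_card_compl_le (k := n m i) (t := τ * totalSize (n m)) hx
    have hexp : Real.exp (-(32 / η ^ 2)) ≤ η ^ 2 / 32 := by
      rw [Real.exp_neg, inv_le_comm₀ (Real.exp_pos _) (by positivity), inv_div]
      linarith [Real.add_one_le_exp (32 / η ^ 2)]
    have hpoly := mul_add_le_mul_exp (a := 6) (b := 1) (δ := η ^ 2 / 8)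
      (N := (totalSize (n m) : ℝ)) (by norm_num) zero_le_one (by positivity) hm.le
    rw [hcardT]
    generalize (totalSize (n m) : ℝ) = N at *
    have hexp2 : 32 / η ^ 2 * (τ * N) + Real.exp (-(32 / η ^ 2)) * (n m i) ≤ η ^ 2 / 16 * N := by
      have h1 : 32 / η ^ 2 * (τ * N) ≤ η ^ 2 / 32 * N := by
        calc 32 / η ^ 2 * (τ * N) ≤ 32 / η ^ 2 * (η ^ 4 / 1024 * N) := by gcongr
          _ = η ^ 2 / 32 * N := by field_simp; ring
      have h2 : Real.exp (-(32 / η ^ 2)) * (n m i) ≤ η ^ 2 / 32 * N := by gcongr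
      linarith
    have hexp3 : 6 * (3 * τ * N) ≤ η ^ 2 / 16 * N := by
      have h4 : η ^ 4 ≤ η ^ 2 := pow_le_pow_of_le_one hη.le hη1 (by norm_num)
      have : 18 * τ ≤ η ^ 2 / 16 := by nlinarith
      nlinarith
    calc _ ≤ (Real.exp (η ^ 2 / 16 * N) * ((6 / (η ^ 2 / 8) + 1) * Real.exp (η ^ 2 / 8 * N))) *
          (Real.exp (η ^ 2 / 16 * N) * Real.exp (-(η ^ 2 * N / 2))) := by
          gcongr
          exact hcount.trans (Real.exp_le_exp.2 hexp2)
      _ = (6 / (η ^ 2 / 8) + 1) * Real.exp (η ^ 2 / 16 * N + η ^ 2 / 8 * N + η ^ 2 / 16 * N +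
          -(η ^ 2 * N / 2)) := by
          rw [Real.exp_add, Real.exp_add, Real.exp_add]; ring
      _ = (6 / (η ^ 2 / 8) + 1) * Real.exp (-(η ^ 2 / 4 * N)) := by
          congr 2; ring

/-- Anti-concentration fails for such pairs, but their edges are almost surely deterministic and
equal to their means. -/
theorem ae_clusterDev_eq_zero (hG : ∀ m, IsRIM P (n m) p (G m)) {i j : Fin (r + 1)} (hij : i ≠ j)
    (hpij : p i j = 0 ∨ p i j = 1) : ∀ᵐ ω ∂P, ∀ m x, clusterDev p (G m ω) i j x = 0 := by
  refine ae_all_iff.2 fun m => ae_all_iff.2 fun x => ?_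
  have h : ∀ᵐ ω ∂P, ∀ y : Fin (n m j), edgeDev p (G m ω) ⟨i, x⟩ ⟨j, y⟩ = 0 := by
    refine ae_all_iff.2 fun y => ?_
    have hprob := (hG m).prob_inter ⟨i, x⟩ ⟨j, y⟩ hij
    simp only at hprob
    rcases hpij with h | h
    · rw [h, ENNReal.ofReal_zero] at hprob
      filter_upwards [measure_eq_zero_iff_ae_notMem.1 hprob] with ω hω
      have hω' : ¬ (G m ω).Adj ⟨i, x⟩ ⟨j, y⟩ := hω
      simp [edgeDev, hω', h]
    · rw [h, ENNReal.ofReal_one] at hprob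
      have hae := (mem_ae_iff_prob_eq_one ((hG m).measurable_adj ⟨i, x⟩ ⟨j, y⟩)).2 hprob
      filter_upwards [hae] with ω hω
      have hω' : (G m ω).Adj ⟨i, x⟩ ⟨j, y⟩ := hω
      simp [edgeDev, hω', h]
  filter_upwards [h] with ω hω
  exact Finset.sum_eq_zero fun y _ => hω y

end AlmostSure

/-! ### Bootstrapping the cluster sums and choosing the constants -/

section Assembly

open Matrix

variable {r : ℕ}

/-- The linear system is used twice: the crude error bound O(N) first makes the cluster sums
bounded, which is what the near-kernel argument needs to improve the error to O(ηN). -/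
theorem abs_clusterSum_le_of_events {n : Fin (r + 1) → ℕ} {p : Fin (r + 1) → Fin (r + 1) → ℝ}
    (hr : 1 ≤ r) (hp : ∀ i j, i ≠ j → p i j ∈ Set.Icc (0 : ℝ) 1 ∧ p i j = p j i)
    {g : SimpleGraph (ClusterNode n)} (hcross : CrossBound p g)
    {Y : Matrix (ClusterNode n) (Fin r) ℝ} (hY : IsSpectralSolution (graphLaplacian g) Y)
    {ε : ℝ} (hε : 0 < ε)
    (hspec : ∀ a ∈ spectrum ℂ ((breakdownMatrix n p).map (algebraMap ℝ ℂ)),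
      ∀ j : Fin (Fintype.card (ClusterNode n)), 1 ≤ (j : ℕ) → (j : ℕ) ≤ r →
        ε ≤ ‖a / (totalSize n : ℂ) -
          ((laplacianEigenvalue g j / (totalSize n : ℝ) : ℝ) : ℂ)‖)
    (hN : (r : ℝ) + 3 ≤ √(totalSize n)) {τ c T U η : ℝ}
    (hc : 0 < c) (hη : 0 ≤ η) (hcτ : 1 ≤ c ^ 2 * τ) (hT : 0 < T)
    (hTτ : 128 * r ^ 2 ≤ T ^ 2 * τ)
    (hU : 4 * (1 + T ^ 2 + 64 * r ^ 2 + r ^ 2 * (breakdownFactor r ε * (r * (2 * 8))) ^ 2) ≤ U ^ 2)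
    (hU0 : 0 ≤ U) (hUc : 8 * U ≤ η * c)
    (hlow : ∀ i j, i ≠ j → p i j ≠ 0 → p i j ≠ 1 → ∀ t : ℕ, τ / 2 * totalSize n ≤
        (Finset.univ.filter fun x => nodeDeg (innerGraph g i) x < t).card →
      r + 1 ≤ ((Finset.univ.filter fun x => nodeDeg (innerGraph g i) x < t).filter
        fun x => outDev p g i x ≤ -((2 * c + 1) * √(totalSize n))).card)
    (hproj : ∀ i j, i ≠ j → ∀ (Γ : Finset (Fin (n i))) (θ : ℤ),
      (Γᶜ.card : ℝ) ≤ τ * totalSize n → |(θ : ℝ)| ≤ 3 * totalSize n →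
      ((nearKernelIndex (shiftedRows (innerGraph g i) Γ θ) (c * √(totalSize n))).card : ℝ) ≤
        3 * τ * totalSize n →
      √(∑ a ∈ nearKernelIndex (shiftedRows (innerGraph g i) Γ θ) (c * √(totalSize n)),
        (∑ v, nearKernelBasis (shiftedRows (innerGraph g i) Γ θ) (c * √(totalSize n)) a v *
          clusterDev p g i j v) ^ 2) ≤ η * totalSize n)
    (hdev : ∀ i j, i ≠ j → (p i j = 0 ∨ p i j = 1) → ∀ x, clusterDev p g i j x = 0)
    (k : Fin (r + 1)) (j : Fin r) :
    |clusterSum (fun v => Y v j) k| ≤ r * (breakdownFactor r ε * (r * (4 * η))) := by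
  have hr0 : (0 : ℝ) ≤ r := Nat.cast_nonneg r
  have hNr : (r : ℝ) + 1 < totalSize n := by
    have h1 : (totalSize n : ℝ) = √(totalSize n) ^ 2 := (Real.sq_sqrt (Nat.cast_nonneg _)).symm
    nlinarith
  have hNpos : (0 : ℝ) < totalSize n := by linarith
  have hcardN : r + 1 < Fintype.card (ClusterNode n) := by
    rw [card_clusterNode]; exact_mod_cast hNr
  obtain ⟨W, R, Λ, hYW, hR, hW⟩ := hY.exists_eigenvectors hr (by omega)
  have key : ∀ a, |clusterSum (Wᵀ a) k| ≤ breakdownFactor r ε * (r * (4 * η)) := by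
    intro a
    obtain ⟨hw, hw1, heig, hΛ0, ⟨l, hl1, hlr, hl⟩, htrial⟩ := hW a
    have hΛ2 : Λ a ≤ 2 * totalSize n := by
      obtain ⟨v, -, hv⟩ := htrial Finset.univ (by rw [Finset.card_univ]; omega)
      have : (nodeDeg g v : ℝ) ≤ totalSize n := by
        rw [← card_clusterNode]; exact_mod_cast nodeDeg_le g v
      linarith
    have hspec' : ∀ b ∈ spectrum ℂ ((breakdownMatrix n p).map (algebraMap ℝ ℂ)),
        ε ≤ ‖b / (totalSize n : ℂ) - ((Λ a / (totalSize n : ℝ) : ℝ) : ℂ)‖ := by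
      intro b hb
      have := hspec b hb l hl1 hlr
      rwa [hl] at this
    have hbound := fun E hE => abs_clusterSum_le (E := E) hp hr hNpos hε heig
      (by rw [abs_of_nonneg hΛ0]; exact hΛ2) hw1 hspec' hE
    have hZ := hbound (r * (2 * 8)) fun i => by
      have := abs_clusterErr_le (fun i j hij => hcross.abs_sum_clusterDev_mul_le hij hw.le) i
      calc _ ≤ _ := this
        _ = _ := by ring
    refine hbound (r * (4 * η)) (fun i => ?_) k
    have := abs_clusterErr_le (p := p) (g := g) (y := Wᵀ a) (B := 2 * η * totalSize n)
      (fun i j hij => ?_) i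
    · calc _ ≤ _ := this
        _ = _ := by ring
    · by_cases hpij : p i j = 0 ∨ p i j = 1
      · simp only [hdev i j hij hpij, zero_mul, Finset.sum_const_zero, abs_zero]
        positivity
      · push Not at hpij
        refine abs_sum_clusterDev_mul_le_of_events hp hcross hw.le heig hΛ0 hΛ2 hZ hN hij hc hη hcτ
          hT hTτ hU hU0 hUc (fun S hS => ?_) (hlow i j hij hpij.1 hpij.2) (hproj i j hij)
        -- Nodes of cluster i are viewed as nodes of the whole graph, where the trial bound lives.
        obtain ⟨v, hv, hle⟩ := htrial (S.map ⟨fun x => ⟨i, x⟩, fun x y h => by simpa using h⟩)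
          (by rwa [Finset.card_map])
        obtain ⟨x, hx, rfl⟩ := Finset.mem_map.1 hv
        exact ⟨x, hx, hle⟩
  have hsum : clusterSum (fun v => Y v j) k = ∑ a, R a j * clusterSum (Wᵀ a) k := by
    simp only [clusterSum, hYW, Matrix.mul_apply, Finset.mul_sum]
    rw [Finset.sum_comm]
    exact Finset.sum_congr rfl fun a _ => Finset.sum_congr rfl fun x _ => mul_comm _ _
  rw [hsum]
  calc |∑ a, R a j * clusterSum (Wᵀ a) k| ≤ ∑ a, |R a j * clusterSum (Wᵀ a) k| :=
        Finset.abs_sum_le_sum_abs _ _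
    _ ≤ ∑ _a : Fin r, breakdownFactor r ε * (r * (4 * η)) := by
        refine Finset.sum_le_sum fun a _ => ?_
        rw [abs_mul]
        exact (mul_le_of_le_one_left (abs_nonneg _) (hR a j)).trans (key a)
    _ = _ := by simp

/-- Eventually the size ratio is at least c/2, and N is at most r + 1 times the largest size. -/
theorem eventually_mul_totalSize_le {n : ℕ → Fin (r + 1) → ℕ} {c : ℝ} (hc : 0 < c)
    (hratio : Tendsto (fun m => (minSize (n m) : ℝ) / (maxSize (n m) : ℝ)) atTop (𝓝 c)) :
    ∀ᶠ m in atTop, ∀ k, c / (2 * (r + 1)) * totalSize (n m) ≤ n m k := by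
  filter_upwards [hratio.eventually (eventually_ge_nhds (half_lt_self hc))] with m hm k
  have hmax : (0 : ℝ) < maxSize (n m) := by
    rcases Nat.eq_zero_or_pos (maxSize (n m)) with h | h
    · rw [h] at hm
      simp at hm
      linarith
    · exact_mod_cast h
  rw [le_div_iff₀ hmax] at hm
  have h1 : (minSize (n m) : ℝ) ≤ n m k := by
    exact_mod_cast Finset.inf'_le (n m) (Finset.mem_univ k)
  have h2 : (totalSize (n m) : ℝ) ≤ (r + 1) * maxSize (n m) := by
    have : totalSize (n m) ≤ ∑ _k : Fin (r + 1), maxSize (n m) :=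
      Finset.sum_le_sum fun k _ => Finset.le_sup' (n m) (Finset.mem_univ k)
    rw [Finset.sum_const, Finset.card_univ, Fintype.card_fin, smul_eq_mul] at this
    exact_mod_cast this
  calc c / (2 * (r + 1)) * totalSize (n m) ≤ c / (2 * (r + 1)) * ((r + 1) * maxSize (n m)) := by
        gcongr
    _ = c / 2 * maxSize (n m) := by field_simp
    _ ≤ n m k := hm.trans h1

theorem exists_nat_one_div_le {x : ℝ} (hx : 0 < x) : ∃ a : ℕ, 1 / ((a : ℝ) + 1) ≤ x := by
  obtain ⟨a, ha⟩ := exists_nat_one_div_lt hx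
  exact ⟨a, ha.le⟩

/-- Along the sequence the cluster sums of the spectral solutions are eventually small. -/
theorem ae_eventually_abs_clusterSum_le {Ω : Type*} [MeasurableSpace Ω] (P : Measure Ω)
    [IsProbabilityMeasure P] (hr : 1 ≤ r) {p : Fin (r + 1) → Fin (r + 1) → ℝ}
    (hp : ∀ i j, i ≠ j → p i j ∈ Set.Icc (0 : ℝ) 1 ∧ p i j = p j i) {n : ℕ → Fin (r + 1) → ℕ}
    (hn_inj : Function.Injective n)
    (hN : Tendsto (fun m => (totalSize (n m) : ℝ)) atTop atTop) {κ : ℝ} (hκ : 0 < κ)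
    (hκn : ∀ᶠ m in atTop, ∀ k, κ * totalSize (n m) ≤ n m k)
    {G : (m : ℕ) → Ω → SimpleGraph (ClusterNode (n m))} (hG : ∀ m, IsRIM P (n m) p (G m)) :
    ∀ᵐ ω ∂P, ∀ ε : ℝ, 0 < ε → (∀ᶠ m in atTop,
        ∀ a ∈ spectrum ℂ ((breakdownMatrix (n m) p).map (algebraMap ℝ ℂ)),
        ∀ j : Fin (Fintype.card (ClusterNode (n m))), 1 ≤ (j : ℕ) → (j : ℕ) ≤ r →
          ε ≤ ‖a / (totalSize (n m) : ℂ)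
            - ((laplacianEigenvalue (G m ω) j / (totalSize (n m) : ℝ) : ℝ) : ℂ)‖) →
      ∀ Y : (m : ℕ) → Matrix (ClusterNode (n m)) (Fin r) ℝ,
        (∀ m, IsSpectralSolution (graphLaplacian (G m ω)) (Y m)) →
        ∀ δ : ℝ, 0 < δ → ∀ᶠ m in atTop, ∀ k j, |clusterSum (fun v => Y m v j) k| ≤ δ := by
  have hcross := ae_eventually_crossBound hn_inj hG hp
  -- The gap ε may depend on ω, so all parameters must be chosen after the null set. They are
  -- therefore drawn from countable families.
  have hlow : ∀ᵐ ω ∂P, ∀ (b c : ℕ) (i j : Fin (r + 1)), i ≠ j → p i j ≠ 0 → p i j ≠ 1 →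
      ∀ᶠ m in atTop, ∀ t : ℕ, 1 / ((b : ℝ) + 1) / 2 * totalSize (n m) ≤
        (Finset.univ.filter fun x => nodeDeg (innerGraph (G m ω) i) x < t).card →
      r + 1 ≤ ((Finset.univ.filter fun x => nodeDeg (innerGraph (G m ω) i) x < t).filter
        fun x => outDev p (G m ω) i x ≤ -((2 * (c : ℝ) + 1) * √(totalSize (n m)))).card := by
    simp only [ae_all_iff, eventually_imp_distrib_left]
    intro b c i j hij h0 h1
    exact ae_eventually_exists_low_outDev hn_inj hG hp hN hij h0 h1 hκ
      (hκn.mono fun m hm => hm j) (by positivity) (by positivity)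
  have hproj : ∀ᵐ ω ∂P, ∀ (a b c : ℕ), 1 / ((b : ℝ) + 1) ≤ (1 / ((a : ℝ) + 1)) ^ 4 / 1024 →
      ∀ (i j : Fin (r + 1)), i ≠ j → ∀ᶠ m in atTop, ∀ (Γ : Finset (Fin (n m i))) (θ : ℤ),
      (Γᶜ.card : ℝ) ≤ 1 / ((b : ℝ) + 1) * totalSize (n m) → |(θ : ℝ)| ≤ 3 * totalSize (n m) →
      ((nearKernelIndex (shiftedRows (innerGraph (G m ω) i) Γ θ)
        ((c : ℝ) * √(totalSize (n m)))).card : ℝ) ≤ 3 * (1 / ((b : ℝ) + 1)) * totalSize (n m) →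
      √(∑ a ∈ nearKernelIndex (shiftedRows (innerGraph (G m ω) i) Γ θ)
          ((c : ℝ) * √(totalSize (n m))),
        (∑ v, nearKernelBasis (shiftedRows (innerGraph (G m ω) i) Γ θ)
          ((c : ℝ) * √(totalSize (n m))) a v * clusterDev p (G m ω) i j v) ^ 2) ≤
        1 / ((a : ℝ) + 1) * totalSize (n m) := by
    simp only [ae_all_iff]
    intro a b c hab i j hij
    refine ae_eventually_projection_le hn_inj hG hp hN hij (by positivity) ?_ hab
    rw [div_le_one (by positivity)]
    linarith [Nat.cast_nonneg (α := ℝ) a]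
  have hdev : ∀ᵐ ω ∂P, ∀ (i j : Fin (r + 1)), i ≠ j → (p i j = 0 ∨ p i j = 1) →
      ∀ m x, clusterDev p (G m ω) i j x = 0 := by
    refine ae_all_iff.2 fun i => ae_all_iff.2 fun j => ?_
    by_cases h : i ≠ j ∧ (p i j = 0 ∨ p i j = 1)
    · filter_upwards [ae_clusterDev_eq_zero hG h.1 h.2] with ω hω _ _ using hω
    · exact Eventually.of_forall fun ω hij hpij => absurd ⟨hij, hpij⟩ h
  filter_upwards [hcross, hlow, hproj, hdev] with ω hcross hlow hproj hdev ε hε hspec Y hY δ hδ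
  have hF : 0 ≤ breakdownFactor r ε := by
    rw [breakdownFactor]; positivity
  -- Order of choice: η from δ and ε, τ from η, T from τ, U from T and ε, and finally c large
  -- against U/η and 1/τ. The crude bound on the cluster sums depends on ε and r only, so there is
  -- no circularity.
  obtain ⟨a, ha⟩ := exists_nat_one_div_le
    (x := δ / (r * (breakdownFactor r ε * (r * 4)) + 1)) (by positivity)
  obtain ⟨η, hηdef⟩ : ∃ η : ℝ, η = 1 / ((a : ℝ) + 1) := ⟨_, rfl⟩
  have hη : 0 < η := by rw [hηdef]; positivity
  have hηδ : r * (breakdownFactor r ε * (r * (4 * η))) ≤ δ := by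
    rw [← hηdef, le_div_iff₀ (by positivity)] at ha
    calc r * (breakdownFactor r ε * (r * (4 * η)))
        ≤ η * (r * (breakdownFactor r ε * (r * 4)) + 1) := by linarith
      _ ≤ δ := ha
  obtain ⟨b, hb⟩ := exists_nat_one_div_le (x := (1 / ((a : ℝ) + 1)) ^ 4 / 1024) (by positivity)
  obtain ⟨τ, hτdef⟩ : ∃ τ : ℝ, τ = 1 / ((b : ℝ) + 1) := ⟨_, rfl⟩
  have hτ : 0 < τ := by rw [hτdef]; positivity
  obtain ⟨T, hT1, hTτ⟩ : ∃ T : ℝ, 1 ≤ T ∧ 128 * r ^ 2 ≤ T ^ 2 * τ := by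
    refine ⟨128 * r ^ 2 / τ + 1, by simp; positivity, ?_⟩
    have h0 : 0 ≤ 128 * (r : ℝ) ^ 2 / τ := by positivity
    calc 128 * (r : ℝ) ^ 2 = 128 * r ^ 2 / τ * τ := by field_simp
      _ ≤ (128 * r ^ 2 / τ + 1) ^ 2 * τ := by gcongr; nlinarith
  obtain ⟨U, hU0, hU⟩ : ∃ U : ℝ, 0 ≤ U ∧
      4 * (1 + T ^ 2 + 64 * r ^ 2 + r ^ 2 * (breakdownFactor r ε * (r * (2 * 8))) ^ 2) ≤
        U ^ 2 := ⟨_, Real.sqrt_nonneg _, (Real.sq_sqrt (by positivity)).ge⟩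
  obtain ⟨c, hcU⟩ := exists_nat_ge (8 * U / η + 1 / τ + 1)
  have h8 : 0 ≤ 8 * U / η := by positivity
  have h9 : 0 ≤ 1 / τ := by positivity
  have hc1 : (1 : ℝ) ≤ c := by linarith
  have hUc : 8 * U ≤ η * c := by
    have : 8 * U / η ≤ c := by linarith
    rw [div_le_iff₀ hη] at this
    linarith
  have hcτ : 1 ≤ (c : ℝ) ^ 2 * τ := by
    have : 1 / τ ≤ c := by linarith
    rw [div_le_iff₀ hτ] at this
    nlinarith
  have hlow' : ∀ᶠ m in atTop, ∀ i j, i ≠ j → p i j ≠ 0 → p i j ≠ 1 → ∀ t : ℕ,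
      τ / 2 * totalSize (n m) ≤
        (Finset.univ.filter fun x => nodeDeg (innerGraph (G m ω) i) x < t).card →
      r + 1 ≤ ((Finset.univ.filter fun x => nodeDeg (innerGraph (G m ω) i) x < t).filter
        fun x => outDev p (G m ω) i x ≤ -((2 * (c : ℝ) + 1) * √(totalSize (n m)))).card := by
    simp only [eventually_all]
    intro i j hij h0 h1
    rw [hτdef]
    exact hlow b c i j hij h0 h1
  have hproj' := fun i j hij => hproj a b c hb i j hij
  simp only [← hτdef, ← hηdef, ← eventually_imp_distrib_left, ← eventually_all] at hproj'
  filter_upwards [hcross, hlow', hproj', hspec,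
    (Real.tendsto_sqrt_atTop.comp hN).eventually_ge_atTop ((r : ℝ) + 3)]
    with m hcrossm hlowm hprojm hspecm hNm k j
  refine (abs_clusterSum_le_of_events hr hp hcrossm (hY m) hε hspecm hNm (by linarith) hη.le hcτ
    (by linarith) hTτ hU hU0 hUc hlowm hprojm (fun i j hij h => hdev i j hij h m) k j).trans hηδ

end Assembly

/-! ### The breakdown theorem -/

theorem theorem1 {Ω : Type*} [MeasurableSpace Ω] (P : Measure Ω) [IsProbabilityMeasure P]
    {r : ℕ} (hr : 1 ≤ r)
    (p : Fin (r + 1) → Fin (r + 1) → ℝ)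
    (hp : ∀ i j, i ≠ j → p i j ∈ Set.Icc (0 : ℝ) 1 ∧ p i j = p j i)
    (n : ℕ → Fin (r + 1) → ℕ)
    (hn_inj : Function.Injective n)
    (hn : ∀ k, Tendsto (fun m => n m k) atTop atTop)
    (c : ℝ) (hc : 0 < c)
    (hratio : Tendsto (fun m => (minSize (n m) : ℝ) / (maxSize (n m) : ℝ)) atTop (𝓝 c))
    (G : (m : ℕ) → Ω → SimpleGraph (ClusterNode (n m)))
    (hG : ∀ m, IsRIM P (n m) p (G m)) :
    ∀ᵐ ω ∂P,
      (∃ ε : ℝ, 0 < ε ∧ ∀ᶠ m in atTop,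
        ∀ a ∈ spectrum ℂ ((breakdownMatrix (n m) p).map (algebraMap ℝ ℂ)),
        ∀ j : Fin (Fintype.card (ClusterNode (n m))), 1 ≤ (j : ℕ) → (j : ℕ) ≤ r →
          ε ≤ ‖a / (totalSize (n m) : ℂ)
            - ((laplacianEigenvalue (G m ω) j / (totalSize (n m) : ℝ) : ℝ) : ℂ)‖) →
      ∀ Y : (m : ℕ) → Matrix (ClusterNode (n m)) (Fin r) ℝ,
        (∀ m, IsSpectralSolution (graphLaplacian (G m ω)) (Y m)) →
        (∀ k, Tendsto (fun m => (clusterBlock (Y m) k).transpose.mulVec (fun _ => (1 : ℝ)))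
          atTop (𝓝 0)) ∧
        (∀ᶠ m in atTop, ∀ s : ClusterNode (n m) → Fin (r + 1),
          IsKMeansSolution (Y m) s → ¬ RecoversClusters s) := by
  have hN : Tendsto (fun m => (totalSize (n m) : ℝ)) atTop atTop :=
    tendsto_natCast_atTop_atTop.comp (tendsto_atTop_mono (fun m => le_totalSize 0) (hn 0))
  have hκ : 0 < c / (2 * ((r : ℝ) + 1)) := by positivity
  have hκn := eventually_mul_totalSize_le hc hratio
  filter_upwards [ae_eventually_abs_clusterSum_le P hr hp hn_inj hN hκ hκn hG] with ω hω
  rintro ⟨ε, hε, hspec⟩ Y hY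
  have hsmall := hω ε hε hspec Y hY
  refine ⟨fun k => tendsto_pi_nhds.2 fun j => ?_, ?_⟩
  · have heq : (fun m => (clusterBlock (Y m) k).transpose.mulVec (fun _ => (1 : ℝ)) j) =
        fun m => clusterSum (fun v => Y m v j) k := by
      ext m
      simp [Matrix.mulVec, dotProduct, clusterSum, clusterBlock]
    rw [heq, Metric.tendsto_nhds]
    intro δ hδ
    filter_upwards [hsmall (δ / 2) (half_pos hδ)] with m hm
    rw [Real.dist_eq, Pi.zero_apply, sub_zero]
    exact (hm k j).trans_lt (half_lt_self hδ)
  · generalize c / (2 * ((r : ℝ) + 1)) = κ at *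
    -- With n_k ≥ κN the loss term of the true partition is at most r(r+1)δ²/(κN), which must stay
    -- below r/N.
    obtain ⟨δ, hδ, hδκ⟩ : ∃ δ : ℝ, 0 < δ ∧ ((r : ℝ) + 1) * δ ^ 2 < κ := by
      refine ⟨√(κ / (2 * (r + 1))), Real.sqrt_pos.2 (by positivity), ?_⟩
      rw [Real.sq_sqrt (by positivity)]
      calc ((r : ℝ) + 1) * (κ / (2 * (r + 1))) = κ / 2 := by field_simp
        _ < κ := half_lt_self hκ
    filter_upwards [hsmall δ hδ, hκn, hN.eventually_gt_atTop 0] with m hm hκm hNm s hs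
    have hpos : ∀ k, 0 < n m k := fun k => by
      have := (mul_pos hκ hNm).trans_le (hκm k)
      exact_mod_cast this
    have hYY := (isSpectralFeasible_iff.1 (hY m).1).1
    refine not_recoversClusters_of_sum_small hr hpos (fun j => ?_) ?_ hs
    · have := hYY j j
      rw [if_pos rfl] at this
      simpa [dotProduct, sq] using this
    · have hr' : (0 : ℝ) < r := by exact_mod_cast hr
      calc ∑ k, ∑ j, clusterSum (fun v => Y m v j) k ^ 2 / n m k
          ≤ ∑ _k : Fin (r + 1), ∑ _j : Fin r, δ ^ 2 / (κ * totalSize (n m)) := by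
            refine Finset.sum_le_sum fun k _ => Finset.sum_le_sum fun j _ => ?_
            have h1 : clusterSum (fun v => Y m v j) k ^ 2 ≤ δ ^ 2 :=
              sq_le_sq' (abs_le.1 (hm k j)).1 (abs_le.1 (hm k j)).2
            have := mul_pos hκ hNm
            gcongr
            exact hκm k
        _ = r / totalSize (n m) * ((((r : ℝ) + 1) * δ ^ 2) / κ) := by
            simp only [Finset.sum_const, Finset.card_univ, Fintype.card_fin, nsmul_eq_mul]
            push_cast
            field_simp
        _ < r / totalSize (n m) * 1 := by
            have : (((r : ℝ) + 1) * δ ^ 2) / κ < 1 := (div_lt_one hκ).2 hδκ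
            gcongr
        _ = _ := mul_one _
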